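/- **Classical column-sampling algorithm, 2 matrices.** For $M\in\mathbb R^{a\times b}$ let $\|M\|_{p,q}$ be the $\ell_q$-norm of the vector of $\ell_p$-norms of the rows of $M$; $\|\cdot\|_{\max}=\|\cdot\|_{\infty,\infty}$ and $\|\cdot\|_F=\|\cdot\|_{2,2}$. For a probability distribution $p$ on $\{1,\dots,q\}$ a *column-sample matrix* $S\in\mathbb R^{c\times q}$ has independent rows, each of which equals $e_k^T/\sqrt{c\,p_k}$ with probability $p_k$. The computational model is a randomized RAM with exact real numbers: integer addition, subtraction and comparison, real $+,-,\times,/,\sqrt{\cdot}$ and comparison, indirect reads and writes, drawing a uniformly random integer below a given integer, and tossing a coin with a given bias, each take unit time. Memory that does not hold the input may have arbitrary contents at the start. Let $\omega\in[2,3]$ be a matrix multiplication exponent in this model, i.e. two real $N\times N$ matrices can be multiplied exactly and deterministically in time $O(N^\omega)$. 1. *(max-norm)* There are a deterministic preprocessing routine, an algorithm and a constant $K$ such that for all $n,q,m\ge 1$, $A\in\mathbb R^{n\times q}$ and $B\in\mathbb R^{q\times m}$ the following holds. The preprocessing takes $A$ and $B$ and runs in time at most $K(nq+qm)$. Then, for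 all $\varepsilon>0$ and $\delta\in(0,\tfrac12]$ with $$1\le r:=\frac{\|A^T\|_{\infty,2}^2\,\|B\|_{\infty,2}^2}{\varepsilon^2}\le\min(n,m),$$ the algorithm, started on the preprocessed data with $\varepsilon,\delta$, runs in time at most $$K\,nm\left(\frac{\|A^T\|_{\infty,2}^2\|B\|_{\infty,2}^2}{\varepsilon^2}\right)^{\omega-2}\log\left(\frac{nm}{\delta}\right)$$ and returns a random matrix $C\in\mathbb R^{n\times m}$ with $\Pr[\|C-AB\|_{\max}\le\varepsilon]\ge 1-\delta$. Here $C$ is distributed as $AS^TSB$ for a single column-sample matrix $S$ with some number $c\ge1$ of rows and a distribution $p$, not depending on $\varepsilon,\delta$, with $p_k\propto\max_i|A_{ik}|\cdot\max_j|B_{kj}|$. 2. *(Frobenius norm)* The same holds (with another preprocessing routine, algorithm and constant) with $r:=\|A\|_F^2\|B\|_F^2/\varepsilon^2$, with running time at most $$K\,nm\left(\frac{\|A\|_F^2\|B\|_F^2}{\varepsilon^2}\right)^{\omega-2}\log\left(\frac1\delta\right),$$ with the guarantee $\Pr[\|C-AB\|_F\le\varepsilon]\ge1-\delta$, and with $p_k\propto\|A_{\bullet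 k}\|_2\,\|B_{k\bullet}\|_2$. (If all the weights vanish, $p$ may be any distribution.) -/

import Mathlib

open scoped ENNReal NNReal Matrix

noncomputable section

namespace RealRAM

/-! ### A randomized real RAM with a step count

Memory consists of one-dimensional arrays of natural numbers and two-dimensional arrays of exact
real numbers. Array names are fixed in the program text, indices are computed at run time. -/

/-- The contents of memory. -/
structure Store where
  /-- entry `i` of the integer array `a` -/
  nat : ℕ → ℕ → ℕ
  /-- entry `(i, j)` of the real array `a` -/
  real : ℕ → ℕ → ℕ → ℝ

/-- Write one integer cell. -/
def Store.setNat (s : Store) (a i v : ℕ) : Store :=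
  { s with nat := fun b k => if b = a ∧ k = i then v else s.nat b k }

/-- Write one real cell. -/
def Store.setReal (s : Store) (a i j : ℕ) (v : ℝ) : Store :=
  { s with real := fun b k l => if b = a ∧ k = i ∧ l = j then v else s.real b k l }

/-- The leading `n × m` block of the real array `a`. -/
def Store.matrix (s : Store) (a n m : ℕ) : Matrix (Fin n) (Fin m) ℝ :=
  fun i j => s.real a i j

/-- Integer expressions: constants, (indirect) reads, addition, truncated subtraction. -/
inductive NExp : Type
  | const (k : ℕ) : NExp
  | get (a : ℕ) (i : NExp) : NExp
  | add (x y : NExp) : NExp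
  | sub (x y : NExp) : NExp

/-- Real expressions: integers, (indirect) reads, the four arithmetic operations, square roots. -/
inductive RExp : Type
  | ofNat (x : NExp) : RExp
  | get (a : ℕ) (i j : NExp) : RExp
  | add (x y : RExp) : RExp
  | sub (x y : RExp) : RExp
  | mul (x y : RExp) : RExp
  | div (x y : RExp) : RExp
  | sqrt (x : RExp) : RExp

/-- Tests. -/
inductive BExp : Type
  | natLT (x y : NExp) : BExp
  | realLT (x y : RExp) : BExp
  | not (b : BExp) : BExp
  | and (b c : BExp) : BExp

/-- The value of an integer expression. -/
def NExp.eval (s : Store) : NExp → ℕ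
  | const k => k
  | get a i => s.nat a (i.eval s)
  | add x y => x.eval s + y.eval s
  | sub x y => x.eval s - y.eval s

/-- The value of a real expression. -/
def RExp.eval (s : Store) : RExp → ℝ
  | ofNat x => (x.eval s : ℝ)
  | get a i j => s.real a (i.eval s) (j.eval s)
  | add x y => x.eval s + y.eval s
  | sub x y => x.eval s - y.eval s
  | mul x y => x.eval s * y.eval s
  | div x y => x.eval s / y.eval s
  | sqrt x => Real.sqrt (x.eval s)

/-- The truth value of a test. -/
def BExp.eval (s : Store) : BExp → Prop
  | natLT x y => x.eval s < y.eval s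
  | realLT x y => x.eval s < y.eval s
  | not b => ¬ b.eval s
  | and b c => b.eval s ∧ c.eval s

/-- Programs. `randNat a i e` stores a uniformly random element of `{0, …, e - 1}` (and `0` if
`e = 0`) in cell `i` of the integer array `a`; `flip a i x` stores there the outcome of a coin that
shows `1` with probability `x` (truncated to `[0, 1]`) and `0` otherwise. -/
inductive Cmd : Type
  | setNat (a : ℕ) (i e : NExp) : Cmd
  | setReal (a : ℕ) (i j : NExp) (e : RExp) : Cmd
  | randNat (a : ℕ) (i e : NExp) : Cmd
  | flip (a : ℕ) (i : NExp) (x : RExp) : Cmd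
  | seq (c d : Cmd) : Cmd
  | ite (b : BExp) (c d : Cmd) : Cmd
  | while (b : BExp) (c : Cmd) : Cmd

/-- The uniform distribution on `{0, …, N - 1}`; the point mass at `0` if `N = 0`. -/
def uniformBelow : ℕ → PMF ℕ
  | 0 => PMF.pure 0
  | N + 1 => (PMF.uniformOfFintype (Fin (N + 1))).map Fin.val

/-- A coin with the given bias, truncated to `[0, 1]`. -/
def coin (x : ℝ) : PMF ℕ :=
  (PMF.ofFintype
    (fun b : Bool => if b then min (ENNReal.ofReal x) 1 else 1 - min (ENNReal.ofReal x) 1)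
    (by simp [add_tsub_cancel_of_le])).map (fun b => if b then 1 else 0)

/-- A configuration: the programs that are still to be executed, in order, and the memory. -/
abbrev Config : Type := List Cmd × Store

open Classical in
/-- One step of the machine. Each step executes one command or test; the expressions in it are part
of the program text, so it performs a number of operations bounded by a constant of the program. A
halted configuration stays as it is. -/
def step : Config → PMF Config
  | ([], s) => PMF.pure ([], s)
  | (Cmd.setNat a i e :: k, s) => PMF.pure (k, s.setNat a (i.eval s) (e.eval s))
  | (Cmd.setReal a i j e :: k, s) =>
      PMF.pure (k, s.setReal a (i.eval s) (j.eval s) (e.eval s))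
  | (Cmd.randNat a i e :: k, s) =>
      (uniformBelow (e.eval s)).map (fun v => (k, s.setNat a (i.eval s) v))
  | (Cmd.flip a i x :: k, s) =>
      (coin (x.eval s)).map (fun v => (k, s.setNat a (i.eval s) v))
  | (Cmd.seq c d :: k, s) => PMF.pure (c :: d :: k, s)
  | (Cmd.ite b c d :: k, s) => PMF.pure (if b.eval s then c :: k else d :: k, s)
  | (Cmd.while b c :: k, s) => PMF.pure (if b.eval s then c :: Cmd.while b c :: k else k, s)

/-- The distribution of the configuration after `t` steps. -/
def run : ℕ → Config → PMF Config
  | 0, x => PMF.pure x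
  | t + 1, x => (step x).bind (run t)

/-- Started on the memory `s`, the program `c` halts after at most `T` steps, whatever the outcomes
of its random choices, and the final memory has distribution `μ`. -/
def HaltsWith (c : Cmd) (s : Store) (T : ℝ) (μ : PMF Store) : Prop :=
  ∃ t : ℕ, (t : ℝ) ≤ T ∧ run t ([c], s) = μ.map (fun s' => ([], s'))

/-- `n × n` real matrices can be multiplied (exactly, deterministically) in time `O(n ^ ω)`. The
factors are read from the real arrays `0` and `1` and the product is left in the real array `3`;
memory that does not hold the input may have arbitrary contents at the start. -/
def MatMulExponent (ω : ℝ) : Prop :=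
  ∃ (c : Cmd) (K : ℝ), ∀ (n : ℕ) (s : Store), 0 < n → s.nat 0 0 = n →
    ∃ s' : Store, HaltsWith c s (K * (n : ℝ) ^ ω) (PMF.pure s') ∧
      s'.matrix 3 n n = s.matrix 0 n n * s.matrix 1 n n

/-- The memory holds the dimensions `n, q, m` and the matrices `A`, `B`; everything else in it is
arbitrary. -/
def HoldsInput {n q m : ℕ} (s : Store) (A : Matrix (Fin n) (Fin q) ℝ)
    (B : Matrix (Fin q) (Fin m) ℝ) : Prop :=
  s.nat 0 0 = n ∧ s.nat 0 1 = q ∧ s.nat 0 2 = m ∧ s.matrix 0 n q = A ∧ s.matrix 1 q m = B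

/-- Write the precision `ε` and the failure probability `δ` to two fixed memory cells. -/
def Store.withParams (s : Store) (ε δ : ℝ) : Store :=
  (s.setReal 2 0 0 ε).setReal 2 0 1 δ

end RealRAM

/-! ### Norms and the column-sample sketch -/

/-- The element-wise norm `‖M‖_{p,q}`: the `ℓ_q` norm of the vector of `ℓ_p` norms of the rows. -/
def elementNorm {n m : ℕ} (p q : ℝ≥0∞) (M : Matrix (Fin n) (Fin m) ℝ) : ℝ :=
  ‖WithLp.toLp q (fun j => ‖WithLp.toLp p (M j)‖)‖

/-- The `ℓ_r` norm of column `k` of `A` times the `ℓ_r` norm of row `k` of `B`. -/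
def columnRowWeight {n q m : ℕ} (r : ℝ≥0∞) (A : Matrix (Fin n) (Fin q) ℝ)
    (B : Matrix (Fin q) (Fin m) ℝ) (k : Fin q) : ℝ :=
  ‖WithLp.toLp r (fun i => A i k)‖ * ‖WithLp.toLp r (fun j => B k j)‖

/-- `p k ∝ w k`; no condition if all weights vanish. -/
def IsProportional {q : ℕ} (p : PMF (Fin q)) (w : Fin q → ℝ) : Prop :=
  ∀ k, (p k).toReal * ∑ l, w l = w k

/-- The distribution of `c` independent samples from `p`. -/
def iidSamples {q : ℕ} (p : PMF (Fin q)) (c : ℕ) : PMF (Fin c → Fin q) :=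
  PMF.ofFintype (fun j => ∏ i, p (j i)) (by
    have h : ∑ k, p k = 1 := by rw [← tsum_fintype (L := .unconditional _)]; exact p.tsum_coe
    rw [← Fintype.piFinset_univ, ← Finset.prod_univ_sum]
    simp [h])

/-- The random column-sample matrix `S ∈ ℝ^{c × q}`: the rows are independent, and each of them is
`e_kᵀ / √(c p_k)` with probability `p_k`. -/
def columnSampleSketch {q : ℕ} (p : PMF (Fin q)) (c : ℕ) : PMF (Matrix (Fin c) (Fin q) ℝ) :=
  (iidSamples p c).map (fun j => Matrix.of fun i k =>
    if k = j i then 1 / Real.sqrt (c * (p k).toReal) else 0)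

end

/-! Put `N = ‖Aᵀ‖_{ρ,2} ‖B‖_{ρ,2}` and `r = N² / ε²`, with `ρ = ∞` for the max-norm and `ρ = 2` for
the Frobenius norm. The matrix `A Sᵀ S B` is the average of `c` independent copies of the random
rank-one matrix `Z_k = A_{•k} B_{k•} / p_k`, whose mean is `A B`. Since `p_k` is proportional to the
product `w_k` of the norms of column and row `k`, each `Z_k` is bounded by `∑ w_l`, which is at most
`N` by Cauchy–Schwarz; the bound is entrywise for `ρ = ∞` and in Frobenius norm for `ρ = 2`.

In an inner product space, the average of `c` independent vectors of norm at most `N` has expected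
distance at most `N / √c` from its mean, and exchanging one sample changes this distance by at most
`2N / c`. A bounded differences argument then bounds the probability of an error above `ε` by `exp
(-c ε² / (64 N²))` as soon as `c ≥ 4 r` (`iidExp_norm_avg_sub_gt_le`). For the Frobenius norm this
is used once, in the space of all matrices; for the max-norm it is used for each entry, with a union
bound. So `c ≥ 64 r log (X / δ)` samples suffice, with `X = 1` and `X = n m` respectively.

For the running time, let `R = ⌊r⌋ ≤ min (n, m)` and take `c = 128 l R` samples with `l` of the
order of `log (X / δ)`. They form `128 l` rounds; in each, an `n × R` matrix is multiplied by an `R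
× m` matrix in `O(n m / R²)` square blocks of cost `O(R ^ ω)`, which is `O(n m r ^ (ω - 2))` in all
(`running_time_le`). Preprocessing builds an alias table in time linear in `q` (`buildAlias_runs`),
after which a sample takes constant time.

The programs are analysed with a Hoare-style calculus: `Ev` for laws of memories, `Runs` for
deterministic pieces. The given multiplication routine is a black box: its specification becomes
composable by `HaltsWith.ev`, and all private data live in arrays with names too large for it to
write to. -/

noncomputable section

namespace RealRAM

/-! ### Program logic -/

/-- The command may write to the integer array with this name. -/
def Cmd.WN : Cmd → ℕ → Prop
  | setNat a _ _, x => x = a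
  | setReal _ _ _ _, _ => False
  | randNat a _ _, x => x = a
  | flip a _ _, x => x = a
  | seq c d, x => c.WN x ∨ d.WN x
  | ite _ c d, x => c.WN x ∨ d.WN x
  | .while _ c, x => c.WN x

/-- The command may write to the real array with this name. -/
def Cmd.WR : Cmd → ℕ → Prop
  | setNat _ _ _, _ => False
  | setReal a _ _ _, x => x = a
  | randNat _ _ _, _ => False
  | flip _ _ _, _ => False
  | seq c d, x => c.WR x ∨ d.WR x
  | ite _ c d, x => c.WR x ∨ d.WR x
  | .while _ c, x => c.WR x

/-- A bound for the names of the arrays to which the command writes. -/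
def Cmd.bound : Cmd → ℕ
  | setNat a _ _ => a + 1
  | setReal a _ _ _ => a + 1
  | randNat a _ _ => a + 1
  | flip a _ _ => a + 1
  | seq c d => max c.bound d.bound
  | ite _ c d => max c.bound d.bound
  | .while _ c => c.bound

theorem Cmd.WN_lt_bound {a : ℕ} : ∀ {c : Cmd}, c.WN a → a < c.bound
  | setNat _ _ _, h | setReal _ _ _ _, h | randNat _ _ _, h | flip _ _ _, h => by
    simp_all [WN, bound]
  | seq _ _, h => h.elim (fun h => lt_max_of_lt_left (WN_lt_bound h))
      (fun h => lt_max_of_lt_right (WN_lt_bound h))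
  | ite _ _ _, h => h.elim (fun h => lt_max_of_lt_left (WN_lt_bound h))
      (fun h => lt_max_of_lt_right (WN_lt_bound h))
  | .while _ c, h => WN_lt_bound (c := c) h

theorem Cmd.WR_lt_bound {a : ℕ} : ∀ {c : Cmd}, c.WR a → a < c.bound
  | setNat _ _ _, h | setReal _ _ _ _, h | randNat _ _ _, h | flip _ _ _, h => by
    simp_all [WR, bound]
  | seq _ _, h => h.elim (fun h => lt_max_of_lt_left (WR_lt_bound h))
      (fun h => lt_max_of_lt_right (WR_lt_bound h))
  | ite _ _ _, h => h.elim (fun h => lt_max_of_lt_left (WR_lt_bound h))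
      (fun h => lt_max_of_lt_right (WR_lt_bound h))
  | .while _ c, h => WR_lt_bound (c := c) h

/-- Outside of the arrays to which `c` may write, the memories agree. -/
structure Frame (c : Cmd) (s s' : Store) : Prop where
  nat : ∀ a, ¬ c.WN a → s'.nat a = s.nat a
  real : ∀ a, ¬ c.WR a → s'.real a = s.real a

@[simp] theorem setNat_nat (s : Store) (a i v b k : ℕ) :
    (s.setNat a i v).nat b k = if b = a ∧ k = i then v else s.nat b k := rfl

@[simp] theorem setNat_real (s : Store) (a i v : ℕ) : (s.setNat a i v).real = s.real := rfl

@[simp] theorem setReal_real (s : Store) (a i j : ℕ) (v : ℝ) (b k l : ℕ) :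
    (s.setReal a i j v).real b k l = if b = a ∧ k = i ∧ l = j then v else s.real b k l := rfl

@[simp] theorem setReal_nat (s : Store) (a i j : ℕ) (v : ℝ) :
    (s.setReal a i j v).nat = s.nat := rfl

theorem setNat_nat_ne (s : Store) {a b : ℕ} (i v : ℕ) (h : b ≠ a) :
    (s.setNat a i v).nat b = s.nat b := by
  funext k; simp [h]

theorem setReal_real_ne (s : Store) {a b : ℕ} (i j : ℕ) (v : ℝ) (h : b ≠ a) :
    (s.setReal a i j v).real b = s.real b := by
  funext k l; simp [h]

/-- The claim about the pending commands of `y` makes the statement inductive: a step may unfold a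
command, but never brings in new array names. -/
theorem step_frame {x y : Config} (hy : y ∈ (step x).support) (a : ℕ) :
    ((∀ d ∈ x.1, ¬ d.WN a) → (∀ d ∈ y.1, ¬ d.WN a) ∧ y.2.nat a = x.2.nat a) ∧
    ((∀ d ∈ x.1, ¬ d.WR a) → (∀ d ∈ y.1, ¬ d.WR a) ∧ y.2.real a = x.2.real a) := by
  obtain ⟨l, s⟩ := x
  rcases l with _ | ⟨c, k⟩
  · simp only [step, PMF.support_pure, Set.mem_singleton_iff] at hy
    subst hy; simp
  cases c
  case setNat b i e =>
    simp only [step, PMF.support_pure, Set.mem_singleton_iff] at hy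
    subst hy
    simp only [List.mem_cons, forall_eq_or_imp, Cmd.WN, Cmd.WR, setNat_real]
    exact ⟨fun h => ⟨h.2, setNat_nat_ne _ _ _ h.1⟩, fun h => ⟨h.2, trivial⟩⟩
  case setReal b i j e =>
    simp only [step, PMF.support_pure, Set.mem_singleton_iff] at hy
    subst hy
    simp only [List.mem_cons, forall_eq_or_imp, Cmd.WN, Cmd.WR, setReal_nat]
    exact ⟨fun h => ⟨h.2, trivial⟩, fun h => ⟨h.2, setReal_real_ne _ _ _ _ h.1⟩⟩
  case randNat b i e =>
    simp only [step, PMF.support_map, Set.mem_image] at hy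
    obtain ⟨v, -, rfl⟩ := hy
    simp only [List.mem_cons, forall_eq_or_imp, Cmd.WN, Cmd.WR, setNat_real]
    exact ⟨fun h => ⟨h.2, setNat_nat_ne _ _ _ h.1⟩, fun h => ⟨h.2, trivial⟩⟩
  case flip b i e =>
    simp only [step, PMF.support_map, Set.mem_image] at hy
    obtain ⟨v, -, rfl⟩ := hy
    simp only [List.mem_cons, forall_eq_or_imp, Cmd.WN, Cmd.WR, setNat_real]
    exact ⟨fun h => ⟨h.2, setNat_nat_ne _ _ _ h.1⟩, fun h => ⟨h.2, trivial⟩⟩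
  case seq c d =>
    simp only [step, PMF.support_pure, Set.mem_singleton_iff] at hy
    subst hy
    simp only [List.mem_cons, forall_eq_or_imp, Cmd.WN, Cmd.WR]
    tauto
  case ite b c d =>
    simp only [step, PMF.support_pure, Set.mem_singleton_iff] at hy
    subst hy
    simp only [List.mem_cons, forall_eq_or_imp, Cmd.WN, Cmd.WR]
    split_ifs <;> simp only [List.mem_cons, forall_eq_or_imp] <;> tauto
  next b c =>
    simp only [step, PMF.support_pure, Set.mem_singleton_iff] at hy
    subst hy
    simp only [List.mem_cons, forall_eq_or_imp, Cmd.WN, Cmd.WR]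
    split_ifs <;> simp +contextual [Cmd.WN, Cmd.WR]

theorem run_frame (t : ℕ) {x y : Config} (hy : y ∈ (run t x).support) (a : ℕ) :
    ((∀ d ∈ x.1, ¬ d.WN a) → y.2.nat a = x.2.nat a) ∧
    ((∀ d ∈ x.1, ¬ d.WR a) → y.2.real a = x.2.real a) := by
  induction t generalizing x with
  | zero =>
    simp only [run, PMF.support_pure, Set.mem_singleton_iff] at hy
    subst hy; simp
  | succ t ih =>
    simp only [run, PMF.mem_support_bind_iff] at hy
    obtain ⟨z, hz, hy⟩ := hy
    have h1 := step_frame hz a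
    have h2 := ih hy
    exact ⟨fun h => (h2.1 (h1.1 h).1).trans (h1.1 h).2,
      fun h => (h2.2 (h1.2 h).1).trans (h1.2 h).2⟩

theorem bind_congr_support {α β : Type*} {μ : PMF α} {f g : α → PMF β}
    (h : ∀ a ∈ μ.support, f a = g a) : μ.bind f = μ.bind g := by
  ext b
  simp only [PMF.bind_apply]
  refine tsum_congr fun a => ?_
  by_cases ha : μ a = 0
  · simp [ha]
  · rw [h a ((PMF.mem_support_iff _ _).2 ha)]

theorem map_congr_support {α β : Type*} {μ : PMF α} {f g : α → β}
    (h : ∀ a ∈ μ.support, f a = g a) : μ.map f = μ.map g := by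
  rw [← PMF.bind_pure_comp, ← PMF.bind_pure_comp]
  exact bind_congr_support fun a ha => by simp [h a ha]

/-! ### Composable evaluation with time bounds. -/

theorem run_nil (t : ℕ) (s : Store) : run t ([], s) = PMF.pure ([], s) := by
  induction t with
  | zero => rfl
  | succ t ih => simp [run, step, ih]

/-- Started on `s`, the command `c` takes at most `T` steps and leaves a memory with distribution
`μ`, whatever is executed after it. -/
def Ev (c : Cmd) (s : Store) (T : ℕ) (μ : PMF Store) : Prop :=
  -- Halted configurations are fixed, so `run t` is constant for large `t`. Quantifying over the
  -- continuation `k` and its eventual outcome `F` lets random branches of different lengths be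
  -- composed without synchronising them.
  ∀ (k : List Cmd) (U : ℕ) (F : Store → PMF Config),
    (∀ s' ∈ μ.support, ∀ t ≥ U, run t (k, s') = F s') →
      ∀ t ≥ T + U, run t (c :: k, s) = μ.bind F

theorem Ev.mono {c s T T' μ} (h : Ev c s T μ) (hT : T ≤ T') : Ev c s T' μ :=
  fun k U F hF t ht => h k U F hF t (by omega)

theorem Ev.run_eq {c s T μ} (h : Ev c s T μ) :
    run T ([c], s) = μ.map (fun s' => ([], s')) := by
  rw [h [] 0 (fun s' => PMF.pure ([], s')) (fun s' _ t _ => run_nil t s') T (by omega),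
    ← PMF.bind_pure_comp]
  rfl

theorem Ev.haltsWith {c s T μ} (h : Ev c s T μ) {R : ℝ} (hT : (T : ℝ) ≤ R) :
    HaltsWith c s R μ :=
  ⟨T, hT, h.run_eq⟩

theorem Ev.frame {c s T μ} (h : Ev c s T μ) {s' : Store} (hs' : s' ∈ μ.support) :
    Frame c s s' := by
  have hy : (([], s') : Config) ∈ (run T ([c], s)).support := by
    rw [h.run_eq, PMF.support_map]
    exact ⟨s', hs', rfl⟩
  exact ⟨fun a ha => (run_frame T hy a).1 (by simpa using ha),
    fun a ha => (run_frame T hy a).2 (by simpa using ha)⟩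

theorem step_append (c : Cmd) (l k : List Cmd) (s : Store) :
    step (c :: l ++ k, s) = (step (c :: l, s)).map (fun y => (y.1 ++ k, y.2)) := by
  cases c <;> simp only [step, List.cons_append, PMF.map_comp, PMF.pure_map] <;> try rfl
  all_goals split_ifs <;> rfl

/-- The branches finish `l` at different times, but `k` has reached its eventual outcome after `U`
further steps in each of them, so the difference is invisible from time `t + U` on. -/
theorem run_append (t : ℕ) (l k : List Cmd) (s : Store) (U : ℕ) (F : Store → PMF Config)
    (hl : ∀ y ∈ (run t (l, s)).support, y.1 = [])
    (hF : ∀ y ∈ (run t (l, s)).support, ∀ t ≥ U, run t (k, y.2) = F y.2) :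
    ∀ t' ≥ t + U, run t' (l ++ k, s) = (run t (l, s)).bind (fun y => F y.2) := by
  induction t generalizing l s with
  | zero =>
    intro t' ht'
    simp only [run, PMF.support_pure, Set.mem_singleton_iff, forall_eq, PMF.pure_bind] at hl hF ⊢
    subst hl
    exact hF t' (by omega)
  | succ t ih =>
    intro t' ht'
    rcases l with _ | ⟨c, l⟩
    · simp only [run_nil, PMF.support_pure, Set.mem_singleton_iff, forall_eq, PMF.pure_bind] at hF ⊢
      exact hF t' (by omega)
    obtain ⟨t'', rfl⟩ : ∃ t'', t' = t'' + 1 := ⟨t' - 1, by omega⟩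
    simp only [run, PMF.mem_support_bind_iff, forall_exists_index, and_imp] at hl hF
    rw [run, run, step_append, PMF.bind_map, PMF.bind_bind]
    refine bind_congr_support fun y hy => ?_
    exact ih y.1 y.2 (fun z hz => hl z y hy hz) (fun z hz => hF z y hy hz) t'' (by omega)

/-- Makes the black-box specification of matrix multiplication usable inside a larger program. Step
counts are integers, so the real bound may be rounded down. -/
theorem HaltsWith.ev {c s R μ} (h : HaltsWith c s R μ) : Ev c s ⌊R⌋₊ μ := by
  obtain ⟨t, ht, h⟩ := h
  intro k U F hF t' ht'
  have htR : t ≤ ⌊R⌋₊ := Nat.le_floor ht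
  have := run_append t [c] k s U F
    (by rw [h, PMF.support_map]; rintro _ ⟨s', -, rfl⟩; rfl)
    (by rw [h, PMF.support_map]; rintro _ ⟨s', hs', rfl⟩; exact hF s' hs') t' (by omega)
  rw [h, PMF.bind_map] at this
  exact this

theorem Ev.atomic {c : Cmd} {s : Store} {ν : PMF Store}
    (h : ∀ k, step (c :: k, s) = ν.map (fun s' => (k, s'))) : Ev c s 1 ν := by
  intro k U F hF t ht
  obtain ⟨t, rfl⟩ : ∃ t', t = t' + 1 := ⟨t - 1, by omega⟩
  rw [run, h, PMF.bind_map]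
  exact bind_congr_support fun s' hs' => hF s' hs' t (by omega)

theorem Ev.seq {c d s T₁ T₂ μ} {ν : Store → PMF Store} (hc : Ev c s T₁ μ)
    (hd : ∀ s' ∈ μ.support, Ev d s' T₂ (ν s')) : Ev (c.seq d) s (T₁ + T₂ + 1) (μ.bind ν) := by
  intro k U F hF t ht
  obtain ⟨t, rfl⟩ : ∃ t', t = t' + 1 := ⟨t - 1, by omega⟩
  rw [run, step, PMF.pure_bind, hc (d :: k) (T₂ + U) (fun s' => (ν s').bind F) ?_ t (by omega),
    PMF.bind_bind]
  intro s' hs' t ht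
  exact hd s' hs' k U F (fun s'' hs'' => hF s'' ((PMF.mem_support_bind_iff _ _ _).2
    ⟨s', hs', hs''⟩)) t ht

theorem Ev.ite_true {b : BExp} {c d s T μ} (hb : b.eval s) (hc : Ev c s T μ) :
    Ev (.ite b c d) s (T + 1) μ := by
  intro k U F hF t ht
  obtain ⟨t, rfl⟩ : ∃ t', t = t' + 1 := ⟨t - 1, by omega⟩
  rw [run, step, if_pos hb, PMF.pure_bind]
  exact hc k U F hF t (by omega)

theorem Ev.ite_false {b : BExp} {c d s T μ} (hb : ¬ b.eval s) (hd : Ev d s T μ) :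
    Ev (.ite b c d) s (T + 1) μ := by
  intro k U F hF t ht
  obtain ⟨t, rfl⟩ : ∃ t', t = t' + 1 := ⟨t - 1, by omega⟩
  rw [run, step, if_neg hb, PMF.pure_bind]
  exact hd k U F hF t (by omega)

theorem Ev.while_true {b : BExp} {c s T₁ T₂ μ} {ν : Store → PMF Store} (hb : b.eval s)
    (hc : Ev c s T₁ μ) (hd : ∀ s' ∈ μ.support, Ev (.while b c) s' T₂ (ν s')) :
    Ev (.while b c) s (T₁ + T₂ + 1) (μ.bind ν) := by
  intro k U F hF t ht
  have h := Ev.seq hc hd k U F hF t ht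
  obtain ⟨t, rfl⟩ : ∃ t', t = t' + 1 := ⟨t - 1, by omega⟩
  rw [run, step, PMF.pure_bind] at h
  rw [run, step, if_pos hb, PMF.pure_bind, h]

theorem Ev.while_false {b : BExp} {c s} (hb : ¬ b.eval s) :
    Ev (.while b c) s 1 (PMF.pure s) :=
  Ev.atomic fun k => by simp [step, hb, PMF.pure_map]

/-- Started on `s`, the command `c` takes at most `T` steps and leaves, deterministically, a memory
with the property `Q`. -/
def Runs (c : Cmd) (s : Store) (T : ℕ) (Q : Store → Prop) : Prop :=
  ∃ s', Ev c s T (PMF.pure s') ∧ Q s'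

theorem Runs.conseq {c s T T'} {Q Q' : Store → Prop} (h : Runs c s T Q) (hT : T ≤ T')
    (hQ : ∀ s', Frame c s s' → Q s' → Q' s') : Runs c s T' Q' := by
  obtain ⟨s', h, hs⟩ := h
  exact ⟨s', h.mono hT, hQ s' (h.frame (by simp)) hs⟩

theorem Runs.mono {c s T T'} {Q : Store → Prop} (h : Runs c s T Q) (hT : T ≤ T') :
    Runs c s T' Q :=
  h.conseq hT fun _ _ => id

theorem Runs.setNat {a i e s} {Q : Store → Prop} (h : Q (s.setNat a (i.eval s) (e.eval s))) :
    Runs (.setNat a i e) s 1 Q :=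
  ⟨_, Ev.atomic fun k => by simp [step, PMF.pure_map], h⟩

theorem Runs.setReal {a i j e s} {Q : Store → Prop}
    (h : Q (s.setReal a (i.eval s) (j.eval s) (e.eval s))) :
    Runs (.setReal a i j e) s 1 Q :=
  ⟨_, Ev.atomic fun k => by simp [step, PMF.pure_map], h⟩

theorem Runs.seq {c d s T₁ T₂} {Q : Store → Prop}
    (h : Runs c s T₁ (fun s' => Runs d s' T₂ Q)) : Runs (c.seq d) s (T₁ + T₂ + 1) Q := by
  obtain ⟨s₁, h₁, s₂, h₂, hQ⟩ := h
  refine ⟨s₂, ?_, hQ⟩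
  have := Ev.seq (ν := fun _ => PMF.pure s₂) h₁ (T₂ := T₂) (d := d) (by simpa using h₂)
  simpa using this

theorem Runs.ite {b : BExp} {c d s T} {Q : Store → Prop} (hc : b.eval s → Runs c s T Q)
    (hd : ¬ b.eval s → Runs d s T Q) : Runs (.ite b c d) s (T + 1) Q := by
  by_cases hb : b.eval s
  · obtain ⟨s', h, hQ⟩ := hc hb
    exact ⟨s', h.ite_true hb, hQ⟩
  · obtain ⟨s', h, hQ⟩ := hd hb
    exact ⟨s', h.ite_false hb, hQ⟩

/-- Loop rule for exactly `N` passes. The invariant has to record only what the body changes: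
`Frame` ties each intermediate memory to the initial one. The extra `1` per pass pays for the test.
-/
theorem Runs.while {b : BExp} {c s T} {N : ℕ} (I : ℕ → Store → Prop) (h0 : I 0 s)
    (hg : ∀ i s', i ≤ N → Frame c s s' → I i s' → (b.eval s' ↔ i < N))
    (hc : ∀ i s', i < N → Frame c s s' → I i s' → Runs c s' T (I (i + 1))) :
    Runs (.while b c) s (N * (T + 1) + 1) (I N) := by
  suffices H : ∀ (r i : ℕ) (s' : Store), i + r = N → Frame c s s' → I i s' →
      Runs (.while b c) s' (r * (T + 1) + 1) (I N) from
    H N 0 s (by omega) ⟨fun _ _ => rfl, fun _ _ => rfl⟩ h0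
  intro r
  induction r with
  | zero =>
    intro i s' hi hf hI
    obtain rfl : i = N := by omega
    refine ⟨s', ?_, hI⟩
    simpa using Ev.while_false (fun hb => absurd ((hg i s' le_rfl hf hI).1 hb) (lt_irrefl _))
  | succ r ih =>
    intro i s' hi hf hI
    obtain ⟨s₁, h₁, hI₁⟩ := hc i s' (by omega) hf hI
    have hf₁ := h₁.frame (s' := s₁) (by simp)
    obtain ⟨s₂, h₂, hI₂⟩ := ih (i + 1) s₁ (by omega)
      ⟨fun a ha => (hf₁.nat a ha).trans (hf.nat a ha),
        fun a ha => (hf₁.real a ha).trans (hf.real a ha)⟩ hI₁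
    refine ⟨s₂, ?_, hI₂⟩
    have := Ev.while_true (ν := fun _ => PMF.pure s₂) ((hg i s' (by omega) hf hI).2 (by omega)) h₁
      (T₂ := r * (T + 1) + 1) (by simpa using h₂)
    rw [PMF.pure_bind] at this
    exact this.mono (by rw [Nat.succ_mul]; omega)

/-- The integer variable kept in cell `0` of the integer array `a`. -/
def nv (a : ℕ) : NExp := .get a (.const 0)

/-- The real variable kept in cell `(0, 0)` of the real array `a`. -/
def rv (a : ℕ) : RExp := .get a (.const 0) (.const 0)

/-- Assignment to an integer variable. -/
def setN (a : ℕ) (e : NExp) : Cmd := .setNat a (.const 0) e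

/-- Assignment to a real variable. -/
def setR (a : ℕ) (e : RExp) : Cmd := .setReal a (.const 0) (.const 0) e

/-- Counting loop: the variable `v` runs through the numbers less than `e`. -/
def forTo (v : ℕ) (e : NExp) (c : Cmd) : Cmd :=
  (setN v (.const 0)).seq (.while (.natLT (nv v) e) (c.seq (setN v (.add (nv v) (.const 1)))))

/-- The invariant for `i + 1` is required after the counter has been raised, which is itself a write
to memory. A pass costs the body, the increment, their sequencing and the test, hence `T + 3`. -/
theorem Runs.forTo {v : ℕ} {e : NExp} {c : Cmd} {s : Store} {T : ℕ} (N : ℕ)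
    (I : ℕ → Store → Prop) (hv : ¬ c.WN v)
    (h0 : I 0 (s.setNat v 0 0))
    (he : ∀ s', Frame (forTo v e c) s s' → e.eval s' = N)
    (hc : ∀ i s', i < N → Frame (RealRAM.forTo v e c) s s' → s'.nat v 0 = i → I i s' →
      Runs c s' T (fun s'' => I (i + 1) (s''.setNat v 0 (i + 1)))) :
    Runs (RealRAM.forTo v e c) s (N * (T + 3) + 3) (I N) := by
  have hF : ∀ s', Frame (c.seq (setN v (.add (nv v) (.const 1)))) (s.setNat v 0 0) s' →
      Frame (RealRAM.forTo v e c) s s' := by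
    intro s' hs'
    refine ⟨fun a ha => ?_, fun a ha => ?_⟩
    · have ha' : a ≠ v ∧ ¬ c.WN a := by
        exact ⟨fun h => ha (Or.inl h), fun h => ha (Or.inr (Or.inl h))⟩
      rw [hs'.nat a (by simp [Cmd.WN, setN, ha'.1, ha'.2]), setNat_nat_ne _ _ _ ha'.1]
    · have ha' : ¬ c.WR a := by
        simpa [RealRAM.forTo, setN, Cmd.WR] using ha
      rw [hs'.real a (by simp [Cmd.WR, setN, ha']), setNat_real]
  have h := Runs.while (s := s.setNat v 0 0) (b := .natLT (nv v) e) (T := T + 2) (N := N)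
    (c := c.seq (setN v (.add (nv v) (.const 1))))
    (fun i s' => s'.nat v 0 = i ∧ I i s') ⟨by simp, h0⟩ ?_ ?_
  · exact (Runs.seq (T₁ := 1) (Runs.setNat (h.conseq le_rfl fun s' _ h => h.2))).mono
      (by ring_nf; omega)
  · rintro i s' hi hf ⟨hv', hI⟩
    simp [BExp.eval, nv, NExp.eval, hv', he s' (hF s' hf)]
  · rintro i s' hi hf ⟨hv', hI⟩
    refine Runs.seq (T₁ := T) (T₂ := 1) ((hc i s' hi (hF s' hf) hv' hI).conseq le_rfl ?_)
    intro s'' hf'' hI''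
    have : s''.nat v 0 = i := by rw [hf''.nat v hv, hv']
    refine Runs.setNat ?_
    simpa [NExp.eval, nv, this] using hI''

end RealRAM

/-! ### Concentration of averages of independent vectors -/

/-- The expectation of `f` under the product of `c` copies of the weights `p`. -/
def iidExp {ι : Type*} [Fintype ι] (p : ι → ℝ) (c : ℕ) (f : (Fin c → ι) → ℝ) : ℝ :=
  ∑ x, (∏ t, p (x t)) * f x

section iidExp

variable {ι : Type*} [Fintype ι] {p : ι → ℝ}

theorem iidExp_zero (f : (Fin 0 → ι) → ℝ) : iidExp p 0 f = f Fin.elim0 := by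
  simp only [iidExp, Finset.univ_unique, Finset.sum_singleton, Finset.univ_eq_empty,
    Finset.prod_empty, one_mul]
  congr 1

theorem iidExp_succ (c : ℕ) (f : (Fin (c + 1) → ι) → ℝ) :
    iidExp p (c + 1) f =
      ∑ k, p k * iidExp p c (fun x => f (Fin.cons (α := fun _ => ι) k x)) := by
  simp only [iidExp, Finset.mul_sum]
  rw [← Fintype.sum_prod_type', ← (Fin.consEquiv (fun _ : Fin (c + 1) => ι)).sum_comp]
  refine Finset.sum_congr rfl fun x _ => ?_
  simp [Fin.consEquiv, Fin.prod_univ_succ, mul_assoc]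

theorem iidExp_add (c : ℕ) (f g : (Fin c → ι) → ℝ) :
    iidExp p c (fun x => f x + g x) = iidExp p c f + iidExp p c g := by
  simp [iidExp, mul_add, Finset.sum_add_distrib]

theorem iidExp_mul_left (c : ℕ) (a : ℝ) (f : (Fin c → ι) → ℝ) :
    iidExp p c (fun x => a * f x) = a * iidExp p c f := by
  simp [iidExp, Finset.mul_sum, mul_left_comm]

theorem iidExp_const (hp1 : ∑ k, p k = 1) (c : ℕ) (a : ℝ) :
    iidExp p c (fun _ => a) = a := by
  induction c with
  | zero => rw [iidExp_zero]
  | succ c ih => simp [iidExp_succ, ih, ← Finset.sum_mul, hp1]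

theorem iidExp_mono (hp : ∀ k, 0 ≤ p k) {c : ℕ} {f g : (Fin c → ι) → ℝ} (h : ∀ x, f x ≤ g x) :
    iidExp p c f ≤ iidExp p c g :=
  Finset.sum_le_sum fun x _ =>
    mul_le_mul_of_nonneg_left (h x) (Finset.prod_nonneg fun _ _ => hp _)

theorem iidExp_sum {κ : Type*} (s : Finset κ) (c : ℕ) (f : κ → (Fin c → ι) → ℝ) :
    iidExp p c (fun x => ∑ i ∈ s, f i x) = ∑ i ∈ s, iidExp p c (f i) := by
  simp only [iidExp, Finset.mul_sum]
  exact Finset.sum_comm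

/-- For `|y| ≤ 1` one has `exp y ≤ 1 + y + y²`; the linear term averages to zero, and `1 + a² ≤ exp
(a²)`. -/
theorem sum_mul_exp_le (hp : ∀ k, 0 ≤ p k) (hp1 : ∑ k, p k = 1) {Y : ι → ℝ} {a : ℝ}
    (ha : a ≤ 1) (hY : ∀ k, |Y k| ≤ a) (hY0 : ∑ k, p k * Y k = 0) :
    ∑ k, p k * Real.exp (Y k) ≤ Real.exp (a ^ 2) := by
  calc ∑ k, p k * Real.exp (Y k) ≤ ∑ k, (p k + p k * Y k + p k * a ^ 2) := by
        refine Finset.sum_le_sum fun k _ => ?_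
        have h1 := (abs_le.1 (Real.abs_exp_sub_one_sub_id_le ((hY k).trans ha))).2
        have h2 : Y k ^ 2 ≤ a ^ 2 := sq_le_sq.2 ((hY k).trans (le_abs_self a))
        nlinarith [hp k]
    _ = 1 + a ^ 2 := by
        rw [Finset.sum_add_distrib, Finset.sum_add_distrib, hp1, hY0, ← Finset.sum_mul, hp1]; ring
    _ ≤ Real.exp (a ^ 2) := by linarith [Real.add_one_le_exp (a ^ 2)]

open Function in
/-- The bounded differences inequality for the moment generating function. -/
theorem iidExp_exp_le [DecidableEq ι] (hp : ∀ k, 0 ≤ p k) (hp1 : ∑ k, p k = 1) {l d : ℝ}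
    (hl : 0 ≤ l) (hld : l * d ≤ 1) (c : ℕ) (f : (Fin c → ι) → ℝ)
    (hf : ∀ x t y, |f (update x t y) - f x| ≤ d) :
    iidExp p c (fun x => Real.exp (l * (f x - iidExp p c f))) ≤ Real.exp (c * (l * d) ^ 2) := by
  induction c with
  | zero => simp [iidExp_zero]
  | succ c ih =>
    -- `g` is the conditional expectation of `f` given the first sample, the first step of the Doob
    -- martingale. The remaining steps are the induction hypothesis for the section of `f` at that
    -- sample.
    set g : ι → ℝ := fun k => iidExp p c (fun x => f (Fin.cons (α := fun _ => ι) k x)) with hg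
    have hgE : iidExp p (c + 1) f = ∑ k, p k * g k := iidExp_succ c f
    set m := iidExp p (c + 1) f with hm
    have hgd : ∀ k k', |g k - g k'| ≤ d := by
      intro k k'
      have h1 : ∀ a b, g a - g b ≤ d := by
        intro a b
        have : g a ≤ iidExp p c
            (fun x => f (Fin.cons (α := fun _ => ι) b x) + d) := by
          refine iidExp_mono hp fun x => ?_
          have := hf (Fin.cons (α := fun _ => ι) b x) 0 a
          rw [Fin.update_cons_zero] at this
          linarith [(abs_le.1 this).2]
        rw [iidExp_add, iidExp_const hp1] at this
        linarith
      exact abs_le.2 ⟨by linarith [h1 k' k], h1 k k'⟩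
    have hgm : ∀ k, |l * (g k - m)| ≤ l * d := by
      intro k
      rw [abs_mul, abs_of_nonneg hl]
      refine mul_le_mul_of_nonneg_left ?_ hl
      -- Since `m` is the mean of `g`, the deviation is an average of differences, each at most `d`.
      have : g k - m = ∑ k', p k' * (g k - g k') := by
        simp only [mul_sub, Finset.sum_sub_distrib, ← Finset.sum_mul, hp1, one_mul, hgE]
      rw [this]
      calc _ ≤ ∑ k', |p k' * (g k - g k')| := Finset.abs_sum_le_sum_abs _ _
        _ ≤ ∑ k', p k' * d := Finset.sum_le_sum fun k' _ => by
            rw [abs_mul, abs_of_nonneg (hp k')]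
            exact mul_le_mul_of_nonneg_left (hgd _ _) (hp k')
        _ = d := by rw [← Finset.sum_mul, hp1, one_mul]
    rw [iidExp_succ]
    calc _ ≤ ∑ k, p k * (Real.exp (l * (g k - m)) * Real.exp (c * (l * d) ^ 2)) := by
          refine Finset.sum_le_sum fun k _ => mul_le_mul_of_nonneg_left ?_ (hp k)
          have := ih (fun x => f (Fin.cons (α := fun _ => ι) k x)) (fun x t y => by
            have := hf (Fin.cons (α := fun _ => ι) k x) t.succ y
            rwa [← Fin.cons_update] at this)
          calc _ = Real.exp (l * (g k - m)) * iidExp p c (fun x =>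
                Real.exp (l * (f (Fin.cons (α := fun _ => ι) k x) - g k))) := by
                rw [← iidExp_mul_left]
                congr 1
                funext x
                rw [← Real.exp_add]
                congr 1
                ring
            _ ≤ _ := mul_le_mul_of_nonneg_left this (Real.exp_nonneg _)
      _ = (∑ k, p k * Real.exp (l * (g k - m))) * Real.exp (c * (l * d) ^ 2) := by
          rw [Finset.sum_mul]
          exact Finset.sum_congr rfl fun k _ => by ring
      _ ≤ Real.exp ((l * d) ^ 2) * Real.exp (c * (l * d) ^ 2) := by
          refine mul_le_mul_of_nonneg_right (sum_mul_exp_le hp hp1 hld hgm ?_) (Real.exp_nonneg _)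
          calc ∑ k, p k * (l * (g k - m)) = l * (∑ k, p k * g k - m * ∑ k, p k) := by
                rw [Finset.mul_sum, ← Finset.sum_sub_distrib, Finset.mul_sum]
                exact Finset.sum_congr rfl fun k _ => by ring
            _ = 0 := by rw [hp1, ← hgE]; ring
      _ = _ := by rw [← Real.exp_add]; congr 1; push_cast; ring

/-! ### Averages of vectors in an inner product space. -/

variable {H : Type*} [NormedAddCommGroup H] [InnerProductSpace ℝ H]

/-- Independent centred vectors are orthogonal in expectation: once the first sample is split off,
the cross term is linear in `Y k` and averages to zero. -/
theorem iidExp_norm_sum_sq (hp1 : ∑ k, p k = 1) {Y : ι → H} (hY : ∑ k, p k • Y k = 0) (c : ℕ) :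
    iidExp p c (fun x => ‖∑ t, Y (x t)‖ ^ 2) = c * ∑ k, p k * ‖Y k‖ ^ 2 := by
  induction c with
  | zero => simp [iidExp_zero]
  | succ c ih =>
    rw [iidExp_succ]
    have h1 : ∀ k, iidExp p c (fun x => ‖∑ t, Y (Fin.cons (α := fun _ => ι) k x t)‖ ^ 2) =
        ‖Y k‖ ^ 2 + iidExp p c (fun x => 2 * inner ℝ (Y k) (∑ t, Y (x t))) +
          c * ∑ k, p k * ‖Y k‖ ^ 2 := by
      intro k
      rw [← ih]
      simp only [Fin.sum_univ_succ, Fin.cons_zero, Fin.cons_succ, norm_add_sq_real]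
      rw [iidExp_add, iidExp_add, iidExp_const hp1]
    simp only [h1, mul_add, Finset.sum_add_distrib, ← Finset.sum_mul, hp1]
    have h2 : ∑ k, p k * iidExp p c (fun x => 2 * inner ℝ (Y k) (∑ t, Y (x t))) = 0 := by
      simp only [← iidExp_mul_left]
      rw [← iidExp_sum]
      have : ∀ x : Fin c → ι, ∑ k, p k * (2 * inner ℝ (Y k) (∑ t, Y (x t))) = 0 := by
        intro x
        calc _ = 2 * inner ℝ (∑ k, p k • Y k) (∑ t, Y (x t)) := by
              rw [sum_inner, Finset.mul_sum]
              exact Finset.sum_congr rfl fun k _ => by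
                rw [real_inner_smul_left]; ring
          _ = 0 := by rw [hY]; simp
      simp [this, iidExp_const hp1]
    rw [h2]
    push_cast
    ring

theorem sq_iidExp_le (hp : ∀ k, 0 ≤ p k) (hp1 : ∑ k, p k = 1) (c : ℕ) (f : (Fin c → ι) → ℝ) :
    iidExp p c f ^ 2 ≤ iidExp p c (fun x => f x ^ 2) := by
  set m := iidExp p c f
  have h : 0 ≤ iidExp p c (fun x => f x ^ 2 + ((-2 * m) * f x + m ^ 2)) := by
    rw [← iidExp_const hp1 c 0]
    exact iidExp_mono hp fun x => by nlinarith [sq_nonneg (f x - m)]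
  rw [iidExp_add, iidExp_add, iidExp_mul_left, iidExp_const hp1] at h
  nlinarith

open Function Classical in
/-- The average of `c` independent vectors is close to its mean. -/
theorem iidExp_norm_avg_sub_gt_le (hp : ∀ k, 0 ≤ p k) (hp1 : ∑ k, p k = 1)
    {Z : ι → H} {N ε : ℝ} (hε : 0 < ε) (hεN : ε ≤ N) (hZ : ∀ k, ‖Z k‖ ≤ N) {c : ℕ}
    (hc : 4 * N ^ 2 ≤ c * ε ^ 2) :
    iidExp p c (fun x =>
        if ε < ‖(c : ℝ)⁻¹ • ∑ t, Z (x t) - ∑ k, p k • Z k‖ then 1 else 0) ≤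
      Real.exp (-(c * ε ^ 2 / (64 * N ^ 2))) := by
  set z := ∑ k, p k • Z k with hz
  have hN : 0 < N := hε.trans_le hεN
  have hc0 : (0 : ℝ) < c := by
    by_contra h
    have : 0 < N ^ 2 := by positivity
    nlinarith [sq_nonneg ε]
  set f : (Fin c → ι) → ℝ := fun x => ‖(c : ℝ)⁻¹ • ∑ t, Z (x t) - z‖ with hf
  set m := iidExp p c f with hm
  have hsum : ∑ k, p k • (Z k - z) = 0 := by
    simp only [smul_sub, Finset.sum_sub_distrib, ← Finset.sum_smul, hp1, one_smul, hz, sub_self]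
  have hvar : ∑ k, p k * ‖Z k - z‖ ^ 2 ≤ N ^ 2 := by
    have h1 : ∀ k, p k * ‖Z k - z‖ ^ 2 =
        p k * ‖Z k‖ ^ 2 - 2 * inner ℝ (p k • Z k) z + p k * ‖z‖ ^ 2 := fun k => by
      rw [norm_sub_sq_real, real_inner_smul_left]; ring
    simp only [h1, Finset.sum_add_distrib, Finset.sum_sub_distrib, ← Finset.mul_sum, ← sum_inner,
      ← hz, ← Finset.sum_mul, hp1, real_inner_self_eq_norm_sq]
    have h2 : ∑ k, p k * ‖Z k‖ ^ 2 ≤ ∑ k, p k * N ^ 2 := Finset.sum_le_sum fun k _ =>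
      mul_le_mul_of_nonneg_left (pow_le_pow_left₀ (norm_nonneg _) (hZ k) 2) (hp k)
    rw [← Finset.sum_mul, hp1] at h2
    nlinarith [sq_nonneg ‖z‖]
  -- Jensen and the variance bound give `m² ≤ N² / c`, and `hc` makes this at most `(ε / 2)²`. What
  -- remains is a deviation of `ε / 2` above the mean of `f`.
  have hmε : m ≤ ε / 2 := by
    have h1 : m ^ 2 ≤ N ^ 2 / c := by
      refine (sq_iidExp_le hp hp1 c f).trans ?_
      have h2 : ∀ x, f x ^ 2 = ((c : ℝ)⁻¹) ^ 2 * ‖∑ t, (Z (x t) - z)‖ ^ 2 := by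
        intro x
        have : (c : ℝ)⁻¹ • ∑ t, Z (x t) - z = (c : ℝ)⁻¹ • ∑ t, (Z (x t) - z) := by
          simp only [Finset.sum_sub_distrib, Finset.sum_const, Finset.card_univ, Fintype.card_fin,
            smul_sub]
          rw [← Nat.cast_smul_eq_nsmul ℝ, smul_smul, inv_mul_cancel₀ hc0.ne', one_smul]
        simp only [hf, this, norm_smul, mul_pow, norm_inv, Real.norm_natCast]
      simp only [h2]
      rw [iidExp_mul_left, iidExp_norm_sum_sq (Y := fun k => Z k - z) hp1 hsum]
      calc _ = (∑ k, p k * ‖Z k - z‖ ^ 2) / c := by field_simp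
        _ ≤ _ := by gcongr
    have h3 : N ^ 2 / c ≤ (ε / 2) ^ 2 := by
      rw [div_le_iff₀ hc0]; nlinarith
    exact le_of_sq_le_sq (h1.trans h3) (by positivity)
  -- With this `l` and `d = 2N / c` one gets `l d = ε / (8N) ≤ 1`. The gain `l ε / 2` is then twice
  -- the loss `c (l d)²`, and the loss equals the exponent `c ε² / (64 N²)` of the conclusion.
  set l := ε * c / (16 * N ^ 2) with hl
  set d := 2 * N / c with hd
  have hld : l * d = ε / (8 * N) := by
    rw [hl, hd]; field_simp; norm_num
  have hld1 : l * d ≤ 1 := by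
    rw [hld, div_le_one (by positivity)]; linarith
  have hl0 : 0 ≤ l := by positivity
  have hbd : ∀ x t y, |f (update x t y) - f x| ≤ d := by
    intro x t y
    refine (abs_norm_sub_norm_le _ _).trans ?_
    have h1 : ∑ i, Z (update x t y i) = ∑ i, Z (x i) + (Z y - Z (x t)) := by
      have h2 : ∀ i, Z (update x t y i) = update (fun i => Z (x i)) t (Z y) i := by
        intro i
        by_cases h : i = t
        · subst h; simp
        · simp [h]
      simp only [h2]
      rw [Finset.sum_update_of_mem (Finset.mem_univ t),
        ← Finset.add_sum_erase _ _ (Finset.mem_univ t), Finset.sdiff_singleton_eq_erase]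
      abel
    rw [h1, smul_add, sub_sub_sub_cancel_right, add_sub_cancel_left, norm_smul, norm_inv,
      Real.norm_natCast, hd, inv_mul_eq_div]
    gcongr
    exact (norm_sub_le _ _).trans (by linarith [hZ y, hZ (x t)])
  have hmain := iidExp_exp_le hp hp1 hl0 hld1 c f hbd
  -- Chernoff bound: the indicator of `ε < f x` is at most `exp (l * (f x - ε))`.
  calc _ ≤ iidExp p c (fun x => Real.exp (-(l * (ε - m))) * Real.exp (l * (f x - m))) := by
        refine iidExp_mono hp fun x => ?_
        rw [← Real.exp_add]
        split_ifs with h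
        · rw [Real.one_le_exp_iff]
          have : l * ε ≤ l * f x := mul_le_mul_of_nonneg_left h.le hl0
          linarith
        · positivity
    _ ≤ Real.exp (-(l * (ε - m))) * Real.exp (c * (l * d) ^ 2) := by
        rw [iidExp_mul_left]
        exact mul_le_mul_of_nonneg_left hmain (Real.exp_nonneg _)
    _ ≤ _ := by
        rw [← Real.exp_add]
        refine Real.exp_le_exp.2 ?_
        have h1 : l * (ε / 2) ≤ l * (ε - m) := mul_le_mul_of_nonneg_left (by linarith) hl0
        have h2 : l * (ε / 2) = 2 * (c * ε ^ 2 / (64 * N ^ 2)) := by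
          rw [hl]; field_simp; norm_num
        have h3 : c * (l * d) ^ 2 = c * ε ^ 2 / (64 * N ^ 2) := by
          rw [hld]; field_simp; norm_num
        rw [h3]; linarith

end iidExp

/-! ### The column-sample sketch -/

/-- The product `A Sᵀ S B` for the column-sample matrix that selects the columns `j`. -/
def sampledProduct {n q m c : ℕ} (p : PMF (Fin q)) (A : Matrix (Fin n) (Fin q) ℝ)
    (B : Matrix (Fin q) (Fin m) ℝ) (j : Fin c → Fin q) : Matrix (Fin n) (Fin m) ℝ :=
  fun i i' => ∑ t, A i (j t) * (B (j t) i' / (c * (p (j t)).toReal))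

/-- Each sample enters once through `Sᵀ` and once through `S`, and the two square roots multiply to
`c p_k`. Probability zero is no exception, since then both sides contain the inverse of zero. -/
theorem columnSampleSketch_map {n q m c : ℕ} (p : PMF (Fin q)) (A : Matrix (Fin n) (Fin q) ℝ)
    (B : Matrix (Fin q) (Fin m) ℝ) :
    (columnSampleSketch p c).map (fun S => A * Sᵀ * S * B) =
      (iidSamples p c).map (sampledProduct p A B) := by
  rw [columnSampleSketch, PMF.map_comp]
  congr 1
  funext j
  ext i i'
  rw [Function.comp, Matrix.mul_assoc (A * _), Matrix.mul_apply]
  refine Finset.sum_congr rfl fun t _ => ?_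
  simp only [Matrix.mul_apply, Matrix.transpose_apply, Matrix.of_apply, mul_ite, mul_zero,
    ite_mul, zero_mul, Finset.sum_ite_eq', Finset.mem_univ, if_true]
  have h : Real.sqrt (c * (p (j t)).toReal) * Real.sqrt (c * (p (j t)).toReal) =
      c * (p (j t)).toReal := Real.mul_self_sqrt (by positivity)
  generalize Real.sqrt (c * (p (j t)).toReal) = x at h ⊢
  rw [← h]
  simp only [div_eq_mul_inv, mul_inv]
  ring

theorem PMF.sum_toReal {ι : Type*} [Fintype ι] (p : PMF ι) : ∑ k, (p k).toReal = 1 := by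
  rw [← ENNReal.toReal_sum fun k _ => p.apply_ne_top k,
    ← tsum_fintype (L := .unconditional _), p.tsum_coe, ENNReal.toReal_one]

-- Passes from expectations with real weights to the measure of a `PMF`; `a` bounds the probability
-- of failure.
open Classical in
theorem le_toOuterMeasure_iidSamples {q c : ℕ} (p : PMF (Fin q)) (P : (Fin c → Fin q) → Prop)
    {a : ℝ} (h : iidExp (fun k => (p k).toReal) c (fun j => if P j then 0 else 1) ≤ a) :
    ENNReal.ofReal (1 - a) ≤ (iidSamples p c).toOuterMeasure {j | P j} := by
  have h1 : (iidSamples p c).toOuterMeasure {j | P j} =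
      ENNReal.ofReal (iidExp (fun k => (p k).toReal) c (fun j => if P j then 1 else 0)) := by
    rw [PMF.toOuterMeasure_apply_fintype, iidExp, ENNReal.ofReal_sum_of_nonneg]
    · refine Finset.sum_congr rfl fun j _ => ?_
      simp only [Set.indicator_apply, Set.mem_ofPred_eq, iidSamples, PMF.ofFintype_apply]
      split_ifs with hj
      · rw [mul_one, ← ENNReal.toReal_prod, ENNReal.ofReal_toReal]
        exact (ENNReal.prod_lt_top fun t _ => (p.apply_ne_top _).lt_top).ne
      · simp
    · intro j _
      exact mul_nonneg (Finset.prod_nonneg fun t _ => ENNReal.toReal_nonneg) (by split_ifs <;> simp)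
  rw [h1]
  refine ENNReal.ofReal_le_ofReal ?_
  have h2 := iidExp_add (p := fun k => (p k).toReal) c (fun j => if P j then 1 else 0)
    (fun j => if P j then 0 else 1)
  have h3 : ∀ j, ((if P j then 1 else 0) + (if P j then 0 else 1) : ℝ) = 1 := by
    intro j; split_ifs <;> simp
  simp only [h3, iidExp_const p.sum_toReal] at h2
  linarith

/-! ### The element-wise norms as suprema and sums of squares. -/

section norms

theorem elementNorm_top_top_le {n m : ℕ} (M : Matrix (Fin n) (Fin m) ℝ) {ε : ℝ} (hε : 0 ≤ ε) :
    elementNorm ∞ ∞ M ≤ ε ↔ ∀ i j, |M i j| ≤ ε := by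
  have h : ∀ {k : ℕ} (v : Fin k → ℝ), ‖WithLp.toLp ∞ v‖ = ‖v‖ := fun v => PiLp.norm_toLp v
  rw [elementNorm, h, pi_norm_le_iff_of_nonneg hε]
  refine forall_congr' fun i => ?_
  rw [h, norm_norm, pi_norm_le_iff_of_nonneg hε]
  simp only [Real.norm_eq_abs]

theorem elementNorm_two {n m : ℕ} (p : ℝ≥0∞) (M : Matrix (Fin n) (Fin m) ℝ) :
    elementNorm p 2 M = Real.sqrt (∑ i, ‖WithLp.toLp p (M i)‖ ^ 2) := by
  rw [elementNorm, EuclideanSpace.norm_eq]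
  congr 1
  refine Finset.sum_congr rfl fun i _ => ?_
  rw [Real.norm_eq_abs, sq_abs]

theorem norm_toLp_two_sq {ι : Type*} [Fintype ι] (v : ι → ℝ) :
    ‖WithLp.toLp 2 v‖ ^ 2 = ∑ i, v i ^ 2 := by
  rw [EuclideanSpace.norm_sq_eq]
  simp

theorem elementNorm_two_two {n m : ℕ} (M : Matrix (Fin n) (Fin m) ℝ) :
    elementNorm 2 2 M = Real.sqrt (∑ i, ∑ j, M i j ^ 2) := by
  rw [elementNorm_two]
  simp only [norm_toLp_two_sq]

theorem elementNorm_two_two_transpose {n m : ℕ} (M : Matrix (Fin n) (Fin m) ℝ) :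
    elementNorm 2 2 Mᵀ = elementNorm 2 2 M := by
  rw [elementNorm_two_two, elementNorm_two_two, Finset.sum_comm]
  rfl

theorem elementNorm_nonneg_two {n m : ℕ} (p : ℝ≥0∞) (M : Matrix (Fin n) (Fin m) ℝ) :
    0 ≤ elementNorm p 2 M := by
  rw [elementNorm_two]; positivity

end norms

/-! ### Tail bounds for the sketched product. -/

section sketch

variable {n q m : ℕ} {A : Matrix (Fin n) (Fin q) ℝ} {B : Matrix (Fin q) (Fin m) ℝ}
  {p : PMF (Fin q)} {r : ℝ≥0∞}

theorem norm_toLp_nonneg_of {ι : Type*} [Fintype ι] (hr : r = ∞ ∨ r = 2) (v : ι → ℝ) :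
    0 ≤ ‖WithLp.toLp r v‖ := by
  rcases hr with rfl | rfl <;> exact norm_nonneg _

/-- Cauchy–Schwarz over `k`; this is how the product of the two norms enters. -/
theorem sum_columnRowWeight_le :
    ∑ k, columnRowWeight r A B k ≤ elementNorm r 2 Aᵀ * elementNorm r 2 B := by
  rw [elementNorm_two, elementNorm_two]
  exact Real.sum_mul_le_sqrt_mul_sqrt _ _ _

/-- The weight of `k` is `p_k` times the total weight, so dividing by `p_k` leaves at most the total
weight. If `p_k = 0`, the quotient is `0` by convention. -/
theorem div_le_of_isProportional (hp : IsProportional p (columnRowWeight r A B)) {k : Fin q} {u : ℝ}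
    (hu : u ≤ columnRowWeight r A B k) :
    u / (p k).toReal ≤ elementNorm r 2 Aᵀ * elementNorm r 2 B := by
  have hN : 0 ≤ elementNorm r 2 Aᵀ * elementNorm r 2 B :=
    mul_nonneg (elementNorm_nonneg_two _ _) (elementNorm_nonneg_two _ _)
  rcases eq_or_ne (p k).toReal 0 with h | h
  · simpa [h] using hN
  · have h0 : 0 < (p k).toReal := lt_of_le_of_ne ENNReal.toReal_nonneg h.symm
    rw [div_le_iff₀ h0]
    rw [← hp k] at hu
    calc u ≤ _ := hu
      _ ≤ (p k).toReal * (elementNorm r 2 Aᵀ * elementNorm r 2 B) :=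
        mul_le_mul_of_nonneg_left sum_columnRowWeight_le h0.le
      _ = _ := mul_comm _ _

/-- The sketch is unbiased even where `p_k = 0`: proportionality forces the weight there, and hence
`u`, to vanish. -/
theorem toReal_mul_div_of_isProportional (hp : IsProportional p (columnRowWeight r A B))
    {k : Fin q} {u : ℝ} (hu : |u| ≤ columnRowWeight r A B k) :
    (p k).toReal * (u / (p k).toReal) = u := by
  rcases eq_or_ne (p k).toReal 0 with h | h
  · have := hp k
    rw [h, zero_mul] at this
    rw [← this] at hu
    simp [abs_nonpos_iff.1 hu]
  · field_simp

theorem abs_entry_mul_le (hr : r = ∞ ∨ r = 2) (i : Fin n) (k : Fin q) (j : Fin m) :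
    |A i k * B k j| ≤ columnRowWeight r A B k := by
  have h : ∀ {a : ℕ} (v : Fin a → ℝ) (i : Fin a), |v i| ≤ ‖WithLp.toLp r v‖ := by
    intro a v i
    rcases hr with rfl | rfl
    · exact PiLp.norm_apply_le (p := ∞) (WithLp.toLp ∞ v) i
    · exact PiLp.norm_apply_le (p := 2) (WithLp.toLp 2 v) i
  rw [abs_mul, columnRowWeight]
  exact mul_le_mul (h (fun i => A i k) i) (h (fun j => B k j) j) (abs_nonneg _)
    (norm_toLp_nonneg_of hr _)

theorem sampledProduct_apply {c : ℕ} (j : Fin c → Fin q) (i : Fin n) (i' : Fin m) :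
    sampledProduct p A B j i i' =
      (c : ℝ)⁻¹ * ∑ t, A i (j t) * B (j t) i' / (p (j t)).toReal := by
  rw [sampledProduct, Finset.mul_sum]
  refine Finset.sum_congr rfl fun t _ => ?_
  simp only [div_eq_mul_inv, mul_inv]
  ring

/-- A union bound over the `n m` entries; each entry is an average of real numbers, so the
concentration inequality is applied in `ℝ`. -/
theorem sampledProduct_max_norm (hp : IsProportional p (columnRowWeight ∞ A B)) {ε : ℝ}
    (hε : 0 < ε) (hεN : ε ≤ elementNorm ∞ 2 Aᵀ * elementNorm ∞ 2 B) {c : ℕ}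
    (hc : 4 * (elementNorm ∞ 2 Aᵀ * elementNorm ∞ 2 B) ^ 2 ≤ c * ε ^ 2) :
    ENNReal.ofReal (1 - n * m *
        Real.exp (-(c * ε ^ 2 / (64 * (elementNorm ∞ 2 Aᵀ * elementNorm ∞ 2 B) ^ 2)))) ≤
      (iidSamples p c).toOuterMeasure
        {j | elementNorm ∞ ∞ (sampledProduct p A B j - A * B) ≤ ε} := by
  classical
  refine le_toOuterMeasure_iidSamples p _ ?_
  set N := elementNorm ∞ 2 Aᵀ * elementNorm ∞ 2 B
  have key : ∀ ij : Fin n × Fin m, _ := fun ij =>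
    iidExp_norm_avg_sub_gt_le (p := fun k => (p k).toReal) (fun k => ENNReal.toReal_nonneg)
      p.sum_toReal (Z := fun k => A ij.1 k * B k ij.2 / (p k).toReal) hε hεN (fun k => by
        rw [Real.norm_eq_abs, abs_div, abs_of_nonneg (ENNReal.toReal_nonneg (a := p k))]
        exact div_le_of_isProportional hp (abs_entry_mul_le (Or.inl rfl) _ _ _)) hc
  calc _ ≤ iidExp (fun k => (p k).toReal) c (fun j => ∑ ij : Fin n × Fin m,
          if ε < ‖(c : ℝ)⁻¹ • ∑ t, A ij.1 (j t) * B (j t) ij.2 / (p (j t)).toReal -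
            ∑ k, (p k).toReal • (A ij.1 k * B k ij.2 / (p k).toReal)‖ then 1 else 0) := by
        refine iidExp_mono (fun k => ENNReal.toReal_nonneg) fun j => ?_
        have h0 : ∀ ij ∈ (Finset.univ : Finset (Fin n × Fin m)), (0 : ℝ) ≤
          if ε < ‖(c : ℝ)⁻¹ • ∑ t, A ij.1 (j t) * B (j t) ij.2 / (p (j t)).toReal -
            ∑ k, (p k).toReal • (A ij.1 k * B k ij.2 / (p k).toReal)‖ then 1 else 0 := by
          intro ij _; split_ifs <;> simp
        split_ifs with h
        · exact Finset.sum_nonneg h0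
        · rw [elementNorm_top_top_le _ hε.le] at h
          push Not at h
          obtain ⟨i, i', h⟩ := h
          refine le_trans ?_ (Finset.single_le_sum h0 (Finset.mem_univ (i, i')))
          have h2 : ∑ k, (p k).toReal • (A i k * B k i' / (p k).toReal) = (A * B) i i' := by
            rw [Matrix.mul_apply]
            exact Finset.sum_congr rfl fun k _ =>
              toReal_mul_div_of_isProportional hp (abs_entry_mul_le (Or.inl rfl) _ _ _)
          rw [Matrix.sub_apply, sampledProduct_apply] at h
          rw [h2, smul_eq_mul, Real.norm_eq_abs, if_pos h]
    _ ≤ ∑ ij : Fin n × Fin m, Real.exp (-(c * ε ^ 2 / (64 * N ^ 2))) := by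
        rw [iidExp_sum]
        exact Finset.sum_le_sum fun ij _ => key ij
    _ = _ := by simp

/-- The whole matrix is treated as one vector indexed by pairs, so no union bound is needed and no
factor `n m` appears. -/
theorem sampledProduct_frobenius_norm (hp : IsProportional p (columnRowWeight 2 A B)) {ε : ℝ}
    (hε : 0 < ε) (hεN : ε ≤ elementNorm 2 2 Aᵀ * elementNorm 2 2 B) {c : ℕ}
    (hc : 4 * (elementNorm 2 2 Aᵀ * elementNorm 2 2 B) ^ 2 ≤ c * ε ^ 2) :
    ENNReal.ofReal (1 -
        Real.exp (-(c * ε ^ 2 / (64 * (elementNorm 2 2 Aᵀ * elementNorm 2 2 B) ^ 2)))) ≤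
      (iidSamples p c).toOuterMeasure
        {j | elementNorm 2 2 (sampledProduct p A B j - A * B) ≤ ε} := by
  classical
  refine le_toOuterMeasure_iidSamples p _ ?_
  set N := elementNorm 2 2 Aᵀ * elementNorm 2 2 B
  have key :=
    iidExp_norm_avg_sub_gt_le (p := fun k => (p k).toReal) (fun k => ENNReal.toReal_nonneg)
      p.sum_toReal (Z := fun k => WithLp.toLp 2 (fun ij : Fin n × Fin m =>
        A ij.1 k * B k ij.2 / (p k).toReal)) hε hεN (fun k => by
        -- The Frobenius norm of a rank-one matrix is the product of the norms of its two factors.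
        have h1 : ‖WithLp.toLp 2 (fun ij : Fin n × Fin m =>
            A ij.1 k * B k ij.2 / (p k).toReal)‖ = columnRowWeight 2 A B k / (p k).toReal := by
          have h0 := norm_toLp_nonneg_of (Or.inr rfl : (2 : ℝ≥0∞) = ∞ ∨ (2 : ℝ≥0∞) = 2)
            (fun i => A i k)
          have h0' := norm_toLp_nonneg_of (Or.inr rfl : (2 : ℝ≥0∞) = ∞ ∨ (2 : ℝ≥0∞) = 2)
            (fun j => B k j)
          refine (sq_eq_sq₀ (norm_nonneg _)
            (div_nonneg (mul_nonneg h0 h0') ENNReal.toReal_nonneg)).1 ?_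
          rw [norm_toLp_two_sq, div_pow]
          rw [mul_pow, norm_toLp_two_sq, norm_toLp_two_sq, Finset.sum_mul_sum, Fintype.sum_prod_type]
          simp only [div_pow, mul_pow, Finset.sum_div]
        rw [h1]
        exact div_le_of_isProportional hp le_rfl) hc
  refine le_trans (iidExp_mono (fun k => ENNReal.toReal_nonneg) fun j => ?_) key
  have h2 : elementNorm 2 2 (sampledProduct p A B j - A * B) =
      ‖(c : ℝ)⁻¹ • ∑ t, (WithLp.toLp 2 (fun ij : Fin n × Fin m =>
          A ij.1 (j t) * B (j t) ij.2 / (p (j t)).toReal)) -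
        ∑ k, (p k).toReal • (WithLp.toLp 2 (fun ij : Fin n × Fin m =>
          A ij.1 k * B k ij.2 / (p k).toReal))‖ := by
    rw [elementNorm_two_two, EuclideanSpace.norm_eq, Fintype.sum_prod_type]
    congr 1
    refine Finset.sum_congr rfl fun i _ => Finset.sum_congr rfl fun i' _ => ?_
    rw [Real.norm_eq_abs, sq_abs]
    congr 1
    rw [Matrix.sub_apply, sampledProduct_apply, Matrix.mul_apply]
    simp only [PiLp.sub_apply, PiLp.smul_apply, WithLp.ofLp_sum, Finset.sum_apply, smul_eq_mul]
    congr 1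
    exact Finset.sum_congr rfl fun k _ => (toReal_mul_div_of_isProportional hp
      (abs_entry_mul_le (Or.inr rfl) _ _ _)).symm
  rw [h2]
  split_ifs <;> linarith

end sketch

/-! ### Alias tables -/

/-- The mass that the first `B` buckets of an alias table give to `k`: bucket `u` holds mass `pr u`
of `f u` and mass `1 - pr u` of `g u`. -/
def bucketMass (f g : ℕ → ℕ) (pr : ℕ → ℝ) (B k : ℕ) : ℝ :=
  ∑ u ∈ Finset.range B, ((if f u = k then pr u else 0) + (if g u = k then 1 - pr u else 0))

/-- The state of the construction of an alias table for the masses `P`: the items in `U` are still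
untouched, the mass `w` of the item `cur` is left over, and everything else is in `B` buckets. -/
structure AliasInv (q : ℕ) (P : ℕ → ℝ) (U : Finset ℕ) (B cur : ℕ) (w : ℝ) (f g : ℕ → ℕ)
    (pr : ℕ → ℝ) : Prop where
  card : B + U.card = q
  nonneg : 0 ≤ w
  -- The mass not yet in buckets equals the number of buckets still to be filled, one for each
  -- untouched item.
  sum_eq : w + ∑ k ∈ U, P k = U.card
  cur_lt : cur < q
  table : ∀ u < B, f u < q ∧ g u < q ∧ 0 ≤ pr u ∧ pr u ≤ 1
  mass : ∀ k < q, P k =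
    bucketMass f g pr B k + (if cur = k then w else 0) + (if k ∈ U then P k else 0)

open Function

theorem bucketMass_update (f g : ℕ → ℕ) (pr : ℕ → ℝ) (B k x y : ℕ) (z : ℝ) :
    bucketMass (update f B x) (update g B y) (update pr B z) (B + 1) k =
      bucketMass f g pr B k + ((if x = k then z else 0) + (if y = k then 1 - z else 0)) := by
  rw [bucketMass, Finset.sum_range_succ, bucketMass]
  simp only [update_self]
  congr 1
  refine Finset.sum_congr rfl fun u hu => ?_
  have : u ≠ B := (Finset.mem_range.1 hu).ne
  simp [this]

section

variable {q : ℕ} {P : ℕ → ℝ} {U : Finset ℕ} {B cur v : ℕ} {w : ℝ} {f g : ℕ → ℕ} {pr : ℕ → ℝ}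

/-- Each step fills one bucket from the left-over mass and the item `v`. The hypothesis `hm` is
conservation of mass per item: the two shares of the bucket and the new remainder account for the
old remainder and `P v`. -/
theorem AliasInv.step (h : AliasInv q P U B cur w f g pr) (hv : v ∈ U)
    (hw : 0 ≤ w + P v - 1) {x y cur' : ℕ} {z : ℝ}
    (hx : x < q) (hy : y < q) (hz : 0 ≤ z) (hz1 : z ≤ 1) (hcur : cur' < q)
    (hm : ∀ k, (if x = k then z else 0) + (if y = k then 1 - z else 0) +
      (if cur' = k then w + P v - 1 else 0) = (if cur = k then w else 0) +
      (if v = k then P v else 0)) :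
    AliasInv q P (U.erase v) (B + 1) cur' (w + P v - 1) (update f B x) (update g B y)
      (update pr B z) := by
  have hc := Finset.card_erase_add_one hv
  refine ⟨by have := h.card; omega, hw, ?_, hcur, ?_, ?_⟩
  · have h1 := Finset.add_sum_erase U P hv
    have h2 := h.sum_eq
    have h3 : ((U.erase v).card : ℝ) + 1 = U.card := by exact_mod_cast hc
    linarith
  · intro u hu
    by_cases hB : u = B
    · subst hB; simp [*]
    · simpa [hB] using h.table u (by omega)
  · intro k hk
    have h1 := h.mass k hk
    have h2 := hm k
    rw [bucketMass_update]
    by_cases hkv : v = k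
    · subst hkv
      simp only [hv, if_true, Finset.mem_erase, ne_eq, not_true, false_and, if_false] at h1 h2 ⊢
      linarith
    · have : k ∈ U.erase v ↔ k ∈ U := by simp [Finset.mem_erase, Ne.symm hkv]
      simp only [this, hkv, if_false] at h1 h2 ⊢
      linarith

/-- The light item goes into the bucket completely and the large remainder tops it up, giving away
`1 - P v < w`. -/
theorem AliasInv.step_light (h : AliasInv q P U B cur w f g pr) (hP : ∀ k, 0 ≤ P k) (hv : v ∈ U)
    (hU : ∀ k ∈ U, k < q) (hw : 1 < w) (hv1 : P v ≤ 1) :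
    AliasInv q P (U.erase v) (B + 1) cur (w + P v - 1) (update f B v) (update g B cur)
      (update pr B (P v)) := by
  refine h.step hv (by linarith [hP v]) (hU v hv) h.cur_lt (hP v) hv1 h.cur_lt fun k => ?_
  by_cases h1 : cur = k <;> by_cases h2 : v = k <;> simp [h1, h2]

/-- The small remainder is used up and `v` tops up the bucket, which needs `w + P v ≥ 1`. This is
clear for heavy `v`. If all untouched items are light, the others hold at most one unit each, and
`sum_eq` leaves at least one unit for `w + P v`. -/
theorem AliasInv.step_heavy (h : AliasInv q P U B cur w f g pr) (hv : v ∈ U)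
    (hU : ∀ k ∈ U, k < q) (hw : w ≤ 1) (hv1 : 1 < P v ∨ ∀ k ∈ U, P k ≤ 1) :
    AliasInv q P (U.erase v) (B + 1) v (w + P v - 1) (update f B cur) (update g B v)
      (update pr B w) := by
  have hw' : 0 ≤ w + P v - 1 := by
    rcases hv1 with h1 | h1
    · linarith [h.nonneg]
    · have h2 := Finset.add_sum_erase U P hv
      have h3 := h.sum_eq
      have h4 : ((U.erase v).card : ℝ) + 1 = U.card := by
        exact_mod_cast Finset.card_erase_add_one hv
      have h5 : ∑ k ∈ U.erase v, P k ≤ ∑ k ∈ U.erase v, (1 : ℝ) :=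
        Finset.sum_le_sum fun k hk => h1 k (Finset.mem_of_mem_erase hk)
      simp only [Finset.sum_const, nsmul_eq_mul, mul_one] at h5
      linarith
  refine h.step hv hw' h.cur_lt (hU v hv) h.nonneg hw (hU v hv) fun k => ?_
  by_cases h1 : cur = k <;> by_cases h2 : v = k <;> simp [h1, h2]

/-- If all untouched masses exceeded `1`, their sum would be at least their number, which leaves no
positive remainder in `sum_eq`. -/
theorem AliasInv.exists_light (h : AliasInv q P U B cur w f g pr) (hw : 0 < w) :
    ∃ k ∈ U, P k ≤ 1 := by
  by_contra! hc
  have h1 : ∑ k ∈ U, (1 : ℝ) ≤ ∑ k ∈ U, P k := Finset.sum_le_sum fun k hk => (hc k hk).le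
  simp only [Finset.sum_const, nsmul_eq_mul, mul_one] at h1
  linarith [h.sum_eq]

end

/-- The items that are untouched when the light items below `i` and the heavy items below `j` have
been treated. -/
def untouched (q : ℕ) (P : ℕ → ℝ) (i j : ℕ) : Finset ℕ :=
  open Classical in (Finset.range q).filter fun k => (P k ≤ 1 ∧ i ≤ k) ∨ (1 < P k ∧ j ≤ k)

theorem mem_untouched {q : ℕ} {P : ℕ → ℝ} {i j k : ℕ} :
    k ∈ untouched q P i j ↔ k < q ∧ ((P k ≤ 1 ∧ i ≤ k) ∨ (1 < P k ∧ j ≤ k)) := by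
  simp [untouched]

theorem untouched_light {q : ℕ} {P : ℕ → ℝ} {i j : ℕ} (h : P i ≤ 1) :
    untouched q P (i + 1) j = (untouched q P i j).erase i := by
  ext k
  simp only [Finset.mem_erase, mem_untouched]
  by_cases hk : k = i
  · subst hk; simp [h]
  · have : i + 1 ≤ k ↔ i ≤ k := by omega
    simp [this, hk]

theorem untouched_light_skip {q : ℕ} {P : ℕ → ℝ} {i j : ℕ} (h : 1 < P i) :
    untouched q P (i + 1) j = untouched q P i j := by
  ext k
  simp only [mem_untouched]
  by_cases hk : k = i
  · subst hk; simp [h.not_ge]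
  · have : i + 1 ≤ k ↔ i ≤ k := by omega
    simp [this]

theorem untouched_heavy {q : ℕ} {P : ℕ → ℝ} {i j : ℕ} (h : 1 < P j) :
    untouched q P i (j + 1) = (untouched q P i j).erase j := by
  ext k
  simp only [Finset.mem_erase, mem_untouched]
  by_cases hk : k = j
  · subst hk; simp [h.not_ge]
  · have : j + 1 ≤ k ↔ j ≤ k := by omega
    simp [this, hk]

theorem untouched_heavy_skip {q : ℕ} {P : ℕ → ℝ} {i j : ℕ} (h : P j ≤ 1) :
    untouched q P i (j + 1) = untouched q P i j := by
  ext k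
  simp only [mem_untouched]
  by_cases hk : k = j
  · subst hk; simp [h.not_gt]
  · have : j + 1 ≤ k ↔ j ≤ k := by omega
    simp [this]

/-- `f`, `g`, `pr` is an alias table for the masses `P` on `{0, …, q - 1}`. -/
structure IsAliasTable (q : ℕ) (P : ℕ → ℝ) (f g : ℕ → ℕ) (pr : ℕ → ℝ) : Prop where
  table : ∀ u < q, f u < q ∧ g u < q ∧ 0 ≤ pr u ∧ pr u ≤ 1
  mass : ∀ k < q, P k = bucketMass f g pr q k

/-- With no item untouched, `card` says that all buckets are filled, and `sum_eq` forces the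
remainder to be zero. -/
theorem AliasInv.isAliasTable {q : ℕ} {P : ℕ → ℝ} {B cur : ℕ} {w : ℝ} {f g : ℕ → ℕ} {pr : ℕ → ℝ}
    (h : AliasInv q P (untouched q P q q) B cur w f g pr) : IsAliasTable q P f g pr := by
  have hU : untouched q P q q = ∅ := by
    ext k
    simp only [mem_untouched, Finset.notMem_empty, iff_false]
    omega
  rw [hU] at h
  have hB : B = q := by simpa using h.card
  subst hB
  have hw : w = 0 := by simpa using h.sum_eq
  refine ⟨h.table, fun k hk => ?_⟩
  have := h.mass k hk
  simpa [hw] using this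

/-- Item `0` is a dummy holder of an empty remainder; it still counts as untouched. -/
theorem AliasInv.init {q : ℕ} {P : ℕ → ℝ} (hq : 0 < q) (hP : ∑ k ∈ Finset.range q, P k = q)
    (f g : ℕ → ℕ) (pr : ℕ → ℝ) : AliasInv q P (untouched q P 0 0) 0 0 0 f g pr := by
  have hU : untouched q P 0 0 = Finset.range q := by
    ext k
    simp [mem_untouched, le_or_gt]
  rw [hU]
  refine ⟨by simp, le_rfl, by simp [hP], hq, by simp, fun k hk => ?_⟩
  simp [bucketMass, hk]

/-! ### The law of a draw from an alias table, and of repeated draws. -/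

namespace RealRAM

/-- The outcome of a coin as a truth value. -/
def boolCoin (x : ℝ) : PMF Bool :=
  PMF.ofFintype
    (fun b : Bool => if b then min (ENNReal.ofReal x) 1 else 1 - min (ENNReal.ofReal x) 1)
    (by simp [add_tsub_cancel_of_le])

theorem coin_eq (x : ℝ) : coin x = (boolCoin x).map (fun b => if b then 1 else 0) := rfl

/-- The distribution that is sampled from an alias table. -/
theorem exists_pmf_of_isAliasTable {q : ℕ} (hq : 0 < q) {P : ℕ → ℝ} {f g : ℕ → ℕ} {pr : ℕ → ℝ}
    (h : IsAliasTable q P f g pr) :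
    ∃ p : PMF (Fin q), (∀ k, (p k).toReal = P k / q) ∧
      (uniformBelow q).bind (fun u => (coin (pr u)).map (fun b => if 0 < b then f u else g u)) =
        p.map Fin.val := by
  obtain ⟨N, rfl⟩ : ∃ N, q = N + 1 := ⟨q - 1, by omega⟩
  set F : Fin (N + 1) → Fin (N + 1) := fun u => ⟨f u, (h.table u u.2).1⟩ with hF
  set G : Fin (N + 1) → Fin (N + 1) := fun u => ⟨g u, (h.table u u.2).2.1⟩ with hG
  refine ⟨(PMF.uniformOfFintype (Fin (N + 1))).bind (fun u =>
    (boolCoin (pr u)).map (fun b => if b then F u else G u)), fun k => ?_, ?_⟩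
  · rw [PMF.bind_apply, tsum_fintype, ENNReal.toReal_sum]
    · rw [h.mass k k.2, bucketMass, Finset.sum_range, Finset.sum_div]
      refine Finset.sum_congr rfl fun u _ => ?_
      obtain ⟨-, -, h0, h1⟩ := h.table u u.2
      -- Table entries lie in `[0, 1]`, so the truncation built into the coin is inactive.
      have hm : min (ENNReal.ofReal (pr u)) 1 = ENNReal.ofReal (pr u) :=
        min_eq_left (by simpa using ENNReal.ofReal_le_ofReal h1)
      have hs : (1 : ℝ≥0∞) - ENNReal.ofReal (pr u) = ENNReal.ofReal (1 - pr u) := by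
        rw [ENNReal.ofReal_sub _ h0, ENNReal.ofReal_one]
      rw [ENNReal.toReal_mul, PMF.map_apply, tsum_fintype]
      simp only [Fintype.sum_bool, PMF.uniformOfFintype_apply, boolCoin, PMF.ofFintype_apply, hm,
        if_true, Bool.false_eq_true, if_false, hs]
      have e1 : k = F u ↔ f u = k := by rw [hF, Fin.ext_iff]; exact eq_comm
      have e2 : k = G u ↔ g u = k := by rw [hG, Fin.ext_iff]; exact eq_comm
      simp only [e1, e2]
      rw [ENNReal.toReal_add (by split_ifs <;> simp) (by split_ifs <;> simp)]
      have e3 : ∀ (Q : Prop) [Decidable Q] (y : ℝ), 0 ≤ y →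
          (if Q then ENNReal.ofReal y else 0).toReal = if Q then y else 0 := by
        intro Q _ y hy; split_ifs <;> simp [hy]
      rw [e3 _ _ h0, e3 _ _ (by linarith)]
      simp only [Fintype.card_fin, ENNReal.toReal_inv, ENNReal.toReal_natCast]
      rw [div_eq_inv_mul]
    · intro u _
      exact ENNReal.mul_ne_top (PMF.apply_ne_top _ _) (PMF.apply_ne_top _ _)
  · rw [uniformBelow, PMF.bind_map, PMF.map_bind]
    congr 1
    funext u
    simp only [Function.comp, coin_eq, PMF.map_comp]
    congr 1
    funext b
    cases b <;> simp [hF, hG]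

theorem iidSamples_zero {q : ℕ} (p : PMF (Fin q)) (j : Fin 0 → Fin q) :
    iidSamples p 0 = PMF.pure j := by
  ext x
  have : x = j := Subsingleton.elim _ _
  subst this
  simp [iidSamples]

theorem iidSamples_succ {q : ℕ} (p : PMF (Fin q)) (c : ℕ) :
    iidSamples p (c + 1) =
      p.bind fun k => (iidSamples p c).map (Fin.cons (α := fun _ => Fin q) k) := by
  ext x
  rw [PMF.bind_apply, tsum_fintype, Finset.sum_eq_single (x 0)]
  · rw [PMF.map_apply, tsum_fintype, Finset.sum_eq_single (Fin.tail x)]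
    · simp [iidSamples, Fin.prod_univ_succ, Fin.tail]
    · intro y _ hy
      rw [if_neg]
      intro h
      have := congrArg Fin.tail h
      rw [Fin.tail_cons] at this
      exact hy this.symm
    · simp
  · intro k _ hk
    rw [PMF.map_apply]
    simp only [mul_eq_zero, ENNReal.tsum_eq_zero, ite_eq_right_iff]
    right
    rintro y rfl
    simp at hk
  · simp

end RealRAM

namespace RealRAM

open Function

theorem setNat_nat_self (s : Store) (a i v : ℕ) :
    (s.setNat a i v).nat a = update (s.nat a) i v := by
  funext k
  simp [update_apply]

theorem update_eq_ite (f : ℕ → ℝ) (a : ℕ) (v : ℝ) :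
    update f a v = fun u => if u = a then v else f u := by
  funext u
  simp [update_apply]

/-! ### The programs

The programs keep their data in arrays whose names are greater than a number `M`.
Integer arrays: `M + 1`, `M + 2`, `M + 3` the dimensions `n`, `q`, `m`; `M + 4`, `M + 5` loop
variables; `M + 6`, `M + 7` the two items in the buckets of the alias table; `M + 8`, `M + 9` the
next light and heavy candidate, `M + 10` the item with left-over mass, `M + 11` the number of
buckets; `M + 12` the block size, `M + 13` the number of rounds, `M + 14` the number of samples,
`M + 15` the samples; `M + 16`, `M + 17`, `M + 18` used for sampling; `M + 19`, …, `M + 24` loop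
variables and offsets; `M + 25` the item that is put into the alias table.
Real arrays: `M + 1`, `M + 2` copies of `A`, `B`; `M + 3`, `M + 4` squared norms of columns and
rows; `M + 5` scaled masses; `M + 6` the total weight; `M + 7` the squared product of the norms,
`M + 8`, `M + 9` its factors; `M + 10` numerator of the threshold for the rounds; `M + 11` left-over
mass; `M + 12` masses of the first items in the buckets; `M + 13` powers of two; `M + 14` the
result; `M + 15` weights. -/

/-- Put the item `e` into the alias table. -/
def placeItem (M : ℕ) (e : NExp) : Cmd :=
  (setN (M + 25) e).seq <|
  (Cmd.ite (.realLT (.ofNat (.const 1)) (rv (M + 11)))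
    ((Cmd.setNat (M + 6) (nv (M + 11)) (nv (M + 25))).seq <|
      (Cmd.setNat (M + 7) (nv (M + 11)) (nv (M + 10))).seq <|
      Cmd.setReal (M + 12) (nv (M + 11)) (.const 0) (.get (M + 5) (nv (M + 25)) (.const 0)))
    ((Cmd.setNat (M + 6) (nv (M + 11)) (nv (M + 10))).seq <|
      (Cmd.setNat (M + 7) (nv (M + 11)) (nv (M + 25))).seq <|
      (Cmd.setReal (M + 12) (nv (M + 11)) (.const 0) (rv (M + 11))).seq <|
      setN (M + 10) (nv (M + 25)))).seq <|
  (setR (M + 11) (.sub (.add (rv (M + 11)) (.get (M + 5) (nv (M + 25)) (.const 0)))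
    (.ofNat (.const 1)))).seq <|
  setN (M + 11) (.add (nv (M + 11)) (.const 1))

/-- The state of the construction of the alias table, as it is kept in memory. -/
def AliasState (M q : ℕ) (P : ℕ → ℝ) (U : Finset ℕ) (s : Store) : Prop :=
  AliasInv q P U (s.nat (M + 11) 0) (s.nat (M + 10) 0) (s.real (M + 11) 0 0) (s.nat (M + 6))
    (s.nat (M + 7)) (fun u => s.real (M + 12) u 0)

/-- The program chooses between the two filling rules by comparing the remainder with `1`; `h1` and
`h2` ask that `v` suit whichever rule is chosen. -/
theorem placeItem_runs {M q : ℕ} {P : ℕ → ℝ} {U : Finset ℕ} {s : Store} {e : NExp} {v : ℕ}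
    (he : e.eval s = v) (hP0 : ∀ k, 0 ≤ P k) (hP : ∀ k < q, s.real (M + 5) k 0 = P k)
    (h : AliasState M q P U s) (hv : v ∈ U) (hU : ∀ k ∈ U, k < q)
    (h1 : 1 < s.real (M + 11) 0 0 → P v ≤ 1)
    (h2 : s.real (M + 11) 0 0 ≤ 1 → 1 < P v ∨ ∀ k ∈ U, P k ≤ 1) :
    Runs (placeItem M e) s 20 (AliasState M q P (U.erase v)) := by
  have hPv := hP v (hU v hv)
  refine Runs.mono (Runs.seq (Runs.setNat (Runs.seq (Runs.ite (T := 7) (fun hb => ?_)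
    (fun hb => ?_))))) (T := 1 + (7 + 1 + 3 + 1) + 1) (by norm_num)
  · simp [BExp.eval, RExp.eval, NExp.eval, rv] at hb
    have key := AliasInv.step_light h hP0 hv hU hb (h1 hb)
    refine Runs.mono (Runs.seq (Runs.setNat (Runs.seq (Runs.setNat (Runs.setReal
      (Runs.seq (Runs.setReal (Runs.setNat ?_)))))))) (by norm_num)
    simp only [nv, rv, NExp.eval, RExp.eval, setNat_nat, setReal_real, setNat_real, setReal_nat, he]
    simpa [AliasState, setNat_nat_self, setNat_nat_ne, update_eq_ite, hPv, he, update_apply]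
      using key
  · simp [BExp.eval, RExp.eval, NExp.eval, rv] at hb
    have key := AliasInv.step_heavy h hv hU hb (h2 hb)
    refine Runs.mono (Runs.seq (Runs.setNat (Runs.seq (Runs.setNat (Runs.seq (Runs.setReal
      (Runs.setNat (Runs.seq (Runs.setReal (Runs.setNat ?_)))))))))) (by norm_num)
    simp only [nv, rv, NExp.eval, RExp.eval, setNat_nat, setReal_real, setNat_real, setReal_nat, he]
    simpa [AliasState, setNat_nat_self, setNat_nat_ne, update_eq_ite, hPv, he, update_apply]
      using key

/-- Build the alias table for the masses in the array `M + 5`. -/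
def buildAlias (M : ℕ) : Cmd :=
  (setN (M + 8) (.const 0)).seq <| (setN (M + 9) (.const 0)).seq <|
  (setN (M + 10) (.const 0)).seq <| (setN (M + 11) (.const 0)).seq <|
  (setR (M + 11) (.ofNat (.const 0))).seq <|
  Cmd.while (.natLT (.add (nv (M + 8)) (nv (M + 9))) (.add (nv (M + 2)) (nv (M + 2)))) <|
  Cmd.ite (.and (.natLT (nv (M + 8)) (nv (M + 2)))
      (.not (.and (.not (.realLT (.ofNat (.const 1)) (rv (M + 11))))
        (.natLT (nv (M + 9)) (nv (M + 2))))))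
    ((Cmd.ite (.realLT (.ofNat (.const 1)) (.get (M + 5) (nv (M + 8)) (.const 0)))
      -- Writing to the scratch variable stands in for a command that does nothing.
      (setN (M + 25) (.const 0)) (placeItem M (nv (M + 8)))).seq <|
      setN (M + 8) (.add (nv (M + 8)) (.const 1)))
    ((Cmd.ite (.realLT (.ofNat (.const 1)) (.get (M + 5) (nv (M + 9)) (.const 0)))
      (placeItem M (nv (M + 9))) (setN (M + 25) (.const 0))).seq <|
      setN (M + 9) (.add (nv (M + 9)) (.const 1)))

theorem AliasState.congr {M q : ℕ} {P : ℕ → ℝ} {U : Finset ℕ} {s s' : Store}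
    (h : AliasState M q P U s) (h6 : s'.nat (M + 6) = s.nat (M + 6))
    (h7 : s'.nat (M + 7) = s.nat (M + 7)) (h10 : s'.nat (M + 10) = s.nat (M + 10))
    (h11 : s'.nat (M + 11) = s.nat (M + 11)) (hr : s'.real = s.real) :
    AliasState M q P U s' := by
  rw [AliasState, h6, h7, h10, h11, hr]
  exact h

/-- One pointer looks for light items and one for heavy items, skipping items of the other kind.
Each pass advances exactly one of them, so there are `2 q` passes of constant cost. -/
theorem buildAlias_runs {M q : ℕ} {P : ℕ → ℝ} {s : Store} (hq : 0 < q) (hP0 : ∀ k, 0 ≤ P k)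
    (hsum : ∑ k ∈ Finset.range q, P k = q) (hsq : s.nat (M + 2) 0 = q)
    (hP : ∀ k < q, s.real (M + 5) k 0 = P k) :
    Runs (buildAlias M) s (60 * q + 20) (fun s' =>
      IsAliasTable q P (s'.nat (M + 6)) (s'.nat (M + 7)) (fun u => s'.real (M + 12) u 0)) := by
  refine Runs.mono (Runs.seq (Runs.setNat (Runs.seq (Runs.setNat (Runs.seq (Runs.setNat
    (Runs.seq (Runs.setNat (Runs.seq (Runs.setReal ((Runs.while (N := q + q) (T := 25)
    (fun t s' => ∃ i j, s'.nat (M + 8) 0 = i ∧ s'.nat (M + 9) 0 = j ∧ i ≤ q ∧ j ≤ q ∧ i + j = t ∧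
      AliasState M q P (untouched q P i j) s') ?_ ?_ ?_).conseq le_rfl ?_)))))))))))
    (T := 1 + (1 + (1 + (1 + (1 + ((q + q) * (25 + 1) + 1) + 1) + 1) + 1) + 1) + 1) (by omega)
  · refine ⟨0, 0, by simp [NExp.eval], by simp [NExp.eval], by omega, by omega, rfl, ?_⟩
    simpa [AliasState, NExp.eval, RExp.eval, setNat_nat_ne] using AliasInv.init hq hsum _ _ _
  · rintro t s' ht hf ⟨i, j, hi, hj, hiq, hjq, hij, -⟩
    have h2 : s'.nat (M + 2) 0 = q := by
      rw [hf.nat _ (by simp [Cmd.WN, placeItem, setN, setR])]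
      simp [hsq]
    simp [BExp.eval, NExp.eval, nv, h2, hi, hj, hij]
  · rintro t s' ht hf ⟨i, j, hi, hj, hiq, hjq, hij, h⟩
    have h2 : s'.nat (M + 2) 0 = q := by
      rw [hf.nat _ (by simp [Cmd.WN, placeItem, setN, setR])]
      simp [hsq]
    have h5 : ∀ k < q, s'.real (M + 5) k 0 = P k := by
      intro k hk
      rw [hf.real _ (by simp [Cmd.WR, placeItem, setN, setR])]
      simp [hP k hk]
    have hUq : ∀ k ∈ untouched q P i j, k < q := fun k hk => (mem_untouched.1 hk).1
    refine Runs.ite (T := 24) (fun hb => ?_) (fun hb => ?_)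
    · simp [BExp.eval, NExp.eval, RExp.eval, nv, rv, h2, hi, hj] at hb
      obtain ⟨hiq', hb⟩ := hb
      refine Runs.mono (Runs.seq (T₁ := 21) (T₂ := 1) (Runs.ite (T := 20) (fun hb' => ?_)
        (fun hb' => ?_))) (by norm_num)
      · simp [BExp.eval, NExp.eval, RExp.eval, nv, hi, h5 i hiq'] at hb'
        refine Runs.mono (Runs.setNat (Runs.setNat ⟨i + 1, j, by simp [NExp.eval, nv, hi],
          by simp [hj], by omega, hjq, by omega, ?_⟩)) (by norm_num)
        rw [untouched_light_skip hb']
        exact h.congr (by simp [setNat_nat_ne]) (by simp [setNat_nat_ne])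
          (by simp [setNat_nat_ne]) (by simp [setNat_nat_ne]) (by simp)
      · simp [BExp.eval, NExp.eval, RExp.eval, nv, hi, h5 i hiq'] at hb'
        refine (placeItem_runs (v := i) (by simp [NExp.eval, nv, hi]) hP0 h5 h
          (mem_untouched.2 ⟨hiq', Or.inl ⟨hb', le_rfl⟩⟩) hUq (fun _ => hb') (fun hw => Or.inr ?_)
          ).conseq le_rfl ?_
        -- With a remainder at most `1`, a light item is used only after the heavy pointer has
        -- reached `q`; then all untouched items are light.
        · intro k hk
          have := hb hw
          rcases mem_untouched.1 hk with ⟨h1, ⟨h2, -⟩ | ⟨-, h3⟩⟩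
          · exact h2
          · omega
        · intro s₁ hf₁ h₁
          have hi₁ : s₁.nat (M + 8) 0 = i := by
            rw [hf₁.nat _ (by simp [Cmd.WN, placeItem, setN, setR]), hi]
          have hj₁ : s₁.nat (M + 9) 0 = j := by
            rw [hf₁.nat _ (by simp [Cmd.WN, placeItem, setN, setR]), hj]
          refine Runs.setNat ⟨i + 1, j, by simp [NExp.eval, nv, hi₁], by simp [hj₁], by omega, hjq,
            by omega, ?_⟩
          rw [untouched_light hb']
          exact h₁.congr (by simp [setNat_nat_ne]) (by simp [setNat_nat_ne])
            (by simp [setNat_nat_ne]) (by simp [setNat_nat_ne]) (by simp)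
    · simp [BExp.eval, NExp.eval, RExp.eval, nv, rv, h2, hi, hj] at hb
      -- A remainder above `1` leaves an untouched light item, so the light pointer would be below
      -- `q` and the test would have chosen the other branch.
      have hw : s'.real (M + 11) 0 0 ≤ 1 := by
        by_contra hw
        obtain ⟨k, hk, hk1⟩ := AliasInv.exists_light h (by linarith)
        rcases mem_untouched.1 hk with ⟨h1, ⟨-, h2⟩ | ⟨h2, -⟩⟩
        · exact hw (hb (by omega)).1
        · linarith
      have hjq' : j < q := by
        by_cases hi' : i < q
        · exact (hb hi').2
        · omega
      refine Runs.mono (Runs.seq (T₁ := 21) (T₂ := 1) (Runs.ite (T := 20) (fun hb' => ?_)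
        (fun hb' => ?_))) (by norm_num)
      · simp [BExp.eval, NExp.eval, RExp.eval, nv, hj, h5 j hjq'] at hb'
        refine (placeItem_runs (v := j) (by simp [NExp.eval, nv, hj]) hP0 h5 h
          (mem_untouched.2 ⟨hjq', Or.inr ⟨hb', le_rfl⟩⟩) hUq (fun hw' => absurd hw' hw.not_gt)
          (fun _ => Or.inl hb')).conseq le_rfl ?_
        intro s₁ hf₁ h₁
        have hi₁ : s₁.nat (M + 8) 0 = i := by
          rw [hf₁.nat _ (by simp [Cmd.WN, placeItem, setN, setR]), hi]
        have hj₁ : s₁.nat (M + 9) 0 = j := by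
          rw [hf₁.nat _ (by simp [Cmd.WN, placeItem, setN, setR]), hj]
        refine Runs.setNat ⟨i, j + 1, by simp [hi₁], by simp [NExp.eval, nv, hj₁], hiq, by omega,
          by omega, ?_⟩
        rw [untouched_heavy hb']
        exact h₁.congr (by simp [setNat_nat_ne]) (by simp [setNat_nat_ne])
          (by simp [setNat_nat_ne]) (by simp [setNat_nat_ne]) (by simp)
      · simp [BExp.eval, NExp.eval, RExp.eval, nv, hj, h5 j hjq'] at hb'
        refine Runs.mono (Runs.setNat (Runs.setNat ⟨i, j + 1, by simp [hi],
          by simp [NExp.eval, nv, hj], hiq, by omega, by omega, ?_⟩)) (by norm_num)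
        rw [untouched_heavy_skip hb']
        exact h.congr (by simp [setNat_nat_ne]) (by simp [setNat_nat_ne])
          (by simp [setNat_nat_ne]) (by simp [setNat_nat_ne]) (by simp)
  · rintro s' - ⟨i, j, -, -, hiq, hjq, hij, h⟩
    obtain rfl : i = q := by omega
    obtain rfl : j = i := by omega
    exact AliasInv.isAliasTable h

end RealRAM

namespace RealRAM

open Function

/-! ### Sampling from the alias table -/

theorem Ev.randNat (a : ℕ) (i e : NExp) (s : Store) :
    Ev (.randNat a i e) s 1 ((uniformBelow (e.eval s)).map fun v => s.setNat a (i.eval s) v) :=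
  Ev.atomic fun k => by simp [step, PMF.map_comp, Function.comp_def]

theorem Ev.flip (a : ℕ) (i : NExp) (x : RExp) (s : Store) :
    Ev (.flip a i x) s 1 ((coin (x.eval s)).map fun v => s.setNat a (i.eval s) v) :=
  Ev.atomic fun k => by simp [step, PMF.map_comp, Function.comp_def]

/-- Store the item that is determined by a random bucket and a random bit. -/
def storeSample (M : ℕ) : Cmd :=
  (Cmd.ite (.natLT (.const 0) (nv (M + 17)))
    (Cmd.setNat (M + 15) (nv (M + 18)) (.get (M + 6) (nv (M + 16))))
    (Cmd.setNat (M + 15) (nv (M + 18)) (.get (M + 7) (nv (M + 16))))).seq <|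
  setN (M + 18) (.add (nv (M + 18)) (.const 1))

/-- The memory after `storeSample`. -/
def storeSampleResult (M : ℕ) (s : Store) : Store :=
  (s.setNat (M + 15) (s.nat (M + 18) 0) (if 0 < s.nat (M + 17) 0 then
    s.nat (M + 6) (s.nat (M + 16) 0) else s.nat (M + 7) (s.nat (M + 16) 0))).setNat (M + 18) 0
      (s.nat (M + 18) 0 + 1)

theorem storeSample_ev (M : ℕ) (s : Store) :
    Ev (storeSample M) s 4 (PMF.pure (storeSampleResult M s)) := by
  have h : Runs (storeSample M) s 4 (fun s' => s' = storeSampleResult M s) := by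
    refine Runs.mono (Runs.seq (Runs.ite (T := 1) (fun hb => ?_) (fun hb => ?_)))
      (T := 2 + 1 + 1) (by norm_num)
    · simp [BExp.eval, NExp.eval, nv] at hb
      refine Runs.setNat (Runs.setNat ?_)
      simp [storeSampleResult, NExp.eval, nv, hb]
    · simp [BExp.eval, NExp.eval, nv] at hb
      refine Runs.setNat (Runs.setNat ?_)
      simp [storeSampleResult, NExp.eval, nv, hb]
  obtain ⟨s', h, rfl⟩ := h
  exact h

/-- Draw one sample. -/
def sampleOnce (M : ℕ) : Cmd :=
  (Cmd.randNat (M + 16) (.const 0) (nv (M + 2))).seq <|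
  (Cmd.flip (M + 17) (.const 0) (.get (M + 12) (nv (M + 16)) (.const 0))).seq <|
  storeSample M

theorem sampleOnce_ev {M q : ℕ} {p : PMF (Fin q)} {s : Store} {i : ℕ} (hq : s.nat (M + 2) 0 = q)
    (hi : s.nat (M + 18) 0 = i)
    (hp : (uniformBelow q).bind (fun u => (coin (s.real (M + 12) u 0)).map
      (fun b => if 0 < b then s.nat (M + 6) u else s.nat (M + 7) u)) = p.map Fin.val) :
    ∃ μ, Ev (sampleOnce M) s 8 μ ∧ μ.map (fun s' => s'.nat (M + 15) i) = p.map Fin.val ∧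
      ∀ s' ∈ μ.support, s'.nat (M + 18) 0 = i + 1 ∧
        ∀ t ≠ i, s'.nat (M + 15) t = s.nat (M + 15) t := by
  have h := Ev.seq (Ev.randNat (M + 16) (.const 0) (nv (M + 2)) s) (fun s₁ _ =>
    Ev.seq (Ev.flip (M + 17) (.const 0) (.get (M + 12) (nv (M + 16)) (.const 0)) s₁)
      (fun s₂ _ => storeSample_ev M s₂))
  refine ⟨_, h, ?_, ?_⟩
  · rw [← hp]
    simp only [PMF.map_bind, PMF.bind_map, PMF.pure_map, nv, NExp.eval, RExp.eval, hq,
      Function.comp_def]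
    congr 1
    funext u
    simp [storeSampleResult, hi, PMF.map, Function.comp_def]
  · intro s' hs'
    simp only [PMF.mem_support_bind_iff, PMF.support_map, Set.mem_image, PMF.support_pure,
      Set.mem_singleton_iff] at hs'
    obtain ⟨_, ⟨u, -, rfl⟩, _, ⟨b, -, rfl⟩, rfl⟩ := hs'
    refine ⟨by simp [storeSampleResult, hi], fun t ht => ?_⟩
    simp [storeSampleResult, hi, NExp.eval, ht]

/-- Draw as many samples as the cell `M + 14` says. -/
def sampleAll (M : ℕ) : Cmd :=
  (setN (M + 18) (.const 0)).seq <|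
  Cmd.while (.natLT (nv (M + 18)) (nv (M + 14))) (sampleOnce M)

/-- The induction carries the joint law of the cells from `i` on, together with the preservation of
the earlier cells; the latter keeps a sample in place while the next ones are drawn. -/
theorem sampleLoop_ev {M q c : ℕ} {p : PMF (Fin q)} (r : ℕ) : ∀ (i : ℕ) (s : Store), i + r = c →
    s.nat (M + 18) 0 = i → s.nat (M + 14) 0 = c → s.nat (M + 2) 0 = q →
    (uniformBelow q).bind (fun u => (coin (s.real (M + 12) u 0)).map
      (fun b => if 0 < b then s.nat (M + 6) u else s.nat (M + 7) u)) = p.map Fin.val →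
    ∃ μ, Ev (.while (.natLT (nv (M + 18)) (nv (M + 14))) (sampleOnce M)) s (r * 9 + 1) μ ∧
      μ.map (fun s' (t : Fin r) => s'.nat (M + 15) (i + t)) =
        (iidSamples p r).map (fun j t => (j t : ℕ)) ∧
      ∀ s' ∈ μ.support, ∀ t < i, s'.nat (M + 15) t = s.nat (M + 15) t := by
  induction r with
  | zero =>
    intro i s hi hsi hsc _ _
    refine ⟨PMF.pure s, ?_, ?_, by simp⟩
    · simpa using Ev.while_false (b := .natLT (nv (M + 18)) (nv (M + 14)))
        (by simp [BExp.eval, nv, NExp.eval, hsi, hsc]; omega)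
    · rw [iidSamples_zero p Fin.elim0, PMF.pure_map, PMF.pure_map]
      congr 1
      exact Subsingleton.elim _ _
  | succ r ih =>
    intro i s hi hsi hsc hsq hp
    obtain ⟨μ, hμ, hμp, hμs⟩ := sampleOnce_ev hsq hsi hp
    -- `choose` needs a law for every memory, so memories outside the support of `μ` get a dummy.
    have key : ∀ s₁, ∃ ν, s₁ ∈ μ.support →
        Ev (.while (.natLT (nv (M + 18)) (nv (M + 14))) (sampleOnce M)) s₁ (r * 9 + 1) ν ∧
        ν.map (fun s' (t : Fin r) => s'.nat (M + 15) (i + 1 + t)) =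
          (iidSamples p r).map (fun j t => (j t : ℕ)) ∧
        ∀ s' ∈ ν.support, ∀ t < i + 1, s'.nat (M + 15) t = s₁.nat (M + 15) t := by
      intro s₁
      by_cases hs₁ : s₁ ∈ μ.support
      · have hf := hμ.frame hs₁
        have hN : ∀ a, a ≠ 15 → a ≠ 16 → a ≠ 17 → a ≠ 18 → s₁.nat (M + a) = s.nat (M + a) := by
          intro a h1 h2 h3 h4
          exact hf.nat _ (by simp [Cmd.WN, sampleOnce, storeSample, setN, h1, h2, h3, h4])
        have hR : s₁.real (M + 12) = s.real (M + 12) :=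
          hf.real _ (by simp [Cmd.WR, sampleOnce, storeSample, setN])
        obtain ⟨ν, hν⟩ := ih (i + 1) s₁ (by omega) (hμs s₁ hs₁).1
          (by rw [hN 14 (by omega) (by omega) (by omega) (by omega), hsc])
          (by rw [hN 2 (by omega) (by omega) (by omega) (by omega), hsq])
          (by rw [hN 6 (by omega) (by omega) (by omega) (by omega),
            hN 7 (by omega) (by omega) (by omega) (by omega), hR, hp])
        exact ⟨ν, fun _ => hν⟩
      · exact ⟨PMF.pure s, fun h => absurd h hs₁⟩
    choose ν hν using key
    refine ⟨μ.bind ν, ?_, ?_, ?_⟩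
    · exact (Ev.while_true (by simp [BExp.eval, nv, NExp.eval, hsi, hsc]; omega) hμ
        (fun s₁ hs₁ => (hν s₁ hs₁).1)).mono (by omega)
    · have h1 : ∀ s₁ ∈ μ.support,
          (ν s₁).map (fun s' (t : Fin (r + 1)) => s'.nat (M + 15) (i + t)) =
          (iidSamples p r).map (fun j => Fin.cons (α := fun _ => ℕ) (s₁.nat (M + 15) i)
            (fun t => (j t : ℕ))) := by
        intro s₁ hs₁
        obtain ⟨-, h2, h3⟩ := hν s₁ hs₁
        have h4 : (iidSamples p r).map (fun j => Fin.cons (α := fun _ => ℕ) (s₁.nat (M + 15) i)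
            (fun t => (j t : ℕ))) = ((iidSamples p r).map (fun j t => (j t : ℕ))).map
              (Fin.cons (α := fun _ => ℕ) (s₁.nat (M + 15) i)) := by
          rw [PMF.map_comp]; rfl
        rw [h4, ← h2, PMF.map_comp]
        refine map_congr_support fun s' hs' => ?_
        funext t
        refine Fin.cases ?_ (fun t => ?_) t
        · simp [h3 s' hs' i (by omega)]
        · simp [add_assoc, add_comm 1]
      rw [PMF.map_bind, bind_congr_support h1]
      have h2 : (μ.bind fun s₁ => (iidSamples p r).map (fun j => Fin.cons (α := fun _ => ℕ)
          (s₁.nat (M + 15) i) (fun t => (j t : ℕ)))) = (μ.map (fun s' => s'.nat (M + 15) i)).bind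
          (fun x => (iidSamples p r).map (fun j => Fin.cons (α := fun _ => ℕ) x
            (fun t => (j t : ℕ)))) := by
        rw [PMF.bind_map]; rfl
      rw [h2, hμp, PMF.bind_map, iidSamples_succ, PMF.map_bind]
      congr 1
      funext k
      rw [PMF.map_comp]
      simp only [Function.comp_def]
      congr 1
      funext j t
      refine Fin.cases ?_ (fun t => ?_) t <;> simp
    · intro s' hs' t ht
      obtain ⟨s₁, hs₁, hs'⟩ := (PMF.mem_support_bind_iff _ _ _).1 hs'
      rw [(hν s₁ hs₁).2.2 s' hs' t (by omega), (hμs s₁ hs₁).2 t (by omega)]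

theorem sampleAll_ev {M q c : ℕ} {p : PMF (Fin q)} {s : Store} (hc : s.nat (M + 14) 0 = c)
    (hq : s.nat (M + 2) 0 = q)
    (hp : (uniformBelow q).bind (fun u => (coin (s.real (M + 12) u 0)).map
      (fun b => if 0 < b then s.nat (M + 6) u else s.nat (M + 7) u)) = p.map Fin.val) :
    ∃ μ, Ev (sampleAll M) s (c * 9 + 3) μ ∧
      μ.map (fun s' (t : Fin c) => s'.nat (M + 15) t) =
        (iidSamples p c).map (fun j t => (j t : ℕ)) := by
  obtain ⟨μ, h1, h2, -⟩ := sampleLoop_ev (M := M) (c := c) (p := p) c 0 (s.setNat (M + 18) 0 0) (by omega)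
    (by simp) (by simpa using hc) (by simpa using hq)
    (by simpa [setNat_nat_ne] using hp)
  refine ⟨μ, ?_, by simpa using h2⟩
  have h3 : Ev (setN (M + 18) (.const 0)) s 1 (PMF.pure (s.setNat (M + 18) 0 0)) :=
    Ev.atomic fun k => by simp [setN, step, NExp.eval, PMF.pure_map]
  have := Ev.seq (ν := fun _ => μ) h3 (T₂ := c * 9 + 1) (by simpa using h1)
  rw [PMF.pure_bind] at this
  exact this.mono (by omega)

end RealRAM

namespace RealRAM

open Function

/-! ### Preprocessing -/

/-- Combine the squares of the numbers `f 0, …, f (i - 1)` by the operation `op`. -/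
def accumulate (op : ℝ → ℝ → ℝ) (f : ℕ → ℝ) : ℕ → ℝ
  | 0 => 0
  | i + 1 => op (accumulate op f i) (f i * f i)

/-- Copy the entries `(e₁, e₂)` of the array `src` to the array `dst` and combine their squares in
the array `acc`; the variable `M + 4` runs below the variable `vo` and `M + 5` below `vi`. -/
def loadMatrix (M : ℕ) (comb : RExp → RExp → RExp) (src dst acc vo vi : ℕ) (e₁ e₂ : NExp) : Cmd :=
  forTo (M + 4) (nv vo) <|
  (Cmd.setReal acc (nv (M + 4)) (.const 0) (.ofNat (.const 0))).seq <|
  forTo (M + 5) (nv vi) <|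
  (Cmd.setReal dst e₁ e₂ (.get src e₁ e₂)).seq <|
  Cmd.setReal acc (nv (M + 4)) (.const 0) (comb (.get acc (nv (M + 4)) (.const 0))
    (.mul (.get src e₁ e₂) (.get src e₁ e₂)))

/-- The maps `ρ` and `κ` turn the outer and inner counters into row and column. They allow one
routine to traverse `A` by columns and `B` by rows; `hinj` keeps a copied entry from being
overwritten. -/
theorem loadMatrix_runs {M : ℕ} {comb : RExp → RExp → RExp} {op : ℝ → ℝ → ℝ}
    (hop : ∀ s x y, (comb x y).eval s = op (x.eval s) (y.eval s)) {src dst acc vo vi : ℕ}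
    {e₁ e₂ : NExp} {ρ κ : ℕ → ℕ → ℕ}
    (he₁ : ∀ s, e₁.eval s = ρ (s.nat (M + 4) 0) (s.nat (M + 5) 0))
    (he₂ : ∀ s, e₂.eval s = κ (s.nat (M + 4) 0) (s.nat (M + 5) 0))
    (hinj : ∀ k i k' i', ρ k i = ρ k' i' → κ k i = κ k' i' → k = k' ∧ i = i')
    (h1 : src ≠ dst) (h2 : src ≠ acc) (h3 : dst ≠ acc) (hvo4 : vo ≠ M + 4) (hvo5 : vo ≠ M + 5)
    (hvi4 : vi ≠ M + 4) (hvi5 : vi ≠ M + 5) {s : Store} {a b : ℕ} (ha : s.nat vo 0 = a)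
    (hb : s.nat vi 0 = b) :
    Runs (loadMatrix M comb src dst acc vo vi e₁ e₂) s (a * (b * 6 + 8) + 3) (fun s' =>
      (∀ k < a, ∀ i < b, s'.real dst (ρ k i) (κ k i) = s.real src (ρ k i) (κ k i)) ∧
      ∀ k < a, s'.real acc k 0 = accumulate op (fun i => s.real src (ρ k i) (κ k i)) b) := by
  refine Runs.mono (Runs.forTo (T := b * 6 + 5) a (fun x s' =>
      (∀ k < x, ∀ i < b, s'.real dst (ρ k i) (κ k i) = s.real src (ρ k i) (κ k i)) ∧
      ∀ k < x, s'.real acc k 0 = accumulate op (fun i => s.real src (ρ k i) (κ k i)) b)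
    (by simp [Cmd.WN, forTo, setN]) (by simp) ?_ ?_) (by ring_nf; omega)
  · intro s' hf
    have : s'.nat vo 0 = a := by
      rw [hf.nat _ (by simp [Cmd.WN, forTo, setN, hvo4, hvo5]), ha]
    simpa [nv, NExp.eval] using this
  · intro x s₁ hx hf hx₁ ⟨hI, hI'⟩
    have hsrc : s₁.real src = s.real src :=
      hf.real _ (by simp [Cmd.WR, forTo, setN, h1, h2])
    have hvi : s₁.nat vi 0 = b := by
      rw [hf.nat _ (by simp [Cmd.WN, forTo, setN, hvi4, hvi5]), hb]
    refine Runs.mono (Runs.seq (Runs.setReal ((Runs.forTo (T := 3) b (fun y s' =>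
      ((∀ k < x, ∀ i < b, s'.real dst (ρ k i) (κ k i) = s.real src (ρ k i) (κ k i)) ∧
        ∀ k < x, s'.real acc k 0 = accumulate op (fun i => s.real src (ρ k i) (κ k i)) b) ∧
      (∀ i < y, s'.real dst (ρ x i) (κ x i) = s.real src (ρ x i) (κ x i)) ∧
      s'.real acc x 0 = accumulate op (fun i => s.real src (ρ x i) (κ x i)) y)
      (by simp [Cmd.WN]) ?_ ?_ ?_).conseq le_rfl ?_)))
      (T := 1 + (b * (3 + 3) + 3) + 1) (by omega)
    · simp only [nv, NExp.eval, RExp.eval, hx₁, setNat_real, setReal_real, h3, false_and, if_false]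
      refine ⟨⟨hI, fun k hk => ?_⟩, by simp, by simp [accumulate]⟩
      simp [hk.ne, hI' k hk]
    · intro s₂ hf₂
      have : s₂.nat vi 0 = b := by
        rw [hf₂.nat _ (by simp [Cmd.WN, forTo, setN, hvi5]), setReal_nat, hvi]
      simpa [nv, NExp.eval] using this
    · intro y s₂ hy hf₂ hy₂ ⟨⟨hJ, hJ'⟩, hK, hK'⟩
      have hx₂ : s₂.nat (M + 4) 0 = x := by
        rw [hf₂.nat _ (by simp [Cmd.WN, forTo, setN]), setReal_nat, hx₁]
      have hsrc₂ : s₂.real src = s.real src := by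
        rw [hf₂.real _ (by simp [Cmd.WR, forTo, setN, h1, h2]), setReal_real_ne _ _ _ _ h2, hsrc]
      refine Runs.mono (Runs.seq (Runs.setReal (Runs.setReal ?_))) (by norm_num)
      simp only [nv, NExp.eval, RExp.eval, he₁, he₂, hop, hx₂, hy₂, hsrc₂, setNat_real, setReal_nat,
        setReal_real, h1, h3, h3.symm, false_and, if_false, true_and]
      refine ⟨⟨fun k hk i hi => ?_, fun k hk => ?_⟩, fun i hi => ?_, ?_⟩
      · rw [if_neg, hJ k hk i hi]
        rintro ⟨h, h'⟩
        exact hk.ne (hinj _ _ _ _ h h').1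
      · simp [hk.ne, hJ' k hk]
      · by_cases hiy : i = y
        · simp [hiy]
        · rw [if_neg, hK i (by omega)]
          rintro ⟨h, h'⟩
          exact hiy (hinj _ _ _ _ h h').2
      · simp [accumulate, hK']
    · rintro s₂ - ⟨⟨hJ, hJ'⟩, hK, hK'⟩
      simp only [setNat_real]
      refine ⟨fun k hk => ?_, fun k hk => ?_⟩
      · rcases Nat.lt_succ_iff_lt_or_eq.1 hk with hk | rfl
        · exact hJ k hk
        · exact hK
      · rcases Nat.lt_succ_iff_lt_or_eq.1 hk with hk | rfl
        · exact hJ' k hk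
        · exact hK'

/-- Compute the weights and their sum, and the sums of the squared norms. -/
def computeWeights (M : ℕ) : Cmd :=
  (setR (M + 6) (.ofNat (.const 0))).seq <| (setR (M + 8) (.ofNat (.const 0))).seq <|
  (setR (M + 9) (.ofNat (.const 0))).seq <|
  forTo (M + 4) (nv (M + 2)) <|
  (Cmd.setReal (M + 15) (nv (M + 4)) (.const 0) (.sqrt (.mul (.get (M + 3) (nv (M + 4)) (.const 0))
    (.get (M + 4) (nv (M + 4)) (.const 0))))).seq <|
  (setR (M + 6) (.add (rv (M + 6)) (.get (M + 15) (nv (M + 4)) (.const 0)))).seq <|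
  (setR (M + 8) (.add (rv (M + 8)) (.get (M + 3) (nv (M + 4)) (.const 0)))).seq <|
  setR (M + 9) (.add (rv (M + 9)) (.get (M + 4) (nv (M + 4)) (.const 0)))

theorem computeWeights_runs {M q : ℕ} {s : Store} {a b : ℕ → ℝ} (hq : s.nat (M + 2) 0 = q)
    (ha : ∀ k < q, s.real (M + 3) k 0 = a k) (hb : ∀ k < q, s.real (M + 4) k 0 = b k) :
    Runs (computeWeights M) s (q * 10 + 20) (fun s' =>
      s'.real (M + 6) 0 0 = ∑ k ∈ Finset.range q, Real.sqrt (a k * b k) ∧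
      s'.real (M + 8) 0 0 = ∑ k ∈ Finset.range q, a k ∧
      s'.real (M + 9) 0 0 = ∑ k ∈ Finset.range q, b k ∧
      ∀ k < q, s'.real (M + 15) k 0 = Real.sqrt (a k * b k)) := by
  refine Runs.mono (Runs.seq (Runs.setReal (Runs.seq (Runs.setReal (Runs.seq (Runs.setReal
    (Runs.forTo (T := 7) q (fun x s' =>
      s'.real (M + 6) 0 0 = ∑ k ∈ Finset.range x, Real.sqrt (a k * b k) ∧
      s'.real (M + 8) 0 0 = ∑ k ∈ Finset.range x, a k ∧
      s'.real (M + 9) 0 0 = ∑ k ∈ Finset.range x, b k ∧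
      ∀ k < x, s'.real (M + 15) k 0 = Real.sqrt (a k * b k)) (by simp [Cmd.WN, setR]) ?_ ?_ ?_)))))))
    (T := 1 + (1 + (1 + (q * (7 + 3) + 3) + 1) + 1) + 1) (by omega)
  · simp [NExp.eval, RExp.eval]
  · intro s' hf
    have : s'.nat (M + 2) 0 = q := by
      rw [hf.nat _ (by simp [Cmd.WN, forTo, setN, setR])]
      simpa using hq
    simpa [nv, NExp.eval] using this
  · intro x s' hx hf hx' ⟨h6, h8, h9, h15⟩
    have h3 : s'.real (M + 3) x 0 = a x := by
      rw [hf.real _ (by simp [Cmd.WR, forTo, setN, setR])]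
      simpa using ha x hx
    have h4 : s'.real (M + 4) x 0 = b x := by
      rw [hf.real _ (by simp [Cmd.WR, forTo, setN, setR])]
      simpa using hb x hx
    refine Runs.mono (Runs.seq (Runs.setReal (Runs.seq (Runs.setReal (Runs.seq (Runs.setReal
      (Runs.setReal ?_))))))) (by norm_num)
    refine ⟨?_, ?_, ?_, fun k hk => ?_⟩
    · simp [NExp.eval, RExp.eval, nv, rv, hx', h3, h4, h6, Finset.sum_range_succ]
    · simp [NExp.eval, RExp.eval, nv, rv, hx', h3, h8, Finset.sum_range_succ]
    · simp [NExp.eval, RExp.eval, nv, rv, hx', h4, h9, Finset.sum_range_succ]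
    · rcases Nat.lt_succ_iff_lt_or_eq.1 hk with hk | rfl
      · simp [NExp.eval, RExp.eval, nv, rv, hx', h3, h4, h15 k hk, hk.ne]
      · simp [NExp.eval, RExp.eval, nv, rv, hx', h3, h4]

/-- Scale the weights so that their average is `1`. -/
def scaleWeights (M : ℕ) : Cmd :=
  forTo (M + 4) (nv (M + 2)) <|
  Cmd.ite (.realLT (.ofNat (.const 0)) (rv (M + 6)))
    (Cmd.setReal (M + 5) (nv (M + 4)) (.const 0)
      (.div (.mul (.ofNat (nv (M + 2))) (.get (M + 15) (nv (M + 4)) (.const 0))) (rv (M + 6))))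
    (Cmd.setReal (M + 5) (nv (M + 4)) (.const 0) (.ofNat (.const 1)))

/-- The weights, scaled so that their average over `{0, …, q - 1}` is `1`. -/
def scaledWeight (q : ℕ) (w : ℕ → ℝ) (k : ℕ) : ℝ :=
  open Classical in
  -- The value `1` makes the distribution uniform when all weights vanish.
  if 0 < ∑ l ∈ Finset.range q, w l then q * w k / ∑ l ∈ Finset.range q, w l else 1

theorem scaledWeight_nonneg {q : ℕ} {w : ℕ → ℝ} (hw : ∀ k, 0 ≤ w k) (k : ℕ) :
    0 ≤ scaledWeight q w k := by
  have := hw k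
  rw [scaledWeight]
  split_ifs <;> positivity

theorem sum_scaledWeight (q : ℕ) (w : ℕ → ℝ) :
    ∑ k ∈ Finset.range q, scaledWeight q w k = q := by
  simp only [scaledWeight]
  split_ifs with h
  · rw [← Finset.sum_div, ← Finset.mul_sum, mul_div_assoc, div_self h.ne', mul_one]
  · simp

theorem scaleWeights_runs {M q : ℕ} {s : Store} {w : ℕ → ℝ} (hq : s.nat (M + 2) 0 = q)
    (hW : s.real (M + 6) 0 0 = ∑ k ∈ Finset.range q, w k)
    (hw : ∀ k < q, s.real (M + 15) k 0 = w k) :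
    Runs (scaleWeights M) s (q * 5 + 3) (fun s' =>
      ∀ k < q, s'.real (M + 5) k 0 = scaledWeight q w k) := by
  refine Runs.forTo (T := 2) q (fun x s' => ∀ k < x, s'.real (M + 5) k 0 = scaledWeight q w k)
    (by simp [Cmd.WN]) (by simp) ?_ ?_
  · intro s' hf
    have : s'.nat (M + 2) 0 = q := by
      rw [hf.nat _ (by simp [Cmd.WN, forTo, setN]), hq]
    simpa [nv, NExp.eval] using this
  · intro x s' hx hf hx' hI
    have h2 : s'.nat (M + 2) 0 = q := by
      rw [hf.nat _ (by simp [Cmd.WN, forTo, setN]), hq]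
    have h6 : s'.real (M + 6) 0 0 = ∑ k ∈ Finset.range q, w k := by
      rw [hf.real _ (by simp [Cmd.WR, forTo, setN]), hW]
    have h15 : s'.real (M + 15) x 0 = w x := by
      rw [hf.real _ (by simp [Cmd.WR, forTo, setN]), hw x hx]
    refine Runs.ite (fun hb => Runs.setReal fun k hk => ?_) (fun hb => Runs.setReal fun k hk => ?_)
    all_goals
      simp [BExp.eval, RExp.eval, NExp.eval, rv, h6] at hb
      rcases Nat.lt_succ_iff_lt_or_eq.1 hk with hk | rfl
      · simp [NExp.eval, RExp.eval, nv, rv, hx', hI k hk, hk.ne]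
    · simp [NExp.eval, RExp.eval, nv, rv, hx', h15, h6, h2, scaledWeight, hb]
    · simp [NExp.eval, RExp.eval, nv, hx', scaledWeight, hb.not_gt]

/-- The preprocessing routine; `thr` is the numerator of the threshold for the number of rounds. -/
def preprocess (M : ℕ) (comb : RExp → RExp → RExp) (thr : RExp) : Cmd :=
  (setN (M + 1) (.get 0 (.const 0))).seq <| (setN (M + 2) (.get 0 (.const 1))).seq <|
  (setN (M + 3) (.get 0 (.const 2))).seq <|
  (loadMatrix M comb 0 (M + 1) (M + 3) (M + 2) (M + 1) (nv (M + 5)) (nv (M + 4))).seq <|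
  (loadMatrix M comb 1 (M + 2) (M + 4) (M + 2) (M + 3) (nv (M + 4)) (nv (M + 5))).seq <|
  (computeWeights M).seq <|
  (setR (M + 7) (.mul (rv (M + 8)) (rv (M + 9)))).seq <| (setR (M + 10) thr).seq <|
  (scaleWeights M).seq <| buildAlias M

/-- The memory after preprocessing. -/
structure Prepared (M n q m : ℕ) (α β : ℕ → ℕ → ℝ) (P : ℕ → ℝ) (N2 X : ℝ) (s : Store) :
    Prop where
  n_eq : s.nat (M + 1) 0 = n
  q_eq : s.nat (M + 2) 0 = q
  m_eq : s.nat (M + 3) 0 = m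
  left : ∀ i < n, ∀ k < q, s.real (M + 1) i k = α i k
  right : ∀ k < q, ∀ j < m, s.real (M + 2) k j = β k j
  mass : ∀ k < q, s.real (M + 5) k 0 = P k
  norm : s.real (M + 7) 0 0 = N2
  thr : s.real (M + 10) 0 0 = X
  table : IsAliasTable q P (s.nat (M + 6)) (s.nat (M + 7)) (fun u => s.real (M + 12) u 0)

/-- The inputs are copied because block products are later set up in the arrays `0` and `1`. The
bound `4 ≤ M` separates the private arrays from inputs, parameters and output. -/
theorem preprocess_runs {M n q m : ℕ} {comb : RExp → RExp → RExp} {op : ℝ → ℝ → ℝ}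
    (hop : ∀ s x y, (comb x y).eval s = op (x.eval s) (y.eval s)) {thr : RExp} {X : ℝ}
    (hthr : ∀ s, s.nat (M + 1) 0 = n → s.nat (M + 3) 0 = m → thr.eval s = X) {s : Store}
    (hM : 4 ≤ M) (hq : 0 < q) (hn : s.nat 0 0 = n) (hsq : s.nat 0 1 = q) (hm : s.nat 0 2 = m) {a b : ℕ → ℝ}
    (ha : ∀ k, a k = accumulate op (fun i => s.real 0 i k) n)
    (hb : ∀ k, b k = accumulate op (fun j => s.real 1 k j) m) :
    Runs (preprocess M comb thr) s (q * (n * 6 + 8) + q * (m * 6 + 8) + q * 75 + 100)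
      (Prepared M n q m (s.real 0) (s.real 1)
        (scaledWeight q fun k => Real.sqrt (a k * b k))
        ((∑ k ∈ Finset.range q, a k) * ∑ k ∈ Finset.range q, b k) X) := by
  refine Runs.mono (Runs.seq (Runs.setNat (Runs.seq (Runs.setNat (Runs.seq (Runs.setNat
    (Runs.seq ((loadMatrix_runs hop (ρ := fun k i => i) (κ := fun k i => k) (a := q) (b := n)
      (by simp [nv, NExp.eval]) (by simp [nv, NExp.eval]) (by simp +contextual) (by omega) (by omega)
      (by omega) (by omega) (by omega) (by omega) (by omega) ?_ ?_).conseq le_rfl ?_))))))))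
    (T := 1 + (1 + (1 + ((q * (n * 6 + 8) + 3) + ((q * (m * 6 + 8) + 3) + ((q * 10 + 20) +
      (1 + (1 + ((q * 5 + 3) + (60 * q + 20) + 1) + 1) + 1) + 1) + 1) + 1) + 1) + 1) + 1)
    (by omega)
  · simp [NExp.eval, hsq]
  · simp [NExp.eval, hn]
  rintro s₁ hf₁ ⟨hA₁, ha₁⟩
  have hN₁ : s₁.nat (M + 1) 0 = n ∧ s₁.nat (M + 2) 0 = q ∧ s₁.nat (M + 3) 0 = m := by
    refine ⟨?_, ?_, ?_⟩
    all_goals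
      rw [hf₁.nat _ (by simp [Cmd.WN, loadMatrix, forTo, setN])]
      simp [NExp.eval, hn, hsq, hm]
  have hB₁ : s₁.real 1 = s.real 1 := hf₁.real _ (by simp [Cmd.WR, loadMatrix, forTo, setN]; omega)
  refine Runs.seq ((loadMatrix_runs hop (ρ := fun k i => k) (κ := fun k i => i) (a := q) (b := m)
      (by simp [nv, NExp.eval]) (by simp [nv, NExp.eval]) (by simp +contextual) (by omega) (by omega)
      (by omega) (by omega) (by omega) (by omega) (by omega) hN₁.2.1 hN₁.2.2).conseq le_rfl ?_)
  rintro s₂ hf₂ ⟨hB₂, hb₂⟩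
  have hN₂ : s₂.nat (M + 1) 0 = n ∧ s₂.nat (M + 2) 0 = q ∧ s₂.nat (M + 3) 0 = m := by
    refine ⟨?_, ?_, ?_⟩
    all_goals
      rw [hf₂.nat _ (by simp [Cmd.WN, loadMatrix, forTo, setN])]
      simp [hN₁]
  have ha₂ : ∀ k < q, s₂.real (M + 3) k 0 = a k := fun k hk => by
    rw [hf₂.real _ (by simp [Cmd.WR, loadMatrix, forTo, setN]), ha₁ k hk, ha]
    rfl
  have hb₂' : ∀ k < q, s₂.real (M + 4) k 0 = b k := fun k hk => by
    rw [hb₂ k hk, hb, hB₁]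
  refine Runs.seq ((computeWeights_runs hN₂.2.1 ha₂ hb₂').conseq le_rfl ?_)
  rintro s₃ hf₃ ⟨h6, h8, h9, h15⟩
  have hN₃ : s₃.nat (M + 1) 0 = n ∧ s₃.nat (M + 2) 0 = q ∧ s₃.nat (M + 3) 0 = m := by
    refine ⟨?_, ?_, ?_⟩
    all_goals
      rw [hf₃.nat _ (by simp [Cmd.WN, computeWeights, forTo, setN, setR])]
      simp [hN₂]
  refine Runs.seq (Runs.setReal (Runs.seq (Runs.setReal (Runs.seq
    ((scaleWeights_runs (w := fun k => Real.sqrt (a k * b k)) (q := q) ?_ ?_ ?_).conseq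
      le_rfl ?_)))))
  · simp [hN₃]
  · simp [NExp.eval, h6]
  · intro k hk
    simp [NExp.eval, h15 k hk]
  intro s₄ hf₄ h5
  have hN₄ : s₄.nat (M + 1) 0 = n ∧ s₄.nat (M + 2) 0 = q ∧ s₄.nat (M + 3) 0 = m := by
    refine ⟨?_, ?_, ?_⟩
    all_goals
      rw [hf₄.nat _ (by simp [Cmd.WN, scaleWeights, forTo, setN])]
      simp [hN₃]
  refine (buildAlias_runs hq (scaledWeight_nonneg fun k => Real.sqrt_nonneg _)
    (sum_scaledWeight q fun k => Real.sqrt (a k * b k)) hN₄.2.1 h5).conseq le_rfl ?_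
  intro s₅ hf₅ htab
  have hR₅ : ∀ x, x ≠ 11 → x ≠ 12 → s₅.real (M + x) = s₄.real (M + x) := by
    intro x hx hx'
    exact hf₅.real _ (by simp [Cmd.WR, buildAlias, placeItem, setN, setR, hx, hx'])
  have hN₅ : s₅.nat (M + 1) 0 = n ∧ s₅.nat (M + 2) 0 = q ∧ s₅.nat (M + 3) 0 = m := by
    refine ⟨?_, ?_, ?_⟩
    all_goals
      rw [hf₅.nat _ (by simp [Cmd.WN, buildAlias, placeItem, setN, setR])]
      simp [hN₄]
  have hR₄ : ∀ x, x ≠ 5 → s₄.real (M + x) = ((s₃.setReal (M + 7) 0 0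
      (s₃.real (M + 8) 0 0 * s₃.real (M + 9) 0 0)).setReal (M + 10) 0 0 X).real (M + x) := by
    intro x hx
    rw [hf₄.real _ (by simp [Cmd.WR, scaleWeights, forTo, setN, hx])]
    rw [hthr _ (by simpa using hN₃.1) (by simpa using hN₃.2.2)]
    rfl
  refine ⟨hN₅.1, hN₅.2.1, hN₅.2.2, fun i hi k hk => ?_, fun k hk j hj => ?_, fun k hk => ?_, ?_, ?_,
    htab⟩
  · rw [hR₅ 1 (by norm_num) (by norm_num), hR₄ 1 (by norm_num)]
    simp only [setReal_real, Nat.add_left_cancel_iff]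
    norm_num
    rw [hf₃.real _ (by simp [Cmd.WR, computeWeights, forTo, setN, setR]),
      hf₂.real _ (by simp [Cmd.WR, loadMatrix, forTo, setN]), hA₁ k hk i hi]
    rfl
  · rw [hR₅ 2 (by norm_num) (by norm_num), hR₄ 2 (by norm_num)]
    simp only [setReal_real, Nat.add_left_cancel_iff]
    norm_num
    rw [hf₃.real _ (by simp [Cmd.WR, computeWeights, forTo, setN, setR]), hB₂ k hk j hj, hB₁]
  · rw [hR₅ 5 (by norm_num) (by norm_num), h5 k hk]
  · rw [hR₅ 7 (by norm_num) (by norm_num), hR₄ 7 (by norm_num)]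
    simp [h8, h9]
  · rw [hR₅ 10 (by norm_num) (by norm_num), hR₄ 10 (by norm_num)]
    simp

end RealRAM

namespace RealRAM

open Function

/-! ### Block-wise multiplication -/

/-- Assign `e` to the entries `(e₁, e₂)` of the array `arr`, where the variable `v₁` runs below the
variable `b₁` and `v₂` below `b₂`. -/
def fill (v₁ v₂ b₁ b₂ arr : ℕ) (e₁ e₂ : NExp) (e : RExp) : Cmd :=
  forTo v₁ (nv b₁) (forTo v₂ (nv b₂) (.setReal arr e₁ e₂ e))

/-- The last premise of `he`, that the target cell still has its original value, allows `e` to read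
that cell; accumulating block products needs this. -/
theorem fill_runs {v₁ v₂ b₁ b₂ arr : ℕ} {e₁ e₂ : NExp} {e : RExp} {s : Store} {a b I J : ℕ}
    (F : ℕ → ℕ → ℝ) (hv : v₁ ≠ v₂) (h11 : b₁ ≠ v₁) (h12 : b₁ ≠ v₂) (h21 : b₂ ≠ v₁) (h22 : b₂ ≠ v₂)
    (ha : s.nat b₁ 0 = a) (hb : s.nat b₂ 0 = b)
    (he : ∀ s' x y, x < a → y < b → (∀ t, t ≠ v₁ → t ≠ v₂ → s'.nat t = s.nat t) →
      (∀ t, t ≠ arr → s'.real t = s.real t) → s'.nat v₁ 0 = x → s'.nat v₂ 0 = y →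
      s'.real arr (I + x) (J + y) = s.real arr (I + x) (J + y) →
      e₁.eval s' = I + x ∧ e₂.eval s' = J + y ∧ e.eval s' = F x y) :
    Runs (fill v₁ v₂ b₁ b₂ arr e₁ e₂ e) s (a * (b * 4 + 6) + 3) (fun s' => ∀ i j,
      s'.real arr i j = if (I ≤ i ∧ i < I + a) ∧ J ≤ j ∧ j < J + b then F (i - I) (j - J)
        else s.real arr i j) := by
  refine Runs.mono (Runs.forTo (T := b * 4 + 3) a (fun x s' => ∀ i j,
      s'.real arr i j = if (I ≤ i ∧ i < I + x) ∧ J ≤ j ∧ j < J + b then F (i - I) (j - J)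
        else s.real arr i j) (by simp [Cmd.WN, forTo, setN, hv]) ?_ ?_ ?_) le_rfl
  · intro i j
    rw [if_neg (by omega)]; rfl
  · intro s' hf
    have : s'.nat b₁ 0 = a := by
      rw [hf.nat _ (by simp [Cmd.WN, forTo, setN, h11, h12]), ha]
    simpa [nv, NExp.eval] using this
  · intro x s₁ hx hf₁ hx₁ hI₁
    refine (Runs.forTo (T := 1) b (fun y s' => ∀ i j,
      s'.real arr i j = if ((I ≤ i ∧ i < I + x) ∧ J ≤ j ∧ j < J + b) ∨
          (i = I + x ∧ J ≤ j ∧ j < J + y) then F (i - I) (j - J)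
        else s.real arr i j) (by simp [Cmd.WN]) ?_ ?_ ?_).conseq le_rfl ?_
    · intro i j
      rw [setNat_real, hI₁]
      refine if_congr ?_ rfl rfl
      omega
    · intro s' hf
      have : s'.nat b₂ 0 = b := by
        rw [hf.nat _ (by simp [Cmd.WN, forTo, setN, h22]),
          hf₁.nat _ (by simp [Cmd.WN, forTo, setN, h21, h22]), hb]
      simpa [nv, NExp.eval] using this
    · intro y s₂ hy hf₂ hy₂ hI₂
      obtain ⟨E₁, E₂, E⟩ := he s₂ x y hx hy
        (fun t h h' => by
          rw [hf₂.nat t (by simp [Cmd.WN, forTo, setN, h']),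
            hf₁.nat t (by simp [Cmd.WN, forTo, setN, h, h'])])
        (fun t h => by
          rw [hf₂.real t (by simp [Cmd.WR, forTo, setN, h]),
            hf₁.real t (by simp [Cmd.WR, forTo, setN, h])])
        (by rw [hf₂.nat v₁ (by simp [Cmd.WN, forTo, setN, hv]), hx₁]) hy₂
        (by rw [hI₂, if_neg (by omega)])
      refine Runs.setReal fun i j => ?_
      simp only [setNat_real, setReal_real, true_and, E₁, E₂, E]
      by_cases hij : i = I + x ∧ j = J + y
      · obtain ⟨rfl, rfl⟩ := hij
        rw [if_pos ⟨rfl, rfl⟩, if_pos (by omega)]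
        simp
      · rw [if_neg hij, hI₂]
        refine if_congr ?_ rfl rfl
        omega
    · intro s' _ h i j
      rw [setNat_real, h]
      refine if_congr ?_ rfl rfl
      omega

/-- Add the product of the block in rows `M + 21`, … and samples `M + 20`, … with the block in
the same samples and columns `M + 22`, … to the result. -/
def blockStep (M : ℕ) (mm : Cmd) : Cmd :=
  (fill (M + 23) (M + 24) (M + 12) (M + 12) 0 (nv (M + 23)) (nv (M + 24))
    (.get (M + 1) (.add (nv (M + 21)) (nv (M + 23)))
      (.get (M + 15) (.add (nv (M + 20)) (nv (M + 24)))))).seq <|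
  (fill (M + 23) (M + 24) (M + 12) (M + 12) 1 (nv (M + 23)) (nv (M + 24))
    (.div (.get (M + 2) (.get (M + 15) (.add (nv (M + 20)) (nv (M + 23))))
        (.add (nv (M + 22)) (nv (M + 24))))
      (.mul (.ofNat (nv (M + 14)))
        (.div (.get (M + 5) (.get (M + 15) (.add (nv (M + 20)) (nv (M + 23)))) (.const 0))
          (.ofNat (nv (M + 2))))))).seq <|
  (setN 0 (nv (M + 12))).seq <|
  mm.seq <|
  fill (M + 23) (M + 24) (M + 12) (M + 12) (M + 14) (.add (nv (M + 21)) (nv (M + 23)))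
    (.add (nv (M + 22)) (nv (M + 24)))
    (.add (.get (M + 14) (.add (nv (M + 21)) (nv (M + 23))) (.add (nv (M + 22)) (nv (M + 24))))
      (.get 3 (nv (M + 23)) (nv (M + 24))))

/-- The part of the memory that does not change during the multiplication. -/
structure MulCtx (M n q m R c : ℕ) (J : ℕ → ℕ) (α β : ℕ → ℕ → ℝ) (P : ℕ → ℝ) (s : Store) :
    Prop where
  n_eq : s.nat (M + 1) 0 = n
  q_eq : s.nat (M + 2) 0 = q
  m_eq : s.nat (M + 3) 0 = m
  R_eq : s.nat (M + 12) 0 = R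
  c_eq : s.nat (M + 14) 0 = c
  J_eq : s.nat (M + 15) = J
  α_eq : s.real (M + 1) = α
  β_eq : s.real (M + 2) = β
  P_eq : ∀ k, s.real (M + 5) k 0 = P k

theorem MulCtx.congr {M n q m R c : ℕ} {J : ℕ → ℕ} {α β : ℕ → ℕ → ℝ} {P : ℕ → ℝ} {s s' : Store}
    (h : MulCtx M n q m R c J α β P s)
    (hN : ∀ t ∈ [1, 2, 3, 12, 14, 15], s'.nat (M + t) = s.nat (M + t))
    (hR : ∀ t ∈ [1, 2, 5], s'.real (M + t) = s.real (M + t)) :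
    MulCtx M n q m R c J α β P s' := by
  simp only [List.forall_mem_cons] at hN hR
  obtain ⟨h1, h2, h3, h12, h14, h15, -⟩ := hN
  obtain ⟨r1, r2, r5, -⟩ := hR
  constructor
  · rw [h1, h.n_eq]
  · rw [h2, h.q_eq]
  · rw [h3, h.m_eq]
  · rw [h12, h.R_eq]
  · rw [h14, h.c_eq]
  · rw [h15, h.J_eq]
  · rw [r1, h.α_eq]
  · rw [r2, h.β_eq]
  · intro k; rw [r5, h.P_eq]

/-- The contribution of sample `t` to the entry `(i, j)` of the result. -/
def sampleTerm (q c : ℕ) (J : ℕ → ℕ) (α β : ℕ → ℕ → ℝ) (P : ℕ → ℝ) (i j t : ℕ) : ℝ :=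
  α i (J t) * (β (J t) j / (c * (P (J t) / q)))

section blocks

variable {M n q m R c : ℕ} {J : ℕ → ℕ} {α β : ℕ → ℕ → ℝ} {P : ℕ → ℝ} {s : Store} {mm : Cmd}
  {T : ℕ}

/-- Blocks may stick out beyond row `n` or column `m`. The arbitrary memory read there affects only
entries of the result outside the `n × m` corner, so no padding with zeros is needed. -/
theorem blockStep_runs (hM : 4 ≤ M) (hWN : ∀ k, ¬ mm.WN (M + k)) (hWR : ∀ k, ¬ mm.WR (M + k))
    (hmm : ∀ s : Store, s.nat 0 0 = R → ∃ s', Ev mm s T (PMF.pure s') ∧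
      s'.matrix 3 R R = s.matrix 0 R R * s.matrix 1 R R)
    (h : MulCtx M n q m R c J α β P s) {o I K : ℕ} (ho : s.nat (M + 20) 0 = o)
    (hI : s.nat (M + 21) 0 = I) (hK : s.nat (M + 22) 0 = K) :
    Runs (blockStep M mm) s (T + 3 * (R * (R * 4 + 6)) + 14) (fun s' => ∀ i j,
      s'.real (M + 14) i j = s.real (M + 14) i j +
        if (I ≤ i ∧ i < I + R) ∧ K ≤ j ∧ j < K + R then
          ∑ t ∈ Finset.range R, sampleTerm q c J α β P i j (o + t) else 0) := by
  refine Runs.mono (Runs.seq ((fill_runs (a := R) (b := R) (I := 0) (J := 0)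
    (fun x y => α (I + x) (J (o + y)))
    (by omega) (by omega) (by omega) (by omega) (by omega) h.R_eq h.R_eq ?_).conseq le_rfl ?_))
    (T := (R * (R * 4 + 6) + 3) + ((R * (R * 4 + 6) + 3) + (1 + (T + (R * (R * 4 + 6) + 3) + 1) + 1)
      + 1) + 1) (by omega)
  · intro s' x y _ _ hN hR hx hy _
    simp only [nv, NExp.eval, RExp.eval, hx, hy, zero_add, true_and]
    rw [hR (M + 1) (by omega), hN (M + 21) (by omega) (by omega),
      hN (M + 20) (by omega) (by omega), hN (M + 15) (by omega) (by omega), h.α_eq, h.J_eq, hI, ho]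
  intro s₁ hf₁ h₁
  have hN₁ : ∀ t, t ≠ 23 → t ≠ 24 → s₁.nat (M + t) = s.nat (M + t) := fun t ht ht' =>
    hf₁.nat _ (by simp [Cmd.WN, fill, forTo, setN, ht, ht'])
  have hR₁ : ∀ t, t ≠ 0 → s₁.real t = s.real t := fun t ht =>
    hf₁.real _ (by simp [Cmd.WR, fill, forTo, setN, ht])
  refine Runs.seq ((fill_runs (a := R) (b := R) (I := 0) (J := 0)
    (fun x y => β (J (o + x)) (K + y) / (c * (P (J (o + x)) / q)))
    (by omega) (by omega) (by omega) (by omega) (by omega) ?_ ?_ ?_).conseq le_rfl ?_)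
  · rw [hN₁ 12 (by omega) (by omega), h.R_eq]
  · rw [hN₁ 12 (by omega) (by omega), h.R_eq]
  · intro s' x y _ _ hN hR hx hy _
    simp only [nv, NExp.eval, RExp.eval, hx, hy, zero_add, true_and]
    rw [hR (M + 2) (by omega), hR (M + 5) (by omega), hN (M + 22) (by omega) (by omega),
      hN (M + 20) (by omega) (by omega), hN (M + 15) (by omega) (by omega),
      hN (M + 14) (by omega) (by omega), hN (M + 2) (by omega) (by omega),
      hR₁ _ (by omega), hR₁ _ (by omega), hN₁ _ (by omega) (by omega), hN₁ _ (by omega) (by omega),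
      hN₁ _ (by omega) (by omega), hN₁ _ (by omega) (by omega), hN₁ _ (by omega) (by omega),
      h.β_eq, h.J_eq, hK, ho, h.P_eq, h.c_eq, h.q_eq]
  intro s₂ hf₂ h₂
  have hN₂ : ∀ t, t ≠ 23 → t ≠ 24 → s₂.nat (M + t) = s.nat (M + t) := fun t ht ht' => by
    rw [hf₂.nat _ (by simp [Cmd.WN, fill, forTo, setN, ht, ht']), hN₁ t ht ht']
  have hR₂ : ∀ t, t ≠ 0 → t ≠ 1 → s₂.real t = s.real t := fun t ht ht' => by
    rw [hf₂.real _ (by simp [Cmd.WR, fill, forTo, setN, ht']), hR₁ t ht]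
  have h₂' : s₂.real 0 = s₁.real 0 := hf₂.real _ (by simp [Cmd.WR, fill, forTo, setN])
  refine Runs.seq (Runs.setNat ?_)
  obtain ⟨s₃, hEv, h₃⟩ := hmm (s₂.setNat 0 ((NExp.const 0).eval s₂) ((nv (M + 12)).eval s₂)) (by
    simp [NExp.eval, nv, hN₂ 12, h.R_eq])
  have hf₃ := hEv.frame (s' := s₃) (by simp)
  refine Runs.seq ⟨s₃, hEv, ?_⟩
  have hN₃ : ∀ t, t ≠ 23 → t ≠ 24 → s₃.nat (M + t) = s.nat (M + t) := fun t ht ht' => by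
    rw [hf₃.nat _ (hWN t), setNat_nat_ne _ _ _ (by omega), hN₂ t ht ht']
  have hR₃ : ∀ t, s₃.real (M + t) = s.real (M + t) := fun t => by
    rw [hf₃.real _ (hWR t), setNat_real, hR₂ _ (by omega) (by omega)]
  refine (fill_runs (a := R) (b := R) (I := I) (J := K)
    (fun x y => s.real (M + 14) (I + x) (K + y) +
      ∑ t ∈ Finset.range R, sampleTerm q c J α β P (I + x) (K + y) (o + t))
    (by omega) (by omega) (by omega) (by omega) (by omega) ?_ ?_ ?_).conseq le_rfl ?_
  · rw [hN₃ 12 (by omega) (by omega), h.R_eq]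
  · rw [hN₃ 12 (by omega) (by omega), h.R_eq]
  · intro s' x y hxR hyR hN hR hx hy hxy
    simp only [nv, NExp.eval, RExp.eval, hx, hy]
    rw [hN (M + 21) (by omega) (by omega), hN (M + 22) (by omega) (by omega),
      hN₃ _ (by omega) (by omega), hN₃ _ (by omega) (by omega), hI, hK, hxy, hR₃,
      hR 3 (by omega)]
    refine ⟨rfl, rfl, ?_⟩
    congr 1
    have := congrFun (congrFun h₃ ⟨x, hxR⟩) ⟨y, hyR⟩
    simp only [Store.matrix, Matrix.mul_apply, setNat_real] at this
    rw [this, Finset.sum_range]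
    refine Finset.sum_congr rfl fun t _ => ?_
    rw [h₂', h₁, h₂, if_pos (by omega), if_pos (by omega)]
    simp [sampleTerm]
  · intro s₄ _ h₄ i j
    rw [h₄, hR₃]
    split_ifs with hb
    · rw [Nat.add_sub_cancel' hb.1.1, Nat.add_sub_cancel' hb.2.1]
    · rw [add_zero]

/-- Treat the blocks in the rows `M + 21`, … -/
def rowStep (M : ℕ) (mm : Cmd) : Cmd :=
  (setN (M + 22) (.const 0)).seq <|
  Cmd.while (.natLT (nv (M + 22)) (nv (M + 3))) <|
  (blockStep M mm).seq <| setN (M + 22) (.add (nv (M + 22)) (nv (M + 12)))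

theorem lt_ceilDiv_iff_mul_lt {R : ℕ} (hR : 0 < R) {y m : ℕ} : y < m ⌈/⌉ R ↔ y * R < m := by
  rw [← not_le, ceilDiv_le_iff_le_mul hR, not_le, mul_comm]

theorem le_ceilDiv_mul {R : ℕ} (hR : 0 < R) (m : ℕ) : m ≤ (m ⌈/⌉ R) * R := by
  by_contra h
  exact lt_irrefl _ ((lt_ceilDiv_iff_mul_lt hR).2 (not_le.1 h))

theorem rowStep_runs (hM : 4 ≤ M) (hWN : ∀ k, ¬ mm.WN (M + k)) (hWR : ∀ k, ¬ mm.WR (M + k))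
    (hmm : ∀ s : Store, s.nat 0 0 = R → ∃ s', Ev mm s T (PMF.pure s') ∧
      s'.matrix 3 R R = s.matrix 0 R R * s.matrix 1 R R) (hR : 0 < R)
    (h : MulCtx M n q m R c J α β P s) {o I : ℕ} (ho : s.nat (M + 20) 0 = o)
    (hI : s.nat (M + 21) 0 = I) :
    Runs (rowStep M mm) s ((m ⌈/⌉ R) * (T + 3 * (R * (R * 4 + 6)) + 17) + 3) (fun s' => ∀ i j,
      s'.real (M + 14) i j = s.real (M + 14) i j +
        if (I ≤ i ∧ i < I + R) ∧ j < (m ⌈/⌉ R) * R then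
          ∑ t ∈ Finset.range R, sampleTerm q c J α β P i j (o + t) else 0) := by
  have hctx : ∀ s', Frame ((blockStep M mm).seq (setN (M + 22) (.add (nv (M + 22)) (nv (M + 12)))))
      (s.setNat (M + 22) 0 0) s' → MulCtx M n q m R c J α β P s' := by
    intro s' hf
    refine h.congr (fun t ht => ?_) (fun t ht => ?_)
    · rw [hf.nat]
      · rw [setNat_nat_ne]
        rintro h; simp at h; subst h; simp at ht
      · simp only [List.mem_cons, List.not_mem_nil, or_false] at ht
        simp [Cmd.WN, blockStep, fill, forTo, setN, hWN]
        omega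
    · rw [hf.real]
      · rfl
      · simp only [List.mem_cons, List.not_mem_nil, or_false] at ht
        simp [Cmd.WR, blockStep, fill, forTo, setN, hWR]
        omega
  refine Runs.mono (Runs.seq (Runs.setNat ((Runs.while (N := m ⌈/⌉ R)
    (T := T + 3 * (R * (R * 4 + 6)) + 16) (fun y s' => s'.nat (M + 22) 0 = y * R ∧ ∀ i j,
      s'.real (M + 14) i j = s.real (M + 14) i j +
        if (I ≤ i ∧ i < I + R) ∧ j < y * R then
          ∑ t ∈ Finset.range R, sampleTerm q c J α β P i j (o + t) else 0) ?_ ?_ ?_).conseq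
    le_rfl fun s' _ h => h.2)))
    (T := 1 + ((m ⌈/⌉ R) * (T + 3 * (R * (R * 4 + 6)) + 16 + 1) + 1) + 1) (le_of_eq (by ring))
  · simp [NExp.eval]
  · rintro y s' - hf ⟨hy, -⟩
    have h' := hctx s' hf
    rw [lt_ceilDiv_iff_mul_lt hR]
    simp [BExp.eval, NExp.eval, nv, hy, h'.m_eq]
  · rintro y s' _ hf ⟨hy, hD⟩
    have h' := hctx s' hf
    have ho' : s'.nat (M + 20) 0 = o := by
      rw [hf.nat _ (by simp [Cmd.WN, blockStep, fill, forTo, setN, hWN])]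
      simpa using ho
    have hI' : s'.nat (M + 21) 0 = I := by
      rw [hf.nat _ (by simp [Cmd.WN, blockStep, fill, forTo, setN, hWN])]
      simpa using hI
    refine Runs.mono (Runs.seq (T₂ := 1) ((blockStep_runs hM hWN hWR hmm h' ho' hI' hy).conseq
      le_rfl ?_)) (by omega)
    intro s₁ hf₁ h₁
    have hy₁ : s₁.nat (M + 22) 0 = y * R := by
      rw [hf₁.nat _ (by simp [Cmd.WN, blockStep, fill, forTo, setN, hWN]), hy]
    have hR₁ : s₁.nat (M + 12) 0 = R := by
      rw [hf₁.nat _ (by simp [Cmd.WN, blockStep, fill, forTo, setN, hWN]), h'.R_eq]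
    refine Runs.setNat ⟨by simp [NExp.eval, nv, hy₁, hR₁, add_mul], fun i j => ?_⟩
    rw [setNat_real, h₁, hD, add_assoc, add_mul, one_mul]
    congr 1
    by_cases hi : I ≤ i ∧ i < I + R
    · by_cases hj : j < y * R
      · rw [if_pos ⟨hi, hj⟩, if_neg (by omega), if_pos (by omega), add_zero]
      · rw [if_neg (by omega), zero_add]
        exact if_congr (by omega) rfl rfl
    · rw [if_neg (by omega), if_neg (by omega), if_neg (by omega), add_zero]

/-- Treat all blocks in the samples `M + 20`, … -/
def roundStep (M : ℕ) (mm : Cmd) : Cmd :=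
  (setN (M + 21) (.const 0)).seq <|
  Cmd.while (.natLT (nv (M + 21)) (nv (M + 1))) <|
  (rowStep M mm).seq <| setN (M + 21) (.add (nv (M + 21)) (nv (M + 12)))

theorem roundStep_runs (hM : 4 ≤ M) (hWN : ∀ k, ¬ mm.WN (M + k)) (hWR : ∀ k, ¬ mm.WR (M + k))
    (hmm : ∀ s : Store, s.nat 0 0 = R → ∃ s', Ev mm s T (PMF.pure s') ∧
      s'.matrix 3 R R = s.matrix 0 R R * s.matrix 1 R R) (hR : 0 < R)
    (h : MulCtx M n q m R c J α β P s) {o : ℕ} (ho : s.nat (M + 20) 0 = o) :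
    Runs (roundStep M mm) s ((n ⌈/⌉ R) * ((m ⌈/⌉ R) * (T + 3 * (R * (R * 4 + 6)) + 17) + 6) + 3)
      (fun s' => ∀ i j, s'.real (M + 14) i j = s.real (M + 14) i j +
        if i < (n ⌈/⌉ R) * R ∧ j < (m ⌈/⌉ R) * R then
          ∑ t ∈ Finset.range R, sampleTerm q c J α β P i j (o + t) else 0) := by
  have hctx : ∀ s', Frame ((rowStep M mm).seq (setN (M + 21) (.add (nv (M + 21)) (nv (M + 12)))))
      (s.setNat (M + 21) 0 0) s' → MulCtx M n q m R c J α β P s' := by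
    intro s' hf
    refine h.congr (fun t ht => ?_) (fun t ht => ?_)
    · rw [hf.nat]
      · rw [setNat_nat_ne]
        rintro h; simp at h; subst h; simp at ht
      · simp only [List.mem_cons, List.not_mem_nil, or_false] at ht
        simp [Cmd.WN, rowStep, blockStep, fill, forTo, setN, hWN]
        omega
    · rw [hf.real]
      · rfl
      · simp only [List.mem_cons, List.not_mem_nil, or_false] at ht
        simp [Cmd.WR, rowStep, blockStep, fill, forTo, setN, hWR]
        omega
  refine Runs.mono (Runs.seq (Runs.setNat ((Runs.while (N := n ⌈/⌉ R)
    (T := (m ⌈/⌉ R) * (T + 3 * (R * (R * 4 + 6)) + 17) + 5)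
    (fun x s' => s'.nat (M + 21) 0 = x * R ∧ ∀ i j,
      s'.real (M + 14) i j = s.real (M + 14) i j +
        if i < x * R ∧ j < (m ⌈/⌉ R) * R then
          ∑ t ∈ Finset.range R, sampleTerm q c J α β P i j (o + t) else 0) ?_ ?_ ?_).conseq
    le_rfl fun s' _ h => h.2)))
    (T := 1 + ((n ⌈/⌉ R) * ((m ⌈/⌉ R) * (T + 3 * (R * (R * 4 + 6)) + 17) + 5 + 1) + 1) + 1)
    (le_of_eq (by ring))
  · simp [NExp.eval]
  · rintro x s' - hf ⟨hx, -⟩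
    have h' := hctx s' hf
    rw [lt_ceilDiv_iff_mul_lt hR]
    simp [BExp.eval, NExp.eval, nv, hx, h'.n_eq]
  · rintro x s' _ hf ⟨hx, hD⟩
    have h' := hctx s' hf
    have ho' : s'.nat (M + 20) 0 = o := by
      rw [hf.nat _ (by simp [Cmd.WN, rowStep, blockStep, fill, forTo, setN, hWN])]
      simpa using ho
    refine Runs.mono (Runs.seq (T₂ := 1) ((rowStep_runs hM hWN hWR hmm hR h' ho' hx).conseq
      le_rfl ?_)) (by omega)
    intro s₁ hf₁ h₁
    have hx₁ : s₁.nat (M + 21) 0 = x * R := by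
      rw [hf₁.nat _ (by simp [Cmd.WN, rowStep, blockStep, fill, forTo, setN, hWN]), hx]
    have hR₁ : s₁.nat (M + 12) 0 = R := by
      rw [hf₁.nat _ (by simp [Cmd.WN, rowStep, blockStep, fill, forTo, setN, hWN]), h'.R_eq]
    refine Runs.setNat ⟨by simp [NExp.eval, nv, hx₁, hR₁, add_mul], fun i j => ?_⟩
    rw [setNat_real, h₁, hD, add_assoc, add_mul, one_mul]
    congr 1
    by_cases hj : j < (m ⌈/⌉ R) * R
    · by_cases hi : i < x * R
      · rw [if_pos ⟨hi, hj⟩, if_neg (by omega), if_pos (by omega), add_zero]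
      · rw [if_neg (by omega), zero_add]
        exact if_congr (by omega) rfl rfl
    · rw [if_neg (by omega), if_neg (by omega), if_neg (by omega), add_zero]

/-- Multiply the sampled matrices and leave the product in the array `3`. -/
def multiply (M : ℕ) (mm : Cmd) : Cmd :=
  (fill (M + 4) (M + 5) (M + 1) (M + 3) (M + 14) (nv (M + 4)) (nv (M + 5))
    (.ofNat (.const 0))).seq <|
  (setN (M + 20) (.const 0)).seq <|
  (forTo (M + 19) (nv (M + 13))
    ((roundStep M mm).seq (setN (M + 20) (.add (nv (M + 20)) (nv (M + 12)))))).seq <|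
  fill (M + 4) (M + 5) (M + 1) (M + 3) 3 (nv (M + 4)) (nv (M + 5))
    (.get (M + 14) (nv (M + 4)) (nv (M + 5)))

/-- The `L * R` samples split evenly into rounds, so the inner dimension is never rounded up;
overhanging blocks occur only in rows and columns, where they are harmless. -/
theorem multiply_runs (hM : 4 ≤ M) (hWN : ∀ k, ¬ mm.WN (M + k)) (hWR : ∀ k, ¬ mm.WR (M + k))
    (hmm : ∀ s : Store, s.nat 0 0 = R → ∃ s', Ev mm s T (PMF.pure s') ∧
      s'.matrix 3 R R = s.matrix 0 R R * s.matrix 1 R R) (hR : 0 < R) {L : ℕ}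
    (hL : s.nat (M + 13) 0 = L) (h : MulCtx M n q m R c J α β P s) :
    Runs (multiply M mm) s (2 * (n * (m * 4 + 6)) + L * ((n ⌈/⌉ R) *
        ((m ⌈/⌉ R) * (T + 3 * (R * (R * 4 + 6)) + 17) + 6) + 8) + 13)
      (fun s' => ∀ i < n, ∀ j < m, s'.real 3 i j =
        ∑ t ∈ Finset.range (L * R), sampleTerm q c J α β P i j t) := by
  refine Runs.mono (Runs.seq ((fill_runs (a := n) (b := m) (I := 0) (J := 0) (fun _ _ => 0)
    (by omega) (by omega) (by omega) (by omega) (by omega) h.n_eq h.m_eq ?_).conseq le_rfl ?_))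
    (T := (n * (m * 4 + 6) + 3) + (1 + ((L * ((n ⌈/⌉ R) * ((m ⌈/⌉ R) *
      (T + 3 * (R * (R * 4 + 6)) + 17) + 6) + 5 + 3) + 3) + (n * (m * 4 + 6) + 3) + 1) + 1) + 1)
    (le_of_eq (by ring))
  · intro s' x y _ _ _ _ hx hy _
    simp [nv, NExp.eval, RExp.eval, hx, hy]
  intro s₁ hf₁ h₁
  have hc₁ : MulCtx M n q m R c J α β P (s₁.setNat (M + 20) 0 0) := by
    refine h.congr (fun t ht => ?_) (fun t ht => ?_)
    all_goals simp only [List.mem_cons, List.not_mem_nil, or_false] at ht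
    · rw [setNat_nat_ne _ _ _ (by omega), hf₁.nat]
      simp [Cmd.WN, fill, forTo, setN]
      omega
    · rw [setNat_real, hf₁.real]
      simp [Cmd.WR, fill, forTo, setN]
      omega
  have hctx : ∀ s', Frame (forTo (M + 19) (nv (M + 13))
      ((roundStep M mm).seq (setN (M + 20) (.add (nv (M + 20)) (nv (M + 12))))))
      (s₁.setNat (M + 20) 0 0) s' → MulCtx M n q m R c J α β P s' ∧ s'.nat (M + 13) 0 = L := by
    intro s' hf
    constructor
    · refine hc₁.congr (fun t ht => ?_) (fun t ht => ?_)
      all_goals simp only [List.mem_cons, List.not_mem_nil, or_false] at ht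
      · rw [hf.nat]
        simp [Cmd.WN, roundStep, rowStep, blockStep, fill, forTo, setN, hWN]
        omega
      · rw [hf.real]
        simp [Cmd.WR, roundStep, rowStep, blockStep, fill, forTo, setN, hWR]
        omega
    · rw [hf.nat _ (by simp [Cmd.WN, roundStep, rowStep, blockStep, fill, forTo, setN, hWN]),
        setNat_nat_ne _ _ _ (by omega), hf₁.nat _ (by simp [Cmd.WN, fill, forTo, setN]), hL]
  refine Runs.seq (Runs.setNat (Runs.seq ((Runs.forTo (T := (n ⌈/⌉ R) *
    ((m ⌈/⌉ R) * (T + 3 * (R * (R * 4 + 6)) + 17) + 6) + 5) L (fun x s' =>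
      s'.nat (M + 20) 0 = x * R ∧ ∀ i < n, ∀ j < m, s'.real (M + 14) i j =
        ∑ t ∈ Finset.range (x * R), sampleTerm q c J α β P i j t)
    (by simp [Cmd.WN, roundStep, rowStep, blockStep, fill, forTo, setN, hWN]) ?_ ?_
    ?_).conseq le_rfl ?_)))
  · refine ⟨by simp [NExp.eval], fun i hi j hj => ?_⟩
    rw [setNat_real, setNat_real, h₁, if_pos (by omega)]
    simp
  · intro s' hf
    simpa [nv, NExp.eval] using (hctx s' hf).2
  · rintro x s' _ hf _ ⟨ho, hD⟩
    have h' := (hctx s' hf).1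
    refine Runs.mono (Runs.seq (T₂ := 1) ((roundStep_runs hM hWN hWR hmm hR h' ho).conseq
      le_rfl ?_)) (by omega)
    intro s₂ hf₂ h₂
    have ho₂ : s₂.nat (M + 20) 0 = x * R := by
      rw [hf₂.nat _ (by simp [Cmd.WN, roundStep, rowStep, blockStep, fill, forTo, setN, hWN]), ho]
    have hR₂ : s₂.nat (M + 12) 0 = R := by
      rw [hf₂.nat _ (by simp [Cmd.WN, roundStep, rowStep, blockStep, fill, forTo, setN, hWN]), h'.R_eq]
    refine Runs.setNat ⟨by simp [NExp.eval, nv, ho₂, hR₂, add_mul], fun i hi j hj => ?_⟩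
    rw [setNat_real, setNat_real, h₂, hD i hi j hj,
      if_pos ⟨hi.trans_le (le_ceilDiv_mul hR n), hj.trans_le (le_ceilDiv_mul hR m)⟩, add_mul,
      one_mul, Finset.sum_range_add]
  · rintro s₂ hf₂ ⟨-, h₂⟩
    have h' := (hctx s₂ hf₂).1
    refine (fill_runs (a := n) (b := m) (I := 0) (J := 0)
      (fun x y => ∑ t ∈ Finset.range (L * R), sampleTerm q c J α β P x y t)
      (by omega) (by omega) (by omega) (by omega) (by omega) h'.n_eq h'.m_eq ?_).conseq le_rfl ?_
    · intro s' x y hx hy _ hR hx' hy' _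
      simp only [nv, NExp.eval, RExp.eval, hx', hy', zero_add, true_and]
      rw [hR _ (by omega), h₂ x hx y hy]
    · intro s' _ h₃ i hi j hj
      rw [h₃, if_pos (by omega)]
      simp

end blocks

end RealRAM

namespace RealRAM

open Function

/-! ### The sampling algorithm -/

/-- Determine the block size, the number of rounds and the number of samples. -/
def chooseSizes (M : ℕ) : Cmd :=
  (setN (M + 12) (.const 0)).seq <|
  (Cmd.while (.not (.realLT (rv (M + 7)) (.mul (.ofNat (.add (nv (M + 12)) (.const 1)))
      (.mul (.get 2 (.const 0) (.const 0)) (.get 2 (.const 0) (.const 0))))))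
    (setN (M + 12) (.add (nv (M + 12)) (.const 1)))).seq <|
  (setN (M + 13) (.const 0)).seq <| (setR (M + 13) (.ofNat (.const 1))).seq <|
  (Cmd.while (.realLT (.mul (rv (M + 13)) (.get 2 (.const 0) (.const 1))) (rv (M + 10)))
    ((setR (M + 13) (.add (rv (M + 13)) (rv (M + 13)))).seq
      (setN (M + 13) (.add (nv (M + 13)) (.const 128))))).seq <|
  (setN (M + 14) (.const 0)).seq <|
  forTo (M + 19) (nv (M + 13)) (setN (M + 14) (.add (nv (M + 14)) (nv (M + 12))))

/-- Floors and logarithms are found by counting: `R` is the floor of `N2 / ε²`, and `l` is the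
number of doublings until `2 ^ l * δ` reaches `X`. The time spent on `R` is linear in `R`, hence
affordable when `R ≤ n`. -/
theorem chooseSizes_runs {M : ℕ} (hM : 4 ≤ M) {s : Store} {ε δ N2 X : ℝ} {R l : ℕ}
    (hε : s.real 2 0 0 = ε) (hδ : s.real 2 0 1 = δ) (hN2 : s.real (M + 7) 0 0 = N2)
    (hX : s.real (M + 10) 0 0 = X) (hR : ∀ x : ℕ, x < R ↔ (x + 1) * (ε * ε) ≤ N2)
    (hl : ∀ x : ℕ, x < l ↔ 2 ^ x * δ < X) :
    Runs (chooseSizes M) s (R * 2 + l * 516 + 20) (fun s' => s'.nat (M + 12) 0 = R ∧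
      s'.nat (M + 13) 0 = l * 128 ∧ s'.nat (M + 14) 0 = l * 128 * R) := by
  refine Runs.mono (Runs.seq (Runs.setNat (Runs.seq ((Runs.while (N := R) (T := 1)
    (fun x s' => s'.nat (M + 12) 0 = x) ?_ ?_ ?_).conseq le_rfl ?_))))
    (T := 1 + ((R * (1 + 1) + 1) + (1 + (1 + ((l * (3 + 1) + 1) +
      (1 + (l * 128 * (1 + 3) + 3) + 1) + 1) + 1) + 1) + 1) + 1) (by omega)
  · simp [NExp.eval]
  · intro x s' _ hf hx
    have h7 : s'.real (M + 7) 0 0 = N2 := by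
      rw [hf.real _ (by simp [Cmd.WR, setN])]; simpa using hN2
    have h2 : s'.real 2 0 0 = ε := by
      rw [hf.real _ (by simp [Cmd.WR, setN])]; simpa using hε
    simp [BExp.eval, RExp.eval, NExp.eval, rv, nv, h7, h2, hx, hR]
  · intro x s' _ hf hx
    refine Runs.setNat ?_
    simp [NExp.eval, nv, hx]
  intro s₁ hf₁ h₁
  refine Runs.seq (Runs.setNat (Runs.seq (Runs.setReal (Runs.seq ((Runs.while (N := l) (T := 3)
    (fun x s' => s'.nat (M + 13) 0 = x * 128 ∧ s'.real (M + 13) 0 0 = 2 ^ x) ?_ ?_ ?_).conseq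
    le_rfl ?_)))))
  · simp [NExp.eval, RExp.eval]
  · rintro x s' _ hf ⟨-, hx⟩
    have h10 : s'.real (M + 10) 0 0 = X := by
      rw [hf.real _ (by simp [Cmd.WR, setN, setR]), setReal_real_ne _ _ _ _ (by omega), setNat_real,
        hf₁.real _ (by simp [Cmd.WR, setN])]
      simpa using hX
    have h2 : s'.real 2 0 1 = δ := by
      rw [hf.real _ (by simp [Cmd.WR, setN, setR]), setReal_real_ne _ _ _ _ (by omega),
        setNat_real, hf₁.real _ (by simp [Cmd.WR, setN])]
      simpa using hδ
    simp [BExp.eval, RExp.eval, NExp.eval, rv, h10, h2, hx, hl]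
  · rintro x s' _ hf ⟨hx, hx'⟩
    refine Runs.mono (Runs.seq (Runs.setReal (Runs.setNat ?_))) (by norm_num)
    simp [NExp.eval, RExp.eval, nv, rv, hx, hx', pow_succ, add_mul]
    ring
  rintro s₂ hf₂ ⟨h₂, -⟩
  have hR₂ : s₂.nat (M + 12) 0 = R := by
    rw [hf₂.nat _ (by simp [Cmd.WN, setN, setR])]
    simp [h₁]
  refine Runs.seq (Runs.setNat ((Runs.forTo (T := 1) (l * 128)
    (fun x s' => s'.nat (M + 14) 0 = x * R) (by simp [Cmd.WN, setN]) ?_ ?_ ?_).conseq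
    le_rfl ?_))
  · simp [NExp.eval]
  · intro s' hf
    have : s'.nat (M + 13) 0 = l * 128 := by
      rw [hf.nat _ (by simp [Cmd.WN, forTo, setN])]
      simp [h₂]
    simpa [nv, NExp.eval] using this
  · intro x s' _ hf _ hx
    have : s'.nat (M + 12) 0 = R := by
      rw [hf.nat _ (by simp [Cmd.WN, forTo, setN])]
      simp [hR₂]
    refine Runs.setNat ?_
    simp [NExp.eval, nv, hx, this, add_mul]
  · intro s' hf h
    refine ⟨?_, ?_, h⟩
    · rw [hf.nat _ (by simp [Cmd.WN, forTo, setN])]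
      simp [hR₂]
    · rw [hf.nat _ (by simp [Cmd.WN, forTo, setN])]
      simp [h₂]

/-- The algorithm that samples columns and multiplies the sampled matrices block by block. -/
def sampleMultiply (M : ℕ) (mm : Cmd) : Cmd :=
  (chooseSizes M).seq <| (sampleAll M).seq <| multiply M mm

theorem sampleMultiply_ev {M n q m : ℕ} {α β : ℕ → ℕ → ℝ} {P : ℕ → ℝ} {N2 X ε δ : ℝ} {s : Store}
    {mm : Cmd} {R l T : ℕ} (hM : 4 ≤ M) (hWN : ∀ k, ¬ mm.WN (M + k)) (hWR : ∀ k, ¬ mm.WR (M + k))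
    (hmm : ∀ s : Store, s.nat 0 0 = R → ∃ s', Ev mm s T (PMF.pure s') ∧
      s'.matrix 3 R R = s.matrix 0 R R * s.matrix 1 R R) (hR0 : 0 < R)
    (hs : Prepared M n q m α β P N2 X s) (hR : ∀ x : ℕ, x < R ↔ (x + 1) * (ε * ε) ≤ N2)
    (hl : ∀ x : ℕ, x < l ↔ 2 ^ x * δ < X) {p : PMF (Fin q)}
    (hp : (uniformBelow q).bind (fun u => (coin (s.real (M + 12) u 0)).map
      (fun b => if 0 < b then s.nat (M + 6) u else s.nat (M + 7) u)) = p.map Fin.val)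
    (hpP : ∀ k, (p k).toReal = P k / q) {A : Matrix (Fin n) (Fin q) ℝ}
    {B : Matrix (Fin q) (Fin m) ℝ} (hA : ∀ (i : Fin n) (k : Fin q), α i k = A i k)
    (hB : ∀ (k : Fin q) (j : Fin m), β k j = B k j) :
    ∃ μ, Ev (sampleMultiply M mm) (s.withParams ε δ) ((R * 2 + l * 516 + 20) +
        ((l * 128 * R * 9 + 3) + (2 * (n * (m * 4 + 6)) + l * 128 * ((n ⌈/⌉ R) *
          ((m ⌈/⌉ R) * (T + 3 * (R * (R * 4 + 6)) + 17) + 6) + 8) + 13) + 1) + 1) μ ∧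
      μ.map (fun s' => s'.matrix 3 n m) =
        (iidSamples p (l * 128 * R)).map (sampledProduct p A B) := by
  have hsr : ∀ t, t ≠ 2 → (s.withParams ε δ).real t = s.real t := fun t ht => by
    rw [Store.withParams, setReal_real_ne _ _ _ _ ht, setReal_real_ne _ _ _ _ ht]
  have hsn : (s.withParams ε δ).nat = s.nat := rfl
  obtain ⟨s₁, hE₁, h12, h13, h14⟩ := chooseSizes_runs (M := M) (s := s.withParams ε δ) (ε := ε)
    (δ := δ) (N2 := N2) (X := X) hM (by simp [Store.withParams]) (by simp [Store.withParams])
    (by rw [hsr _ (by omega), hs.norm]) (by rw [hsr _ (by omega), hs.thr]) hR hl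
  have hf₁ := hE₁.frame (s' := s₁) (by simp)
  have hn₁ : ∀ t, t ≠ 12 → t ≠ 13 → t ≠ 14 → t ≠ 19 → s₁.nat (M + t) = s.nat (M + t) :=
    fun t h1 h2 h3 h4 => by
      rw [hf₁.nat _ (by simp [Cmd.WN, chooseSizes, forTo, setN, setR, h1, h2, h3, h4]), hsn]
  have hr₁ : ∀ t, t ≠ 13 → s₁.real (M + t) = s.real (M + t) := fun t h1 => by
    rw [hf₁.real _ (by simp [Cmd.WR, chooseSizes, forTo, setN, setR, h1]), hsr _ (by omega)]
  obtain ⟨μ, hE₂, hμ⟩ := sampleAll_ev (M := M) (s := s₁) (p := p) h14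
    (by rw [hn₁ 2 (by omega) (by omega) (by omega) (by omega), hs.q_eq])
    (by rw [hn₁ 6 (by omega) (by omega) (by omega) (by omega),
          hn₁ 7 (by omega) (by omega) (by omega) (by omega), hr₁ 12 (by omega), hp])
  have key : ∀ s₂, ∃ s₃, s₂ ∈ μ.support →
      Ev (multiply M mm) s₂ (2 * (n * (m * 4 + 6)) + l * 128 * ((n ⌈/⌉ R) *
          ((m ⌈/⌉ R) * (T + 3 * (R * (R * 4 + 6)) + 17) + 6) + 8) + 13) (PMF.pure s₃) ∧
      ∀ i < n, ∀ j < m, s₃.real 3 i j = ∑ t ∈ Finset.range (l * 128 * R),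
        sampleTerm q (l * 128 * R) (s₂.nat (M + 15)) (s.real (M + 1)) (s.real (M + 2))
          (fun k => s.real (M + 5) k 0) i j t := by
    intro s₂
    by_cases hs₂ : s₂ ∈ μ.support
    · have hf₂ := hE₂.frame hs₂
      have hn₂ : ∀ t, t ≠ 15 → t ≠ 16 → t ≠ 17 → t ≠ 18 → s₂.nat (M + t) = s₁.nat (M + t) :=
        fun t h1 h2 h3 h4 =>
          hf₂.nat _ (by simp [Cmd.WN, sampleAll, sampleOnce, storeSample, setN, h1, h2, h3, h4])
      have hr₂ : ∀ t, s₂.real t = s₁.real t := fun t =>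
        hf₂.real _ (by simp [Cmd.WR, sampleAll, sampleOnce, storeSample, setN])
      have hctx : MulCtx M n q m R (l * 128 * R) (s₂.nat (M + 15)) (s.real (M + 1)) (s.real (M + 2))
          (fun k => s.real (M + 5) k 0) s₂ := by
        refine ⟨?_, ?_, ?_, ?_, ?_, rfl, ?_, ?_, ?_⟩
        · rw [hn₂ 1 (by omega) (by omega) (by omega) (by omega),
            hn₁ 1 (by omega) (by omega) (by omega) (by omega), hs.n_eq]
        · rw [hn₂ 2 (by omega) (by omega) (by omega) (by omega),
            hn₁ 2 (by omega) (by omega) (by omega) (by omega), hs.q_eq]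
        · rw [hn₂ 3 (by omega) (by omega) (by omega) (by omega),
            hn₁ 3 (by omega) (by omega) (by omega) (by omega), hs.m_eq]
        · rw [hn₂ 12 (by omega) (by omega) (by omega) (by omega), h12]
        · rw [hn₂ 14 (by omega) (by omega) (by omega) (by omega), h14]
        · rw [hr₂, hr₁ 1 (by omega)]
        · rw [hr₂, hr₁ 2 (by omega)]
        · intro k; rw [hr₂, hr₁ 5 (by omega)]
      obtain ⟨s₃, h₃⟩ := multiply_runs hM hWN hWR hmm hR0 (L := l * 128)
        (by rw [hn₂ 13 (by omega) (by omega) (by omega) (by omega), h13]) hctx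
      exact ⟨s₃, fun _ => h₃⟩
    · exact ⟨s, fun h => absurd h hs₂⟩
  choose fin hfin using key
  refine ⟨μ.bind fun s₂ => PMF.pure (fin s₂), ?_, ?_⟩
  · have := Ev.seq (ν := fun _ => μ.bind fun s₂ => PMF.pure (fin s₂)) hE₁ (by
      simpa using Ev.seq hE₂ fun s₂ hs₂ => (hfin s₂ hs₂).1)
    rw [PMF.pure_bind] at this
    exact this
  · have h1 : (μ.bind fun s₂ => PMF.pure (fin s₂)).map (fun s' => s'.matrix 3 n m) =
        μ.map (fun s₂ => (fin s₂).matrix 3 n m) := by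
      rw [PMF.map_bind, ← PMF.bind_pure_comp]
      simp only [PMF.pure_map]
      rfl
    -- On the support the output is this function of the sampled indices alone, so its law is the
    -- image of the law of the samples.
    set G : (Fin (l * 128 * R) → ℕ) → Matrix (Fin n) (Fin m) ℝ := fun j i i' =>
      ∑ t, s.real (M + 1) i (j t) * (s.real (M + 2) (j t) i' /
        ((l * 128 * R : ℕ) * (s.real (M + 5) (j t) 0 / q))) with hG
    have h2 : μ.map (fun s₂ => (fin s₂).matrix 3 n m) =
        (μ.map (fun s' (t : Fin (l * 128 * R)) => s'.nat (M + 15) t)).map G := by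
      rw [PMF.map_comp]
      refine map_congr_support fun s₂ hs₂ => ?_
      ext i j
      rw [Store.matrix, (hfin s₂ hs₂).2 i i.2 j j.2, Finset.sum_range]
      rfl
    rw [h1, h2, hμ, PMF.map_comp]
    congr 1
    funext j
    ext i i'
    simp only [Function.comp, hG, sampledProduct]
    refine Finset.sum_congr rfl fun t _ => ?_
    rw [hs.left _ i.2 _ (j t).2, hs.right _ (j t).2 _ i'.2, hs.mass _ (j t).2, hA, hB, hpP]

end RealRAM

namespace RealRAM

/-! ### Running time and failure probability -/

theorem ceilDiv_mul_le {R n : ℕ} (hR : 0 < R) (hRn : R ≤ n) : (n ⌈/⌉ R) * R ≤ 2 * n := by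
  rcases Nat.eq_zero_or_pos (n ⌈/⌉ R) with h | h
  · simp [h]
  · have := (lt_ceilDiv_iff_mul_lt hR (m := n) (y := n ⌈/⌉ R - 1)).1 (by omega)
    rw [Nat.sub_mul, one_mul] at this
    omega

/-- There are at most `(2n / R) (2m / R)` blocks per round, each of cost `O(R ^ ω)`, and `R ^ ω ≤ R²
r ^ (ω - 2)`. The other costs are dominated because `R ≤ n`, `1 ≤ m` and `1 ≤ r ^ (ω - 2)`. -/
theorem running_time_le {n m R l T a b : ℕ} {ω r K y : ℝ} (hR0 : 0 < R) (hRn : R ≤ n)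
    (hRm : R ≤ m) (hRr : (R : ℝ) ≤ r) (hω : 2 ≤ ω) (hT : (T : ℝ) ≤ K * (R : ℝ) ^ ω) (hK : 0 ≤ K)
    (hl : 0 < l) (hly : (l : ℝ) ≤ 3 * y) (haR : a * R ≤ 2 * n) (hbR : b * R ≤ 2 * m) :
    (((R * 2 + l * 516 + 20) + ((l * 128 * R * 9 + 3) + (2 * (n * (m * 4 + 6)) + l * 128 *
      (a * (b * (T + 3 * (R * (R * 4 + 6)) + 17) + 6) + 8) + 13) + 1) + 1 : ℕ) : ℝ)
      ≤ (90000 + 1536 * K) * (n * m * r ^ (ω - 2) * y) := by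
  have ha : (a : ℝ) * R ≤ 2 * n := by exact_mod_cast haR
  have hb : (b : ℝ) * R ≤ 2 * m := by exact_mod_cast hbR
  have hR1 : (1 : ℝ) ≤ R := by exact_mod_cast hR0
  have hRn' : (R : ℝ) ≤ n := by exact_mod_cast hRn
  have hRm' : (R : ℝ) ≤ m := by exact_mod_cast hRm
  have hl1 : (1 : ℝ) ≤ l := by exact_mod_cast hl
  set e := r ^ (ω - 2) with he
  have he1 : 1 ≤ e := Real.one_le_rpow (hR1.trans hRr) (by linarith)
  have hRω : (R : ℝ) ^ ω ≤ R ^ 2 * e := by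
    have h1 : (R : ℝ) ^ ω = (R : ℝ) ^ 2 * (R : ℝ) ^ (ω - 2) := by
      rw [← Real.rpow_natCast, ← Real.rpow_add (by linarith)]
      congr 1
      push_cast
      ring
    rw [h1]
    exact mul_le_mul_of_nonneg_left (Real.rpow_le_rpow (by linarith) hRr (by linarith))
      (by positivity)
  have hn1 : (1 : ℝ) ≤ n := hR1.trans hRn'
  have hm1 : (1 : ℝ) ≤ m := hR1.trans hRm'
  have hnm : (n : ℝ) ≤ n * m := by nlinarith
  set E := (n : ℝ) * m * e with hE
  have hnmE : (n : ℝ) * m ≤ E := by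
    rw [hE]
    nlinarith
  have hE1 : 1 ≤ E := by linarith
  -- Copying costs `O(R²)` per block, absorbed because `ω ≥ 2`; `47 = 12 + 18 + 17`.
  have hblock : (T : ℝ) + 3 * (R * (R * 4 + 6)) + 17 ≤ (K + 47) * e * R ^ 2 := by
    have h1 : (R : ℝ) ≤ R ^ 2 := by nlinarith
    have h2 : (R : ℝ) ^ 2 ≤ e * R ^ 2 := by nlinarith
    have h3 : (T : ℝ) ≤ K * (R ^ 2 * e) := hT.trans (mul_le_mul_of_nonneg_left hRω hK)
    nlinarith
  have hround : (a : ℝ) * (b * (T + 3 * (R * (R * 4 + 6)) + 17) + 6) + 8 ≤ (4 * K + 208) * E := by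
    have h1 : (a : ℝ) * (b * (T + 3 * (R * (R * 4 + 6)) + 17)) ≤ (4 * K + 188) * E := by
      calc (a : ℝ) * (b * (T + 3 * (R * (R * 4 + 6)) + 17))
          ≤ a * (b * ((K + 47) * e * R ^ 2)) := by gcongr
        _ = (K + 47) * e * ((a * R) * (b * R)) := by ring
        _ ≤ (K + 47) * e * ((2 * n) * (2 * m)) := by gcongr
        _ = (4 * K + 188) * E := by rw [hE]; ring
    have h2 : (a : ℝ) ≤ 2 * n := by nlinarith [Nat.cast_nonneg (α := ℝ) a]
    nlinarith
  have hlE : E ≤ l * E := by nlinarith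
  have hlE' : (l : ℝ) ≤ l * E := by nlinarith
  have hlR : (l : ℝ) * R ≤ l * E := by
    have : (R : ℝ) ≤ E := by linarith
    gcongr
  have hlround : (l : ℝ) * ((a : ℝ) * (b * (T + 3 * (R * (R * 4 + 6)) + 17) + 6) + 8) ≤
      l * ((4 * K + 208) * E) := by gcongr
  have hfin : (l : ℝ) * E ≤ 3 * y * E := by gcongr
  have hsum : (R : ℝ) * 2 + l * 516 + 20 + (l * 128 * R * 9 + 3 + (2 * (n * (m * 4 + 6)) + l * 128 *
      (a * (b * (T + 3 * (R * (R * 4 + 6)) + 17) + 6) + 8) + 13) + 1) + 1 ≤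
      (30000 + 512 * K) * (l * E) := by
    generalize (a : ℝ) * (b * (T + 3 * (R * (R * 4 + 6)) + 17) + 6) + 8 = Q at hlround ⊢
    have hKE : 0 ≤ K * (l * E) := by positivity
    linarith
  push_cast
  calc _ ≤ (30000 + 512 * K) * (l * E) := hsum
    _ ≤ (30000 + 512 * K) * (3 * y * E) := by gcongr
    _ = _ := by ring

/-- `l` is the least integer with `2 ^ l ≥ X / δ`. The lower bound uses `log 2 < 1`; the upper one
uses `X / δ ≥ 2`, which gives `l * log 2 ≤ 2 * log (X / δ)`, and `2 / log 2 < 3`. -/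
theorem exists_rounds {X δ : ℝ} (hX : 1 ≤ X) (hδ : 0 < δ) (hδ2 : δ ≤ 1 / 2) :
    ∃ l : ℕ, (∀ x : ℕ, x < l ↔ 2 ^ x * δ < X) ∧ 0 < l ∧ Real.log (X / δ) ≤ l ∧
      (l : ℝ) ≤ 3 * Real.log (X / δ) := by
  classical
  have hex : ∃ l : ℕ, X ≤ 2 ^ l * δ := by
    obtain ⟨l, hl⟩ := pow_unbounded_of_one_lt (X / δ) (one_lt_two (α := ℝ))
    exact ⟨l, ((div_lt_iff₀ hδ).1 hl).le⟩
  have hy : 2 ≤ X / δ := by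
    rw [le_div_iff₀ hδ]; linarith
  have hlog2 := Real.log_two_gt_d9
  have hlog : Real.log 2 ≤ Real.log (X / δ) := Real.log_le_log (by norm_num) hy
  have hchar : ∀ x : ℕ, x < Nat.find hex ↔ 2 ^ x * δ < X := by
    intro x
    constructor
    · intro h
      exact not_le.1 (Nat.find_min hex h)
    · intro h
      by_contra hx
      have h1 := Nat.find_spec hex
      have h2 : (2 : ℝ) ^ Nat.find hex ≤ 2 ^ x := pow_le_pow_right₀ (by norm_num) (not_lt.1 hx)
      nlinarith
  have hpos : 0 < Nat.find hex := (hchar 0).2 (by norm_num; linarith)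
  refine ⟨Nat.find hex, hchar, hpos, ?_, ?_⟩
  · have h1 : X / δ ≤ 2 ^ Nat.find hex := (div_le_iff₀ hδ).2 (Nat.find_spec hex)
    have h2 := Real.log_le_log (by linarith) h1
    rw [Real.log_pow] at h2
    have h3 := Real.log_two_lt_d9
    have : (0 : ℝ) ≤ Nat.find hex := Nat.cast_nonneg _
    nlinarith
  · obtain ⟨k, hk⟩ : ∃ k, Nat.find hex = k + 1 := ⟨Nat.find hex - 1, by omega⟩
    have h1 : (2 : ℝ) ^ k < X / δ := (lt_div_iff₀ hδ).2 ((hchar k).1 (by omega))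
    have h2 := Real.log_le_log (by positivity) h1.le
    rw [Real.log_pow] at h2
    rw [hk]
    push_cast
    have : (0 : ℝ) ≤ k := Nat.cast_nonneg _
    nlinarith

theorem sampleMultiply_haltsWith {ω K : ℝ} (hω : 2 ≤ ω) (hK : 0 ≤ K) {mm : Cmd} {M : ℕ}
    (hM : 4 ≤ M) (hmmM : mm.bound ≤ M)
    (hmm : ∀ (n : ℕ) (s : Store), 0 < n → s.nat 0 0 = n → ∃ s' : Store,
      HaltsWith mm s (K * (n : ℝ) ^ ω) (PMF.pure s') ∧
      s'.matrix 3 n n = s.matrix 0 n n * s.matrix 1 n n)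
    {n q m : ℕ} {α β : ℕ → ℕ → ℝ} {P : ℕ → ℝ} {N2 X : ℝ} {s : Store}
    (hs : Prepared M n q m α β P N2 X s) (hX : 1 ≤ X) {p : PMF (Fin q)}
    (hp : (uniformBelow q).bind (fun u => (coin (s.real (M + 12) u 0)).map
      (fun b => if 0 < b then s.nat (M + 6) u else s.nat (M + 7) u)) = p.map Fin.val)
    (hpP : ∀ k, (p k).toReal = P k / q) {A : Matrix (Fin n) (Fin q) ℝ}
    {B : Matrix (Fin q) (Fin m) ℝ} (hA : ∀ (i : Fin n) (k : Fin q), α i k = A i k)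
    (hB : ∀ (k : Fin q) (j : Fin m), β k j = B k j) {ε δ : ℝ} (hε : 0 < ε) (hδ : 0 < δ)
    (hδ2 : δ ≤ 1 / 2) (hr1 : 1 ≤ N2 / ε ^ 2) (hr : N2 / ε ^ 2 ≤ min (n : ℝ) m) :
    ∃ (c : ℕ) (μ : PMF Store), 0 < c ∧
      HaltsWith (sampleMultiply M mm) (s.withParams ε δ)
        ((90000 + 1536 * K) * (n * m * (N2 / ε ^ 2) ^ (ω - 2) * Real.log (X / δ))) μ ∧
      μ.map (fun s' => s'.matrix 3 n m) = (iidSamples p c).map (sampledProduct p A B) ∧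
      64 * (N2 / ε ^ 2) * Real.log (X / δ) ≤ c := by
  obtain ⟨l, hl, hl0, hll, hlu⟩ := exists_rounds hX hδ hδ2
  set r := N2 / ε ^ 2 with hrdef
  set R := ⌊r⌋₊ with hRdef
  have hR0 : 0 < R := Nat.floor_pos.2 hr1
  have hRr : (R : ℝ) ≤ r := Nat.floor_le (by linarith)
  have hrR : r < R + 1 := Nat.lt_floor_add_one r
  have hRn : R ≤ n := by exact_mod_cast hRr.trans (hr.trans (min_le_left _ _))
  have hRm : R ≤ m := by exact_mod_cast hRr.trans (hr.trans (min_le_right _ _))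
  have hR : ∀ x : ℕ, x < R ↔ (x + 1) * (ε * ε) ≤ N2 := by
    intro x
    rw [hRdef, ← Nat.add_one_le_iff, Nat.le_floor_iff (by linarith), hrdef,
      le_div_iff₀ (by positivity)]
    push_cast
    rw [pow_two]
  have hWN : ∀ k, ¬ mm.WN (M + k) := fun k h => by
    have := Cmd.WN_lt_bound h; omega
  have hWR : ∀ k, ¬ mm.WR (M + k) := fun k h => by
    have := Cmd.WR_lt_bound h; omega
  obtain ⟨μ, hE, hμ⟩ := sampleMultiply_ev (T := ⌊K * (R : ℝ) ^ ω⌋₊) hM hWN hWR (fun s' hs' => by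
    obtain ⟨s'', h1, h2⟩ := hmm R s' hR0 hs'
    exact ⟨s'', h1.ev, h2⟩) hR0 hs hR hl hp hpP hA hB
  refine ⟨l * 128 * R, μ, by positivity, hE.haltsWith (running_time_le hR0 hRn hRm hRr hω
    (Nat.floor_le (by positivity)) hK hl0 hlu
    (ceilDiv_mul_le hR0 hRn) (ceilDiv_mul_le hR0 hRm)), hμ, ?_⟩
  have hR1 : (1 : ℝ) ≤ R := by exact_mod_cast hR0
  push_cast
  -- From `r < R + 1` and `1 ≤ R`; this factor `2` is why `128` rounds per unit of `l` give `64 r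
  -- log (X / δ)` samples.
  have h1 : r ≤ 2 * R := by linarith
  have h2 : 0 ≤ (l : ℝ) := Nat.cast_nonneg _
  calc 64 * r * Real.log (X / δ) ≤ 64 * r * l := by gcongr
    _ ≤ 64 * (2 * R) * l := by gcongr
    _ = _ := by ring

theorem sqrt_accumulate_weights {ρ : ℝ≥0∞} (hρ : ρ = ∞ ∨ ρ = 2) {n q m : ℕ}
    {A : Matrix (Fin n) (Fin q) ℝ} {B : Matrix (Fin q) (Fin m) ℝ} {a b : ℕ → ℝ}
    (ha : ∀ k : Fin q, a k = ‖WithLp.toLp ρ (fun i => A i k)‖ ^ 2)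
    (hb : ∀ k : Fin q, b k = ‖WithLp.toLp ρ (fun j => B k j)‖ ^ 2) (k : Fin q) :
    Real.sqrt (a k * b k) = columnRowWeight ρ A B k := by
  rw [ha, hb, ← mul_pow, Real.sqrt_sq]
  · rfl
  · exact mul_nonneg (norm_toLp_nonneg_of hρ _) (norm_toLp_nonneg_of hρ _)

/-- Column sampling for a norm `ν`, given a tail bound for the error of the sketch. -/
theorem exists_sampling_algorithm {ω : ℝ} (hω2 : 2 ≤ ω) (hω : MatMulExponent ω) {ρ : ℝ≥0∞}
    (hρ : ρ = ∞ ∨ ρ = 2) {comb : RExp → RExp → RExp} {op : ℝ → ℝ → ℝ}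
    (hop : ∀ s x y, (comb x y).eval s = op (x.eval s) (y.eval s))
    (hacc : ∀ (f : ℕ → ℝ) (n : ℕ),
      accumulate op f n = ‖WithLp.toLp ρ (fun i : Fin n => f i)‖ ^ 2)
    (thr : ℕ → RExp) (X : ℕ → ℕ → ℝ)
    (hthr : ∀ M n m s, s.nat (M + 1) 0 = n → s.nat (M + 3) 0 = m → (thr M).eval s = X n m)
    (hX : ∀ n m, 0 < n → 0 < m → 1 ≤ X n m)
    (ν : ∀ {n m : ℕ}, Matrix (Fin n) (Fin m) ℝ → ℝ)
    (htail : ∀ {n q m : ℕ} {A : Matrix (Fin n) (Fin q) ℝ} {B : Matrix (Fin q) (Fin m) ℝ}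
      {p : PMF (Fin q)}, IsProportional p (columnRowWeight ρ A B) → ∀ {ε : ℝ}, 0 < ε →
      ε ≤ elementNorm ρ 2 Aᵀ * elementNorm ρ 2 B → ∀ {c : ℕ},
      4 * (elementNorm ρ 2 Aᵀ * elementNorm ρ 2 B) ^ 2 ≤ c * ε ^ 2 →
      ENNReal.ofReal (1 - X n m *
        Real.exp (-(c * ε ^ 2 / (64 * (elementNorm ρ 2 Aᵀ * elementNorm ρ 2 B) ^ 2)))) ≤
      (iidSamples p c).toOuterMeasure {j | ν (sampledProduct p A B j - A * B) ≤ ε}) :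
    ∃ (pre main : Cmd) (K : ℝ),
      ∀ (n q m : ℕ) (A : Matrix (Fin n) (Fin q) ℝ) (B : Matrix (Fin q) (Fin m) ℝ) (s : Store),
        0 < n → 0 < q → 0 < m → HoldsInput s A B →
        ∃ (s₁ : Store) (p : PMF (Fin q)),
          HaltsWith pre s (K * (n * q + q * m)) (PMF.pure s₁) ∧
          IsProportional p (columnRowWeight ρ A B) ∧
          ∀ ε δ : ℝ, 0 < ε → 0 < δ → δ ≤ 1 / 2 →
            1 ≤ elementNorm ρ 2 Aᵀ ^ 2 * elementNorm ρ 2 B ^ 2 / ε ^ 2 →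
            elementNorm ρ 2 Aᵀ ^ 2 * elementNorm ρ 2 B ^ 2 / ε ^ 2 ≤ min (n : ℝ) m →
            ∃ (c : ℕ) (μ : PMF Store),
              0 < c ∧
              HaltsWith main (s₁.withParams ε δ)
                (K * (n * m *
                  (elementNorm ρ 2 Aᵀ ^ 2 * elementNorm ρ 2 B ^ 2 / ε ^ 2) ^ (ω - 2) *
                  Real.log (X n m / δ))) μ ∧
              μ.map (fun s' => s'.matrix 3 n m) =
                (columnSampleSketch p c).map (fun S => A * Sᵀ * S * B) ∧
              ENNReal.ofReal (1 - δ) ≤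
                μ.toOuterMeasure {s' | ν (s'.matrix 3 n m - A * B) ≤ ε} := by
  obtain ⟨mm, K, hmm⟩ := hω
  -- A step count for `1 × 1` matrices is nonnegative and at most `K`.
  have hK : 0 ≤ K := by
    obtain ⟨s', ⟨t, ht, -⟩, -⟩ := hmm 1 ⟨fun _ _ => 1, fun _ _ _ => 0⟩ one_pos rfl
    have : (0 : ℝ) ≤ t := Nat.cast_nonneg _
    simp at ht
    linarith
  -- `mm` writes only below `M`. It may still read private arrays, but its specification allows
  -- arbitrary contents there.
  set M := max 4 mm.bound with hMdef
  have hM : 4 ≤ M := le_max_left _ _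
  refine ⟨preprocess M comb (thr M), sampleMultiply M mm, 90000 + 1536 * K, ?_⟩
  rintro n q m A B s hn hq hm ⟨hsn, hsq, hsm, hsA, hsB⟩
  set a : ℕ → ℝ := fun k => accumulate op (fun i => s.real 0 i k) n
  set b : ℕ → ℝ := fun k => accumulate op (fun j => s.real 1 k j) m
  have hA : ∀ (i : Fin n) (k : Fin q), s.real 0 i k = A i k := fun i k => by rw [← hsA]; rfl
  have hB : ∀ (k : Fin q) (j : Fin m), s.real 1 k j = B k j := fun k j => by rw [← hsB]; rfl
  have ha : ∀ k : Fin q, a k = ‖WithLp.toLp ρ (fun i => A i k)‖ ^ 2 := fun k => by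
    simp only [a, hacc, hA]
  have hb : ∀ k : Fin q, b k = ‖WithLp.toLp ρ (fun j => B k j)‖ ^ 2 := fun k => by
    simp only [b, hacc, hB]
  have hN2 : (∑ k ∈ Finset.range q, a k) * ∑ k ∈ Finset.range q, b k =
      elementNorm ρ 2 Aᵀ ^ 2 * elementNorm ρ 2 B ^ 2 := by
    rw [elementNorm_two, elementNorm_two, Real.sq_sqrt (by positivity),
      Real.sq_sqrt (by positivity), Finset.sum_range, Finset.sum_range]
    simp only [ha, hb]
    rfl
  have hw : ∀ k : Fin q, Real.sqrt (a k * b k) = columnRowWeight ρ A B k :=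
    sqrt_accumulate_weights hρ ha hb
  obtain ⟨s₁, hE, hs₁⟩ := preprocess_runs hop (hthr M n m) hM hq hsn hsq hsm (fun k => rfl)
    (fun k => rfl)
  obtain ⟨p, hpP, hp⟩ := exists_pmf_of_isAliasTable hq hs₁.table
  rw [hN2] at hs₁
  have hprop : IsProportional p (columnRowWeight ρ A B) := by
    intro k
    have hsum : ∑ l, columnRowWeight ρ A B l =
        ∑ l ∈ Finset.range q, Real.sqrt (a l * b l) := by
      rw [Finset.sum_range]
      exact Finset.sum_congr rfl fun l _ => (hw l).symm
    have hq' : (q : ℝ) ≠ 0 := by positivity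
    rw [hpP, hsum, ← hw]
    change scaledWeight q (fun k => Real.sqrt (a k * b k)) k / q * _ = _
    rw [scaledWeight]
    split_ifs with h
    · have h' := h.ne'
      field_simp
    -- A vanishing total means that every weight vanishes, so both sides are zero.
    · have h0 : ∀ l ∈ Finset.range q, 0 ≤ Real.sqrt (a l * b l) := fun l _ => Real.sqrt_nonneg _
      have h1 : ∑ l ∈ Finset.range q, Real.sqrt (a l * b l) = 0 :=
        le_antisymm (not_lt.1 h) (Finset.sum_nonneg h0)
      rw [h1, (Finset.sum_eq_zero_iff_of_nonneg h0).1 h1 k (Finset.mem_range.2 k.2), mul_zero]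
  refine ⟨s₁, p, hE.haltsWith ?_, hprop, ?_⟩
  · have hn1 : (1 : ℝ) ≤ n := by exact_mod_cast hn
    have hm1 : (1 : ℝ) ≤ m := by exact_mod_cast hm
    have hq1 : (1 : ℝ) ≤ q := by exact_mod_cast hq
    -- Lets the terms linear in `q` be absorbed into `n * q + q * m`.
    have h1 : (q : ℝ) ≤ n * q := by nlinarith
    have h2 : 0 ≤ K * (n * q + q * m) := by positivity
    have h3 : (0 : ℝ) ≤ q * m := by positivity
    push_cast
    nlinarith
  intro ε δ hε hδ hδ2 hr1 hr
  obtain ⟨c, μ, hc0, hH, hμ, hc⟩ := sampleMultiply_haltsWith hω2 hK hM (le_max_right _ _) hmm hs₁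
    (hX n m hn hm) hp hpP hA hB hε hδ hδ2 hr1 hr
  refine ⟨c, μ, hc0, hH, by rw [hμ, columnSampleSketch_map], ?_⟩
  have hout : μ.toOuterMeasure {s' | ν (s'.matrix 3 n m - A * B) ≤ ε} =
      (iidSamples p c).toOuterMeasure {j | ν (sampledProduct p A B j - A * B) ≤ ε} := by
    have h1 := PMF.toOuterMeasure_map_apply (fun s' : Store => s'.matrix 3 n m) μ
      {C | ν (C - A * B) ≤ ε}
    have h2 := PMF.toOuterMeasure_map_apply (sampledProduct p A B) (iidSamples p c)
      {C | ν (C - A * B) ≤ ε}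
    rw [hμ] at h1
    exact h1.symm.trans h2
  rw [hout]
  set N := elementNorm ρ 2 Aᵀ * elementNorm ρ 2 B with hN
  have hN0 : 0 ≤ N := mul_nonneg (elementNorm_nonneg_two _ _) (elementNorm_nonneg_two _ _)
  rw [← mul_pow, ← hN] at hr1 hc
  have hε2 : 0 < ε ^ 2 := by positivity
  have hεN : ε ≤ N := by
    rw [le_div_iff₀ hε2, one_mul] at hr1
    exact le_of_sq_le_sq hr1 hN0
  have hNpos : 0 < N := hε.trans_le hεN
  have hX1 := hX n m hn hm
  -- Since `X / δ ≥ 2`. Then `64 N² log (X / δ) ≥ 32 N²`, which covers the requirement `4 N² ≤ c ε²`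
  -- of the tail bound.
  have hlog : 1 / 2 ≤ Real.log (X n m / δ) := by
    have h1 : Real.log 2 ≤ Real.log (X n m / δ) :=
      Real.log_le_log (by norm_num) (by rw [le_div_iff₀ hδ]; linarith)
    linarith [Real.log_two_gt_d9]
  have hc' : 64 * N ^ 2 * Real.log (X n m / δ) ≤ c * ε ^ 2 := by
    have := mul_le_mul_of_nonneg_right hc hε2.le
    calc 64 * N ^ 2 * Real.log (X n m / δ)
        = 64 * (N ^ 2 / ε ^ 2) * Real.log (X n m / δ) * ε ^ 2 := by field_simp
      _ ≤ _ := this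
  refine le_trans (ENNReal.ofReal_le_ofReal ?_) (htail hprop hε hεN (c := c) ?_)
  · have h1 : Real.exp (-(c * ε ^ 2 / (64 * N ^ 2))) ≤ δ / X n m := by
      have h2 : Real.log (X n m / δ) ≤ c * ε ^ 2 / (64 * N ^ 2) := by
        rw [le_div_iff₀ (by positivity)]
        linarith
      calc Real.exp (-(c * ε ^ 2 / (64 * N ^ 2))) ≤ Real.exp (-Real.log (X n m / δ)) :=
            Real.exp_le_exp.2 (neg_le_neg h2)
        _ = δ / X n m := by
            rw [Real.exp_neg, Real.exp_log (by positivity), inv_div]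
    have h3 : X n m * Real.exp (-(c * ε ^ 2 / (64 * N ^ 2))) ≤ δ := by
      calc _ ≤ X n m * (δ / X n m) := by gcongr
        _ = δ := by field_simp
    linarith
  · have : 64 * N ^ 2 * (1 / 2) ≤ 64 * N ^ 2 * Real.log (X n m / δ) := by gcongr
    nlinarith

/-- The expression is `(x + y + |x - y|) / 2 = max x y`, with the absolute value written as a square
root of a square. Starting from `0` is harmless because squares are nonnegative. -/
theorem accumulate_max (f : ℕ → ℝ) (n : ℕ) :
    accumulate (fun x y => (x + y + Real.sqrt ((x - y) * (x - y))) / 2) f n =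
      ‖WithLp.toLp ∞ (fun i : Fin n => f i)‖ ^ 2 := by
  have hop : (fun x y : ℝ => (x + y + Real.sqrt ((x - y) * (x - y))) / 2) = max := by
    funext x y
    rw [Real.sqrt_mul_self_eq_abs]
    rcases le_total x y with h | h
    · rw [max_eq_right h, abs_of_nonpos (by linarith)]; ring
    · rw [max_eq_left h, abs_of_nonneg (by linarith)]; ring
  rw [hop]
  have h0 : 0 ≤ accumulate max f n := by
    cases n with
    | zero => exact le_rfl
    | succ n => exact le_max_of_le_right (mul_self_nonneg _)
  have h1 : ∀ c : ℝ, 0 ≤ c → (accumulate max f n ≤ c ^ 2 ↔ ∀ i : Fin n, |f i| ≤ c) := by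
    intro c hc
    clear h0
    induction n with
    | zero => simp [accumulate, sq_nonneg]
    | succ n ih =>
      rw [accumulate, max_le_iff, ih, Fin.forall_fin_succ', ← pow_two, sq_le_sq, abs_of_nonneg hc]
      simp
  have h2 : ∀ c : ℝ, 0 ≤ c → (‖WithLp.toLp ∞ (fun i : Fin n => f i)‖ ≤ c ↔
      ∀ i : Fin n, |f i| ≤ c) := by
    intro c hc
    rw [PiLp.norm_toLp, pi_norm_le_iff_of_nonneg hc]
    rfl
  have hn := norm_toLp_nonneg_of (Or.inl rfl : (∞ : ℝ≥0∞) = ∞ ∨ (∞ : ℝ≥0∞) = 2)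
    (fun i : Fin n => f i)
  refine le_antisymm ((h1 _ hn).2 ((h2 _ hn).1 le_rfl)) ?_
  have h3 := (h2 _ (Real.sqrt_nonneg (accumulate max f n))).2 ((h1 _ (Real.sqrt_nonneg _)).1
    (Real.sq_sqrt h0).ge)
  calc _ ≤ Real.sqrt (accumulate max f n) ^ 2 := pow_le_pow_left₀ hn h3 2
    _ = _ := Real.sq_sqrt h0

theorem accumulate_add (f : ℕ → ℝ) (n : ℕ) :
    accumulate (· + ·) f n = ‖WithLp.toLp 2 (fun i : Fin n => f i)‖ ^ 2 := by
  rw [norm_toLp_two_sq]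
  induction n with
  | zero => simp [accumulate]
  | succ n ih => simp [accumulate, ih, Fin.sum_univ_castSucc, pow_two]

end RealRAM

end

/-! ### The two norms as instances of one algorithm. -/

theorem mainTheorem10 (ω : ℝ) (hω2 : 2 ≤ ω) (hω3 : ω ≤ 3) (hω : RealRAM.MatMulExponent ω) :
    (∃ (pre main : RealRAM.Cmd) (K : ℝ),
      ∀ (n q m : ℕ) (A : Matrix (Fin n) (Fin q) ℝ) (B : Matrix (Fin q) (Fin m) ℝ)
        (s : RealRAM.Store),
        0 < n → 0 < q → 0 < m → RealRAM.HoldsInput s A B →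
        ∃ (s₁ : RealRAM.Store) (p : PMF (Fin q)),
          RealRAM.HaltsWith pre s (K * (n * q + q * m)) (PMF.pure s₁) ∧
          IsProportional p (columnRowWeight ∞ A B) ∧
          ∀ ε δ : ℝ, 0 < ε → 0 < δ → δ ≤ 1 / 2 →
            1 ≤ elementNorm ∞ 2 Aᵀ ^ 2 * elementNorm ∞ 2 B ^ 2 / ε ^ 2 →
            elementNorm ∞ 2 Aᵀ ^ 2 * elementNorm ∞ 2 B ^ 2 / ε ^ 2 ≤ min (n : ℝ) m →
            ∃ (c : ℕ) (μ : PMF RealRAM.Store),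
              0 < c ∧
              RealRAM.HaltsWith main (s₁.withParams ε δ)
                (K * (n * m *
                  (elementNorm ∞ 2 Aᵀ ^ 2 * elementNorm ∞ 2 B ^ 2 / ε ^ 2) ^ (ω - 2) *
                  Real.log (n * m / δ))) μ ∧
              μ.map (fun s' => s'.matrix 3 n m) =
                (columnSampleSketch p c).map (fun S => A * Sᵀ * S * B) ∧
              ENNReal.ofReal (1 - δ) ≤
                μ.toOuterMeasure {s' | elementNorm ∞ ∞ (s'.matrix 3 n m - A * B) ≤ ε}) ∧
    (∃ (pre main : RealRAM.Cmd) (K : ℝ),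
      ∀ (n q m : ℕ) (A : Matrix (Fin n) (Fin q) ℝ) (B : Matrix (Fin q) (Fin m) ℝ)
        (s : RealRAM.Store),
        0 < n → 0 < q → 0 < m → RealRAM.HoldsInput s A B →
        ∃ (s₁ : RealRAM.Store) (p : PMF (Fin q)),
          RealRAM.HaltsWith pre s (K * (n * q + q * m)) (PMF.pure s₁) ∧
          IsProportional p (columnRowWeight 2 A B) ∧
          ∀ ε δ : ℝ, 0 < ε → 0 < δ → δ ≤ 1 / 2 →
            1 ≤ elementNorm 2 2 A ^ 2 * elementNorm 2 2 B ^ 2 / ε ^ 2 →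
            elementNorm 2 2 A ^ 2 * elementNorm 2 2 B ^ 2 / ε ^ 2 ≤ min (n : ℝ) m →
            ∃ (c : ℕ) (μ : PMF RealRAM.Store),
              0 < c ∧
              RealRAM.HaltsWith main (s₁.withParams ε δ)
                (K * (n * m *
                  (elementNorm 2 2 A ^ 2 * elementNorm 2 2 B ^ 2 / ε ^ 2) ^ (ω - 2) *
                  Real.log (1 / δ))) μ ∧
              μ.map (fun s' => s'.matrix 3 n m) =
                (columnSampleSketch p c).map (fun S => A * Sᵀ * S * B) ∧
              ENNReal.ofReal (1 - δ) ≤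
                μ.toOuterMeasure {s' | elementNorm 2 2 (s'.matrix 3 n m - A * B) ≤ ε}) := by
  constructor
  · refine RealRAM.exists_sampling_algorithm hω2 hω (Or.inl rfl)
      (comb := fun x y => .div (.add (.add x y) (.sqrt (.mul (.sub x y) (.sub x y))))
        (.ofNat (.const 2)))
      (op := fun x y => (x + y + Real.sqrt ((x - y) * (x - y))) / 2)
      (fun s x y => by simp [RealRAM.RExp.eval, RealRAM.NExp.eval]) RealRAM.accumulate_max
      (fun M => .mul (.ofNat (RealRAM.nv (M + 1))) (.ofNat (RealRAM.nv (M + 3))))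
      (fun n m => (n : ℝ) * m)
      (fun M n m s hn hm => by
        simp [RealRAM.RExp.eval, RealRAM.NExp.eval, RealRAM.nv, hn, hm])
      (fun n m hn hm => by exact_mod_cast Nat.mul_pos hn hm)
      (fun C => elementNorm ∞ ∞ C) sampledProduct_max_norm
  · have h := RealRAM.exists_sampling_algorithm hω2 hω (Or.inr rfl)
      (comb := fun x y => .add x y) (op := (· + ·))
      (fun s x y => rfl) RealRAM.accumulate_add
      (fun M => .ofNat (.const 1)) (fun n m => 1)
      (fun M n m s hn hm => by simp [RealRAM.RExp.eval, RealRAM.NExp.eval])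
      (fun n m hn hm => le_rfl)
      (fun C => elementNorm 2 2 C) (fun hp ε hε hεN c hc => by
        rw [one_mul]
        exact sampledProduct_frobenius_norm hp hε hεN hc)
    -- The general statement speaks of `Aᵀ`; the Frobenius norm is invariant under transposition.
    simpa only [elementNorm_two_two_transpose] using h
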